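/- **Setting.** Let $(\Omega,\mathcal F)$ be a measurable space and let $C_{l,Lip}(\mathbb R^n)$ be the set of $\varphi:\mathbb R^n\to\mathbb R$ with $|\varphi(x)-\varphi(y)|\le C(1+|x|^m+|y|^m)|x-y|$ for some $C>0$, $m\in\mathbb N$. Let $\mathcal H$ be a set of real random variables on $(\Omega,\mathcal F)$ such that $\varphi(X_1,\dots,X_n)\in\mathcal H$ whenever $X_1,\dots,X_n\in\mathcal H$ and $\varphi\in C_{l,Lip}(\mathbb R^n)$. Let $\mathbb E:\mathcal H\to[-\infty,\infty]$ be a sub-linear expectation: it is monotone, $\mathbb E[c]=c$ for $c\in\mathbb R$, $\mathbb E[\lambda X]=\lambda\mathbb E[X]$ for $\lambda\ge0$, and $\mathbb E[X+Y]\le\mathbb E[X]+\mathbb E[Y]$ unless the right-hand side is of the form $\infty-\infty$. Put $\mathbb V(A)=\inf\{\mathbb E[\xi]: I_A\le\xi,\ \xi\in\mathcal H\}$ and $$C_{\mathbb V}(X)=\int_0^\infty \mathbb V(X>x)\,dx+\int_{-\infty}^0(\mathbb V(X>x)-1)\,dx .$$ Assume that $\mathbb E$ is countably sub-additive, i.e.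 $\mathbb E[X]\le\sum_{n\ge1}\mathbb E[X_n]$ whenever $X,X_n\in\mathcal H$, $X\ge0$, $X_n\ge0$, $X\le\sum_{n\ge1} X_n$, and that $\mathbb V$ is countably sub-additive on $\mathcal F$, i.e. $\mathbb V(\bigcup_n A_n)\le\sum_n\mathbb V(A_n)$. A random vector $\mathbf Y$ in $\mathbb R^n$ is negatively dependent to a random vector $\mathbf X$ in $\mathbb R^m$ (components in $\mathcal H$) if $\mathbb E[\psi_1(\mathbf X)\psi_2(\mathbf Y)]\le\mathbb E[\psi_1(\mathbf X)]\,\mathbb E[\psi_2(\mathbf Y)]$ for all $\psi_1\in C_{l,Lip}(\mathbb R^m)$, $\psi_2\in C_{l,Lip}(\mathbb R^n)$, both coordinatewise nondecreasing or both coordinatewise nonincreasing, with $\psi_1(\mathbf X)\ge0$, $\mathbb E[\psi_2(\mathbf Y)]\ge0$, $\mathbb E[\psi_1(\mathbf X)\psi_2(\mathbf Y)]<\infty$, $\mathbb E|\psi_1(\mathbf X)|<\infty$, $\mathbb E|\psi_2(\mathbf Y)|<\infty$. A two-sided sequence $(Y_i)_{i\in\mathbb Z}$ is negatively dependent if $Y_{i+n}$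 is negatively dependent to $(Y_i,\dots,Y_{i+n-1})$ for all $i\in\mathbb Z$, $n\ge1$. Random variables $X,Y\in\mathcal H$ are identically distributed if $\mathbb E[\psi(X)]=\mathbb E[\psi(Y)]$ for every $\psi\in C_{l,Lip}(\mathbb R)$ for which both sides are finite. **Theorem.** Let $l$ be positive and measurable on $[0,\infty)$ and slowly varying at infinity, i.e. $l(\lambda x)/l(x)\to1$ as $x\to\infty$ for every $\lambda>0$. Let $(a_i)_{i\in\mathbb Z}$ be real with $\sum_i|a_i|<\infty$, let $p\ge1$ and $r\ge\max\{2,p\}$, and let $(f(n))_{n\ge1}$, $(g(n))_{n\ge1}$ be sequences of positive numbers such that * (C1) $f$ is nondecreasing, $f(n)\to\infty$ and $n/f^p(n)\to0$; * (C2) $\sum_{m=1}^{k}\log\frac{f(m+1)}{f(m)}\sum_{n=1}^{m}\frac{n g(n)l(n)}{f(n)}=O(f^{p-1}(k)l(k))$; * (C3) $\sum_{m=k}^{\infty}[f^{1-r}(m)-f^{1-r}(m+1)]\sum_{n=1}^{m}\frac{n g(n)l(n)}{f(n)}=O(f^{p-r}(k)l(k))$ (the series being convergent); * (C4) $\sum_{m=1}^{k}[f(m+1)-f(m)]\sum_{n=1}^{m}\frac{n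 g(n)l(n)}{f(n)}=O(f^{p}(k)l(k))$; * (C5) $\sum_{m=1}^{\infty}[f^{1-r}(m)-f^{1-r}(m+1)]f^{t}(m+1)\sum_{n=1}^{m}\frac{n^{r/2}g(n)l(n)}{f(n)}<\infty$, where $t=\max\{0,2-p\}\,r/2$; * (C6) $\sum_{m=1}^{\infty}[f(m+1)-f(m)]f^{t'}(m+1)\sum_{n=1}^{m}\frac{n^{r/2}g(n)l(n)}{f(n)}<\infty$, where $t'=-\min\{2,p\}\,r/2$. Let $f^{-1}:[0,\infty)\to[0,\infty)$ be an inverse function of $f$, i.e. any nondecreasing function with $n\le f^{-1}(y)\le n+1$ whenever $n\ge1$ and $f(n)\le y<f(n+1)$ (for example the inverse of a strictly increasing extension of $f$ to a real variable, or $y\mapsto\max\{n: f(n)\le y\}$ for $y\ge f(1)$ and $0$ for $y<f(1)$). Let $(Y_i)_{i\in\mathbb Z}$ be a negatively dependent sequence in $\mathcal H$ such that every $Y_i$ is identically distributed as some $Y\in\mathcal H$ with $\mathbb E(Y)=\mathbb E(-Y)=0$ and $$C_{\mathbb V}\big(|Y|^p\,(1\vee l(f^{-1}(|Y|)))\big)<\infty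 .$$ Then, for every $n\ge1$, the series $X_n=\sum_{i\in\mathbb Z}a_iY_{i+n}$ converges absolutely outside a set of $\mathbb V$-capacity $0$ (put $X_n=0$ on that set), and for every $\varepsilon>0$ $$\sum_{n=1}^{\infty}\frac{g(n)l(n)}{f(n)}\,C_{\mathbb V}\Big\{\Big(\max_{1\le k\le n}\Big|\sum_{j=1}^{k}X_j\Big|-\varepsilon f(n)\Big)^{+}\Big\}<\infty .$$ -/

import Mathlib

open Set Filter Topology MeasureTheory Asymptotics

/-- The class `C_{l,Lip}` of real functions with locally Lipschitz growth:
`|φ x - φ y| ≤ C (1 + |x|^m + |y|^m) |x - y|` for some `C > 0` and `m ∈ ℕ`.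
It is used on `ℝ` and on `Fin n → ℝ`; since all norms on `ℝⁿ` are equivalent and `C` is free, the
choice of the norm does not change the class. -/
def LocLip {F : Type*} [NormedAddCommGroup F] (φ : F → ℝ) : Prop :=
  ∃ C : ℝ, 0 < C ∧ ∃ m : ℕ, ∀ x y : F, |φ x - φ y| ≤ C * (1 + ‖x‖ ^ m + ‖y‖ ^ m) * ‖x - y‖

/-- A sub-linear expectation space on a measurable space `Ω`: a set `H` of (measurable) random
variables, stable under `C_{l,Lip}` functions of finitely many of its members, with a functional
`E` on `H` with values in `[-∞, ∞]`. The values of `E` outside `H` carry no meaning and are never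
used. -/
structure SublinearExpectation (Ω : Type*) [MeasurableSpace Ω] where
  /-- the set of admissible random variables -/
  H : Set (Ω → ℝ)
  measurable_of_mem : ∀ X ∈ H, Measurable X
  comp_mem : ∀ (n : ℕ) (X : Fin n → Ω → ℝ), (∀ i, X i ∈ H) →
    ∀ φ : (Fin n → ℝ) → ℝ, LocLip φ → (fun ω => φ (fun i => X i ω)) ∈ H
  /-- the sub-linear expectation -/
  E : (Ω → ℝ) → EReal
  mono : ∀ X ∈ H, ∀ Y ∈ H, (∀ ω, Y ω ≤ X ω) → E Y ≤ E X
  const : ∀ c : ℝ, E (fun _ => c) = (c : EReal)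
  pos_homogeneous : ∀ X ∈ H, ∀ c : ℝ, 0 ≤ c → E (fun ω => c * X ω) = (c : EReal) * E X
  subadd : ∀ X ∈ H, ∀ Y ∈ H, ¬ (E X = ⊤ ∧ E Y = ⊥) → ¬ (E X = ⊥ ∧ E Y = ⊤) →
    E (fun ω => X ω + Y ω) ≤ E X + E Y

namespace SublinearExpectation

variable {Ω : Type*} [MeasurableSpace Ω] (S : SublinearExpectation Ω)

/-- The upper capacity `V(A) = inf {E[ξ] : I_A ≤ ξ, ξ ∈ H}`. -/
noncomputable def capacity (A : Set Ω) : EReal :=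
  sInf {e : EReal | ∃ ξ ∈ S.H, (∀ ω, A.indicator (fun _ => (1 : ℝ)) ω ≤ ξ ω) ∧ e = S.E ξ}

theorem const_mem (c : ℝ) : (fun _ : Ω => c) ∈ S.H :=
  S.comp_mem 0 (fun i => i.elim0) (fun i => i.elim0) (fun _ => c)
    ⟨1, one_pos, 0, fun x y => by simp; positivity⟩

/-- Capacities lie in `[0, 1]`, so nothing is lost by `EReal.toENNReal` below. -/
theorem capacity_nonneg (A : Set Ω) : 0 ≤ S.capacity A := by
  refine le_sInf ?_
  rintro e ⟨ξ, hξ, h, rfl⟩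
  have h0 := S.mono ξ hξ _ (S.const_mem 0) (fun ω =>
    (Set.indicator_nonneg (fun _ _ => zero_le_one) ω).trans (h ω))
  simpa [S.const 0] using h0

theorem capacity_le_one (A : Set Ω) : S.capacity A ≤ 1 := by
  refine sInf_le ⟨fun _ => 1, S.const_mem 1, fun ω => ?_, ?_⟩
  · exact Set.indicator_le_self' (fun _ _ => zero_le_one) ω
  · simp [S.const 1]

/-- The Choquet integral
`C_V(X) = ∫_0^∞ V(X > x) dx + ∫_{-∞}^0 (V(X > x) - 1) dx`, with values in `[-∞, ∞]`;
the second integrand is nonpositive and is written as minus the integral of `1 - V(X > x)`.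
For `X ≥ 0` it vanishes, so that `C_V(X)` is the first integral and is nonnegative. -/
noncomputable def choquet (X : Ω → ℝ) : EReal :=
  ((∫⁻ x in Ioi (0 : ℝ), (S.capacity {ω | x < X ω}).toENNReal : ENNReal) : EReal)
    - ((∫⁻ x in Iio (0 : ℝ), (1 - S.capacity {ω | x < X ω}).toENNReal : ENNReal) : EReal)

/-- Countable sub-additivity of the sub-linear expectation on `H`: `E[X] ≤ ∑ E[Xₙ]` whenever
`X ≤ ∑ Xₙ` pointwise, for nonnegative members of `H`. Both sums are taken in `[0, ∞]`, all
quantities being nonnegative. -/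
def CountablySubadditive : Prop :=
  ∀ X ∈ S.H, ∀ Z : ℕ → Ω → ℝ, (∀ n, Z n ∈ S.H) → (∀ ω, 0 ≤ X ω) → (∀ n ω, 0 ≤ Z n ω) →
    (∀ ω, ENNReal.ofReal (X ω) ≤ ∑' n, ENNReal.ofReal (Z n ω)) →
    (S.E X).toENNReal ≤ ∑' n, (S.E (Z n)).toENNReal

/-- Countable sub-additivity of the capacity on events. -/
def CapacityCountablySubadditive : Prop :=
  ∀ A : ℕ → Set Ω, (∀ n, MeasurableSet (A n)) →
    (S.capacity (⋃ n, A n)).toENNReal ≤ ∑' n, (S.capacity (A n)).toENNReal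

/-- The random vector `Y` is negatively dependent to the random vector `X`. On `Fin n → ℝ`,
`Monotone` and `Antitone` mean coordinatewise nondecreasing and nonincreasing. -/
def NegDep {m n : ℕ} (X : Fin m → Ω → ℝ) (Y : Fin n → Ω → ℝ) : Prop :=
  ∀ (ψ₁ : (Fin m → ℝ) → ℝ) (ψ₂ : (Fin n → ℝ) → ℝ), LocLip ψ₁ → LocLip ψ₂ →
    ((Monotone ψ₁ ∧ Monotone ψ₂) ∨ (Antitone ψ₁ ∧ Antitone ψ₂)) →
    (∀ ω, 0 ≤ ψ₁ (fun i => X i ω)) →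
    0 ≤ S.E (fun ω => ψ₂ (fun j => Y j ω)) →
    S.E (fun ω => ψ₁ (fun i => X i ω) * ψ₂ (fun j => Y j ω)) < ⊤ →
    S.E (fun ω => |ψ₁ (fun i => X i ω)|) < ⊤ →
    S.E (fun ω => |ψ₂ (fun j => Y j ω)|) < ⊤ →
    S.E (fun ω => ψ₁ (fun i => X i ω) * ψ₂ (fun j => Y j ω))
      ≤ S.E (fun ω => ψ₁ (fun i => X i ω)) * S.E (fun ω => ψ₂ (fun j => Y j ω))

/-- A two-sided sequence of negatively dependent random variables: every variable is negatively
dependent to every finite block of variables immediately preceding it. -/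
def NegDepSeq (Y : ℤ → Ω → ℝ) : Prop :=
  ∀ (i : ℤ) (n : ℕ), 1 ≤ n →
    S.NegDep (fun k : Fin n => Y (i + (k : ℕ))) (fun _ : Fin 1 => Y (i + n))

/-- `X` and `Y` are identically distributed: `E[ψ(X)] = E[ψ(Y)]` for every `ψ` in `C_{l,Lip}(ℝ)`
for which both expectations are finite. -/
def IdentDistributed (X Y : Ω → ℝ) : Prop :=
  ∀ ψ : ℝ → ℝ, LocLip ψ →
    S.E (fun ω => ψ (X ω)) ≠ ⊤ → S.E (fun ω => ψ (X ω)) ≠ ⊥ →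
    S.E (fun ω => ψ (Y ω)) ≠ ⊤ → S.E (fun ω => ψ (Y ω)) ≠ ⊥ →
    S.E (fun ω => ψ (X ω)) = S.E (fun ω => ψ (Y ω))

end SublinearExpectation

/-- `l` is positive and measurable on `[0, ∞)` and slowly varying at infinity. -/
structure SlowlyVarying (l : ℝ → ℝ) : Prop where
  pos : ∀ x, 0 ≤ x → 0 < l x
  measurable : Measurable (fun x : Ici (0 : ℝ) => l x)
  tendsto : ∀ c : ℝ, 0 < c → Tendsto (fun x => l (c * x) / l x) atTop (𝓝 1)

/-- `finv : [0, ∞) → [0, ∞)` is an inverse function of the nondecreasing sequence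
`f(1) ≤ f(2) ≤ …`. As `f` is given at the positive integers only, every nondecreasing function that
inverts `f` at the scale of the integers is admitted: the inverse of any strictly increasing
extension of `f` to a real variable, any nondecreasing left inverse of a strictly increasing `f`,
and the generalized inverse `y ↦ max {n : f n ≤ y}`. -/
structure IsInverseSeq (f : ℕ → ℝ) (finv : ℝ → ℝ) : Prop where
  nonneg : ∀ y, 0 ≤ y → 0 ≤ finv y
  mono : MonotoneOn finv (Ici 0)
  bounds : ∀ n : ℕ, 1 ≤ n → ∀ y : ℝ, f n ≤ y → y < f (n + 1) →
    (n : ℝ) ≤ finv y ∧ finv y ≤ (n : ℝ) + 1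

/-- `weightSum q f g l m = ∑_{n=1}^m n^q g(n) l(n) / f(n)`. -/
noncomputable def weightSum (q : ℝ) (f g : ℕ → ℝ) (l : ℝ → ℝ) (m : ℕ) : ℝ :=
  ∑ n ∈ Finset.Icc 1 m, (n : ℝ) ^ q * g n * l n / f n

/-- The six conditions on the sequences `f(n)`, `g(n)`, `n ≥ 1`. Convergence of each infinite
series (all have nonnegative terms; the term of index `0` is `0`) is part of the condition. -/
structure RateConditions (p r : ℝ) (f g : ℕ → ℝ) (l : ℝ → ℝ) : Prop where
  c1_mono : ∀ n : ℕ, 1 ≤ n → f n ≤ f (n + 1)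
  c1_atTop : Tendsto f atTop atTop
  c1_tendsto : Tendsto (fun n : ℕ => (n : ℝ) / f n ^ p) atTop (𝓝 0)
  c2 : (fun k : ℕ => ∑ m ∈ Finset.Icc 1 k, Real.log (f (m + 1) / f m) * weightSum 1 f g l m)
    =O[atTop] (fun k : ℕ => f k ^ (p - 1) * l k)
  c3_summable : Summable (fun m : ℕ =>
    (f m ^ (1 - r) - f (m + 1) ^ (1 - r)) * weightSum 1 f g l m)
  c3 : (fun k : ℕ => ∑' j : ℕ,
      (f (k + j) ^ (1 - r) - f (k + j + 1) ^ (1 - r)) * weightSum 1 f g l (k + j))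
    =O[atTop] (fun k : ℕ => f k ^ (p - r) * l k)
  c4 : (fun k : ℕ => ∑ m ∈ Finset.Icc 1 k, (f (m + 1) - f m) * weightSum 1 f g l m)
    =O[atTop] (fun k : ℕ => f k ^ p * l k)
  c5 : Summable (fun m : ℕ =>
    (f m ^ (1 - r) - f (m + 1) ^ (1 - r)) * f (m + 1) ^ (max 0 (2 - p) * r / 2)
      * weightSum (r / 2) f g l m)
  c6 : Summable (fun m : ℕ =>
    (f (m + 1) - f m) * f (m + 1) ^ (-(min 2 p) * r / 2) * weightSum (r / 2) f g l m)

/-- The moving average `X_n = ∑_{i ∈ ℤ} a_i Y_{i+n}` (with value `0` at those `ω` where the series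
is not absolutely convergent). -/
noncomputable def movingAverage {Ω : Type*} (a : ℤ → ℝ) (Y : ℤ → Ω → ℝ) (n : ℕ) (ω : Ω) : ℝ :=
  ∑' i : ℤ, a i * Y (i + n) ω

/-- `max_{1 ≤ k ≤ n} |∑_{j=1}^k X_j|`, for `n ≥ 1`. -/
noncomputable def maxPartialSum {Ω : Type*} (X : ℕ → Ω → ℝ) (n : ℕ) (ω : Ω) : ℝ :=
  ⨆ k : Fin n, |∑ j ∈ Finset.Icc 1 ((k : ℕ) + 1), X j ω|

/-! ### Functions of locally Lipschitz growth -/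

theorem LocLip.of_lipschitz {F : Type*} [NormedAddCommGroup F] {φ : F → ℝ} {L : ℝ}
    (h : ∀ x y, |φ x - φ y| ≤ L * ‖x - y‖) : LocLip φ := by
  refine ⟨|L| + 1, by positivity, 0, fun x y => (h x y).trans ?_⟩
  have h1 : L ≤ (|L| + 1) * (1 + ‖x‖ ^ 0 + ‖y‖ ^ 0) := by
    have := le_abs_self L
    have := abs_nonneg L
    simp only [pow_zero]; nlinarith
  exact mul_le_mul_of_nonneg_right h1 (norm_nonneg _)

theorem LocLip.comp_lipschitz {F : Type*} [NormedAddCommGroup F] {φ : F → ℝ} (hφ : LocLip φ)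
    {G : ℝ → ℝ} {L : ℝ} (hG : ∀ x y, |G x - G y| ≤ L * |x - y|) : LocLip (fun x => G (φ x)) := by
  obtain ⟨C, hC, m, h⟩ := hφ
  refine ⟨(|L| + 1) * C, by positivity, m, fun x y => (hG _ _).trans ?_⟩
  calc L * |φ x - φ y| ≤ (|L| + 1) * |φ x - φ y| :=
        mul_le_mul_of_nonneg_right (by linarith [le_abs_self L]) (abs_nonneg _)
    _ ≤ (|L| + 1) * (C * (1 + ‖x‖ ^ m + ‖y‖ ^ m) * ‖x - y‖) :=
        mul_le_mul_of_nonneg_left (h x y) (by positivity)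
    _ = _ := by ring

theorem LocLip.comp_apply {n : ℕ} (i : Fin n) {φ : ℝ → ℝ} (hφ : LocLip φ) :
    LocLip (fun u : Fin n → ℝ => φ (u i)) := by
  obtain ⟨C, hC, m, h⟩ := hφ
  refine ⟨C, hC, m, fun x y => (h _ _).trans ?_⟩
  have h1 := norm_le_pi_norm x i
  have h2 := norm_le_pi_norm y i
  have h3 := norm_le_pi_norm (x - y) i
  simp only [Pi.sub_apply] at h3
  gcongr

namespace SublinearExpectation

variable {Ω : Type*} [MeasurableSpace Ω] (S : SublinearExpectation Ω)

/-! ### Stability of the class of random variables -/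

theorem comp_mem_one {X : Ω → ℝ} (hX : X ∈ S.H) {φ : ℝ → ℝ} (hφ : LocLip φ) :
    (fun ω => φ (X ω)) ∈ S.H :=
  S.comp_mem 1 (fun _ => X) (fun _ => hX) (fun u => φ (u 0)) (hφ.comp_apply 0)

theorem add_mem {X Z : Ω → ℝ} (hX : X ∈ S.H) (hZ : Z ∈ S.H) : (fun ω => X ω + Z ω) ∈ S.H := by
  have := S.comp_mem 2 ![X, Z] (fun i => by fin_cases i <;> simpa) (fun u => u 0 + u 1)
    (LocLip.of_lipschitz (L := 2) fun x y => by
      have h1 := norm_le_pi_norm (x - y) 0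
      have h2 := norm_le_pi_norm (x - y) 1
      simp only [Pi.sub_apply, Real.norm_eq_abs] at h1 h2
      calc |x 0 + x 1 - (y 0 + y 1)| = |(x 0 - y 0) + (x 1 - y 1)| := by ring_nf
        _ ≤ |x 0 - y 0| + |x 1 - y 1| := abs_add_le _ _
        _ ≤ _ := by linarith)
  simpa using this

theorem mul_mem {X Z : Ω → ℝ} (hX : X ∈ S.H) (hZ : Z ∈ S.H) : (fun ω => X ω * Z ω) ∈ S.H := by
  have := S.comp_mem 2 ![X, Z] (fun i => by fin_cases i <;> simpa) (fun u => u 0 * u 1)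
    ⟨1, one_pos, 1, fun x y => by
      have h1 := norm_le_pi_norm (x - y) 0
      have h2 := norm_le_pi_norm (x - y) 1
      have h3 := norm_le_pi_norm x 0
      have h4 := norm_le_pi_norm y 1
      simp only [Pi.sub_apply, Real.norm_eq_abs] at h1 h2 h3 h4
      calc |x 0 * x 1 - y 0 * y 1| = |x 0 * (x 1 - y 1) + y 1 * (x 0 - y 0)| := by ring_nf
        _ ≤ |x 0 * (x 1 - y 1)| + |y 1 * (x 0 - y 0)| := abs_add_le _ _
        _ = |x 0| * |x 1 - y 1| + |y 1| * |x 0 - y 0| := by rw [abs_mul, abs_mul]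
        _ ≤ ‖x‖ * ‖x - y‖ + ‖y‖ * ‖x - y‖ := by gcongr
        _ ≤ _ := by nlinarith [norm_nonneg (x - y)]⟩
  simpa using this

theorem const_mul_mem {X : Ω → ℝ} (c : ℝ) (hX : X ∈ S.H) : (fun ω => c * X ω) ∈ S.H :=
  S.mul_mem (S.const_mem c) hX

theorem neg_mem {X : Ω → ℝ} (hX : X ∈ S.H) : (fun ω => -X ω) ∈ S.H := by
  simpa using S.const_mul_mem (-1) hX

theorem sum_mem {ι : Type*} (s : Finset ι) {X : ι → Ω → ℝ} (hX : ∀ i ∈ s, X i ∈ S.H) :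
    (fun ω => ∑ i ∈ s, X i ω) ∈ S.H := by
  classical
  induction s using Finset.induction_on with
  | empty => simpa using S.const_mem 0
  | insert i s hi ih =>
    simp only [Finset.sum_insert hi]
    exact S.add_mem (hX i (by simp)) (ih fun j hj => hX j (by simp [hj]))

/-! ### Real bounds for the expectation -/

theorem E_le_of_le {X Z : Ω → ℝ} (hX : X ∈ S.H) (hZ : Z ∈ S.H) (h : ∀ ω, X ω ≤ Z ω) {c : EReal}
    (hc : S.E Z ≤ c) : S.E X ≤ c :=
  (S.mono Z hZ X hX h).trans hc

theorem E_nonneg {X : Ω → ℝ} (hX : X ∈ S.H) (h : ∀ ω, 0 ≤ X ω) : 0 ≤ S.E X := by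
  have := S.mono X hX _ (S.const_mem 0) h
  simpa [S.const 0] using this

theorem E_le_const {X : Ω → ℝ} (hX : X ∈ S.H) {c : ℝ} (h : ∀ ω, X ω ≤ c) : S.E X ≤ (c : EReal) := by
  have := S.mono _ (S.const_mem c) X hX h
  rwa [S.const c] at this

theorem const_le_E {X : Ω → ℝ} (hX : X ∈ S.H) {c : ℝ} (h : ∀ ω, c ≤ X ω) : (c : EReal) ≤ S.E X := by
  have := S.mono X hX _ (S.const_mem c) h
  rwa [S.const c] at this

theorem E_add_le {X Z : Ω → ℝ} (hX : X ∈ S.H) (hZ : Z ∈ S.H) {a b : ℝ}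
    (ha : S.E X ≤ (a : EReal)) (hb : S.E Z ≤ (b : EReal)) :
    S.E (fun ω => X ω + Z ω) ≤ ((a + b : ℝ) : EReal) := by
  have h1 : S.E X ≠ ⊤ := (ha.trans_lt (EReal.coe_lt_top a)).ne
  have h2 : S.E Z ≠ ⊤ := (hb.trans_lt (EReal.coe_lt_top b)).ne
  refine (S.subadd X hX Z hZ (fun h => h1 h.1) (fun h => h2 h.2)).trans ?_
  rw [EReal.coe_add]
  exact add_le_add ha hb

theorem E_const_mul_le {X : Ω → ℝ} (hX : X ∈ S.H) {a c : ℝ} (hc : 0 ≤ c)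
    (ha : S.E X ≤ (a : EReal)) : S.E (fun ω => c * X ω) ≤ ((c * a : ℝ) : EReal) := by
  rw [S.pos_homogeneous X hX c hc, EReal.coe_mul]
  exact mul_le_mul_of_nonneg_left ha (by exact_mod_cast hc)

theorem E_sum_le {ι : Type*} (s : Finset ι) {X : ι → Ω → ℝ} (hX : ∀ i ∈ s, X i ∈ S.H) {b : ι → ℝ}
    (hb : ∀ i ∈ s, S.E (X i) ≤ (b i : EReal)) :
    S.E (fun ω => ∑ i ∈ s, X i ω) ≤ ((∑ i ∈ s, b i : ℝ) : EReal) := by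
  classical
  induction s using Finset.induction_on with
  | empty => simp [S.const 0]
  | insert i s hi ih =>
    simp only [Finset.sum_insert hi]
    exact S.E_add_le (hX i (by simp)) (S.sum_mem s fun j hj => hX j (by simp [hj]))
      (hb i (by simp)) (ih (fun j hj => hX j (by simp [hj])) fun j hj => hb j (by simp [hj]))

theorem exists_E_eq_coe {X : Ω → ℝ} (hX : X ∈ S.H) {b c : ℝ} (hb : ∀ ω, b ≤ X ω)
    (hc : ∀ ω, X ω ≤ c) : ∃ e : ℝ, S.E X = (e : EReal) := by
  have h1 := S.E_le_const hX hc
  have h2 := S.const_le_E hX hb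
  refine ⟨(S.E X).toReal, (EReal.coe_toReal ?_ ?_).symm⟩
  · exact (h1.trans_lt (EReal.coe_lt_top c)).ne
  · exact ((EReal.bot_lt_coe b).trans_le h2).ne'

/-! ### The capacity -/

theorem capacity_le_E {A : Set Ω} {X : Ω → ℝ} (hX : X ∈ S.H) (h0 : ∀ ω, 0 ≤ X ω)
    (h1 : ∀ ω ∈ A, 1 ≤ X ω) : S.capacity A ≤ S.E X := by
  refine sInf_le ⟨X, hX, fun ω => ?_, rfl⟩
  by_cases h : ω ∈ A
  · simpa [h] using h1 ω h
  · simpa [h] using h0 ω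

theorem capacity_mono {A B : Set Ω} (h : A ⊆ B) : S.capacity A ≤ S.capacity B := by
  refine le_sInf ?_
  rintro e ⟨ξ, hξ, h1, rfl⟩
  exact sInf_le ⟨ξ, hξ, fun ω =>
    (Set.indicator_le_indicator_of_subset h (fun _ => zero_le_one) ω).trans (h1 ω), rfl⟩

theorem capacity_univ : S.capacity univ = 1 := by
  refine le_antisymm (S.capacity_le_one _) (le_sInf ?_)
  rintro e ⟨ξ, hξ, h1, rfl⟩
  simpa using S.const_le_E hξ (c := 1) (by simpa using h1)

/-- The capacity with values in `[0, ∞]`. -/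
noncomputable def cap (A : Set Ω) : ENNReal := (S.capacity A).toENNReal

theorem cap_mono {A B : Set Ω} (h : A ⊆ B) : S.cap A ≤ S.cap B :=
  EReal.toENNReal_le_toENNReal (S.capacity_mono h)

theorem cap_le_one (A : Set Ω) : S.cap A ≤ 1 := by
  have h : S.capacity A ≤ ((1 : ENNReal) : EReal) := by simpa using S.capacity_le_one A
  have := EReal.toENNReal_le_toENNReal h
  rwa [EReal.toENNReal_coe] at this

theorem cap_empty : S.cap ∅ = 0 := by
  have h : S.capacity ∅ ≤ 0 := by
    have := S.capacity_le_E (A := ∅) (S.const_mem 0) (fun _ => le_rfl) (by simp)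
    simpa [S.const 0] using this
  simp [cap, EReal.toENNReal_of_nonpos h]

theorem E_le_of_toENNReal_le {X : Ω → ℝ} {c : ℝ} (hc : 0 ≤ c)
    (h : (S.E X).toENNReal ≤ ENNReal.ofReal c) : S.E X ≤ (c : EReal) := by
  by_cases hX : 0 ≤ S.E X
  · have := EReal.coe_ennreal_le_coe_ennreal_iff.2 h
    rwa [EReal.coe_toENNReal hX, EReal.coe_ennreal_ofReal, max_eq_left hc] at this
  · exact (not_le.1 hX).le.trans (by exact_mod_cast hc)

theorem choquet_of_nonneg {X : Ω → ℝ} (hX : ∀ ω, 0 ≤ X ω) :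
    S.choquet X = ((∫⁻ x in Ioi (0 : ℝ), S.cap {ω | x < X ω} : ENNReal) : EReal) := by
  have h : ∫⁻ x in Iio (0 : ℝ), (1 - S.capacity {ω | x < X ω}).toENNReal = 0 := by
    rw [setLIntegral_congr_fun (g := fun _ => 0) measurableSet_Iio]
    · simp
    · intro x hx
      have : {ω | x < X ω} = univ := eq_univ_of_forall fun ω => lt_of_lt_of_le hx (hX ω)
      simp only [this, capacity_univ]
      have : (1 : EReal) - 1 = 0 := by
        rw [← EReal.coe_one, ← EReal.coe_sub]; simp
      simp [this]
  simp only [choquet, h, cap]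
  simp

theorem antitone_cap (X : Ω → ℝ) : Antitone fun x => S.cap {ω | x < X ω} :=
  fun _ _ h => S.cap_mono fun _ hω => lt_of_le_of_lt h hω

/-- Markov's inequality. -/
theorem cap_lt_le {X : Ω → ℝ} (hX : X ∈ S.H) (h0 : ∀ ω, 0 ≤ X ω) {x c : ℝ} (hx : 0 < x)
    (hc : S.E X ≤ (c : EReal)) : S.cap {ω | x < X ω} ≤ ENNReal.ofReal (c / x) := by
  have h1 := S.capacity_le_E (A := {ω | x < X ω}) (S.const_mul_mem (x⁻¹) hX)
    (fun ω => mul_nonneg (inv_nonneg.2 hx.le) (h0 ω)) (fun ω hω => by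
      have : x < X ω := hω
      rw [inv_mul_eq_div, le_div_iff₀ hx]; linarith)
  have h2 := h1.trans (S.E_const_mul_le hX (inv_nonneg.2 hx.le) hc)
  have := EReal.toENNReal_le_toENNReal h2
  rw [inv_mul_eq_div] at this
  simpa [cap] using this

/-- A variable bounded by `c` and vanishing off `A` has expectation at most `c V(A)`. -/
theorem toENNReal_E_le_mul_cap {X : Ω → ℝ} (hX : X ∈ S.H) {c : ℝ} (hc : 0 < c) {A : Set Ω}
    (hle : ∀ ω, X ω ≤ c) (hA : ∀ ω ∉ A, X ω ≤ 0) :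
    (S.E X).toENNReal ≤ ENNReal.ofReal c * S.cap A := by
  have h1 : S.E (fun ω => c⁻¹ * X ω) ≤ S.capacity A := by
    refine le_sInf ?_
    rintro e ⟨ξ, hξ, h, rfl⟩
    refine S.mono ξ hξ _ (S.const_mul_mem _ hX) fun ω => (le_trans ?_ (h ω))
    by_cases hω : ω ∈ A
    · simp only [hω, indicator_of_mem]
      rw [inv_mul_le_iff₀ hc]; linarith [hle ω]
    · simp only [hω, not_false_eq_true, indicator_of_notMem]
      exact mul_nonpos_of_nonneg_of_nonpos (inv_nonneg.2 hc.le) (hA ω hω)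
  have h2 : S.E X = (c : EReal) * S.E (fun ω => c⁻¹ * X ω) := by
    rw [← S.pos_homogeneous _ (S.const_mul_mem _ hX) c hc.le]
    congr 1; ext ω; field_simp
  rw [h2, EReal.toENNReal_mul (by exact_mod_cast hc.le)]
  rw [EReal.real_coe_toENNReal]
  exact mul_le_mul_right (EReal.toENNReal_le_toENNReal h1) _

end SublinearExpectation

theorem sum_range_slice (u h : ℝ) (hu : 0 ≤ u) (hh : 0 < h) (N : ℕ) :
    ∑ n ∈ Finset.range N, min (max (u - n * h) 0) h = min u (N * h) := by
  induction N with
  | zero => simp [hu]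
  | succ N ih =>
    rw [Finset.sum_range_succ, ih]
    push_cast
    rcases le_total u (N * h) with h1 | h1
    · rw [min_eq_left h1, max_eq_right (by linarith), min_eq_left hh.le, min_eq_left (by linarith)]
      ring
    · rw [min_eq_right h1, max_eq_left (by linarith)]
      rcases le_total (u - N * h) h with h2 | h2
      · rw [min_eq_left h2, min_eq_left (by linarith)]; ring
      · rw [min_eq_right h2, min_eq_right (by linarith)]; ring

theorem abs_slice_sub_le (c h x y : ℝ) :
    |min (max (x - c) 0) h - min (max (y - c) 0) h| ≤ 1 * |x - y| := by
  rw [one_mul]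
  calc _ ≤ |max (x - c) 0 - max (y - c) 0| := by
        simpa using abs_min_sub_min_le_max (max (x - c) 0) h (max (y - c) 0) h
    _ ≤ |(x - c) - (y - c)| := by
        simpa using abs_max_sub_max_le_max (x - c) 0 (y - c) 0
    _ = _ := by ring_nf

/-- A Riemann sum of an antitone function lies below its integral. -/
theorem tsum_mul_le_setLIntegral {H : ℝ → ENNReal} (hH : Antitone H) {h : ℝ} (hh : 0 < h) :
    ∑' n : ℕ, ENNReal.ofReal h * H ((n + 1) * h) ≤ ∫⁻ t in Ioi (0 : ℝ), H t := by
  have hm : Monotone fun n : ℕ => (n : ℝ) * h := fun a b hab => by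
    simp only; gcongr
  calc ∑' n : ℕ, ENNReal.ofReal h * H ((n + 1) * h)
      ≤ ∑' n : ℕ, ∫⁻ t in Ioc ((n : ℝ) * h) (((n + 1 : ℕ) : ℝ) * h), H t := by
        refine ENNReal.tsum_le_tsum fun n => ?_
        calc ENNReal.ofReal h * H ((n + 1) * h)
            = ∫⁻ t in Ioc ((n : ℝ) * h) (((n + 1 : ℕ) : ℝ) * h), H ((n + 1) * h) := by
              rw [setLIntegral_const, Real.volume_Ioc, mul_comm]
              congr 2; push_cast; ring
          _ ≤ _ := setLIntegral_mono' measurableSet_Ioc fun t ht => hH (by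
              have := ht.2; push_cast at this; exact this)
    _ = ∫⁻ t in ⋃ n : ℕ, Ioc ((n : ℝ) * h) (((n + 1 : ℕ) : ℝ) * h), H t := by
        rw [lintegral_iUnion (fun n => measurableSet_Ioc)]
        exact hm.pairwise_disjoint_on_Ioc_succ
    _ ≤ _ := lintegral_mono_set (iUnion_subset fun n t ht => by
        have : 0 ≤ (n : ℝ) * h := by positivity
        exact lt_of_le_of_lt this ht.1)

namespace SublinearExpectation

variable {Ω : Type*} [MeasurableSpace Ω] (S : SublinearExpectation Ω)

/-- The expectation of a nonnegative function of `X` is at most the Choquet integral of the same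
function of a copy of `X`. -/
theorem toENNReal_E_le_lintegral_cap (hS : S.CountablySubadditive) {X X₀ : Ω → ℝ} (hX : X ∈ S.H)
    (hX₀ : X₀ ∈ S.H) (hid : S.IdentDistributed X X₀) {ψ : ℝ → ℝ} (hψ : LocLip ψ)
    (hψ0 : ∀ y, 0 ≤ ψ y) :
    (S.E fun ω => ψ (X ω)).toENNReal ≤ ∫⁻ t in Ioi (0 : ℝ), S.cap {ω | t < ψ (X₀ ω)} := by
  refine ENNReal.le_of_forall_pos_le_add fun h hh _ => ?_
  set Z : ℕ → ℝ → ℝ := fun n y => min (max (ψ y - n * h) 0) h with hZ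
  have hh' : (0 : ℝ) < h := by exact_mod_cast hh
  have hZl : ∀ n, LocLip (Z n) := fun n =>
    hψ.comp_lipschitz (G := fun x => min (max (x - n * h) 0) h) (abs_slice_sub_le _ _)
  have hZ0 : ∀ n y, 0 ≤ Z n y := fun n y => le_min (le_max_right _ _) hh'.le
  have hZh : ∀ n y, Z n y ≤ h := fun n y => min_le_right _ _
  have hEq : ∀ n, S.E (fun ω => Z n (X ω)) = S.E (fun ω => Z n (X₀ ω)) := fun n => by
    obtain ⟨e, he⟩ := S.exists_E_eq_coe (S.comp_mem_one hX (hZl n)) (fun ω => hZ0 n _)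
      (fun ω => hZh n _)
    obtain ⟨e', he'⟩ := S.exists_E_eq_coe (S.comp_mem_one hX₀ (hZl n)) (fun ω => hZ0 n _)
      (fun ω => hZh n _)
    apply hid _ (hZl n) <;> simp [he, he']
  have h1 : (S.E fun ω => ψ (X ω)).toENNReal ≤ ∑' n, (S.E fun ω => Z n (X ω)).toENNReal := by
    refine hS _ (S.comp_mem_one hX hψ) (fun n ω => Z n (X ω))
      (fun n => S.comp_mem_one hX (hZl n)) (fun ω => hψ0 _) (fun n ω => hZ0 n _) fun ω => ?_
    obtain ⟨N, hN⟩ := exists_nat_ge (ψ (X ω) / h)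
    rw [div_le_iff₀ hh'] at hN
    calc ENNReal.ofReal (ψ (X ω)) = ENNReal.ofReal (∑ n ∈ Finset.range N, Z n (X ω)) := by
          rw [sum_range_slice _ _ (hψ0 _) hh', min_eq_left hN]
      _ = ∑ n ∈ Finset.range N, ENNReal.ofReal (Z n (X ω)) :=
          ENNReal.ofReal_sum_of_nonneg fun n _ => hZ0 n _
      _ ≤ _ := ENNReal.sum_le_tsum _
  have h2 : ∀ n : ℕ, (S.E fun ω => Z n (X ω)).toENNReal
      ≤ ENNReal.ofReal h * S.cap {ω | (n : ℝ) * h < ψ (X₀ ω)} := fun n => by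
    rw [hEq]
    refine S.toENNReal_E_le_mul_cap (S.comp_mem_one hX₀ (hZl n)) hh' (fun ω => hZh n _) ?_
    intro ω hω
    simp only [mem_ofPred_eq, not_lt] at hω
    exact (min_le_left _ _).trans (max_le (by linarith) le_rfl)
  refine h1.trans ((ENNReal.tsum_le_tsum h2).trans ?_)
  rw [tsum_eq_zero_add' ENNReal.summable, add_comm]
  refine add_le_add ?_ ?_
  · have := tsum_mul_le_setLIntegral (S.antitone_cap fun ω => ψ (X₀ ω)) hh'
    refine le_trans (le_of_eq ?_) this
    push_cast; rfl
  · calc ENNReal.ofReal h * S.cap _ ≤ ENNReal.ofReal h * 1 := by gcongr; exact S.cap_le_one _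
      _ = h := by simp

/-! ### Markov's inequality for weighted series -/

theorem exists_tail_le {w : ℕ → ℝ} (hs : Summable w) (hw : ∀ i, 0 ≤ w i) {δ : ℝ} (hδ : 0 < δ) (k : ℕ) :
    ∃ N : ℕ, k ≤ N ∧ ∀ M, ∑ i ∈ Finset.Ico N M, w i ≤ δ := by
  have h := tendsto_sum_nat_add w
  obtain ⟨N, hN, hk⟩ := ((h.eventually (gt_mem_nhds hδ)).and (eventually_ge_atTop k)).exists
  refine ⟨N, hk, fun M => ?_⟩
  rw [Finset.sum_Ico_eq_sum_range]
  refine le_trans ?_ hN.le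
  have h1 := ((summable_nat_add_iff N).2 hs).sum_le_tsum (Finset.range (M - N))
    (fun i _ => hw (i + N))
  simpa [add_comm] using h1

theorem cap_tsum_nat_lt_le (hV : S.CapacityCountablySubadditive) {w : ℕ → ℝ} (hs : Summable w)
    (hw : ∀ i, 0 ≤ w i) {A K x : ℝ} (hA : 0 < A) (hwA : ∑' i, w i ≤ A) (hK : 0 ≤ K) (hx : 0 < x)
    {ξ : ℕ → Ω → ℝ} (hξ : ∀ i, ξ i ∈ S.H) (hξ0 : ∀ i ω, 0 ≤ ξ i ω)
    (hE : ∀ i, S.E (ξ i) ≤ (K : EReal)) :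
    S.cap {ω | ENNReal.ofReal x < ∑' i, ENNReal.ofReal (w i * ξ i ω)}
      ≤ ENNReal.ofReal (4 * K * A / x) := by
  choose M hM1 hM2 using fun k : ℕ => exists_tail_le hs hw (δ := A * (1 / 4) ^ k) (by positivity) k
  set N : ℕ → ℕ := fun k => if k = 0 then 0 else M k with hN
  have hNk : ∀ k, k ≤ N k := fun k => by
    simp only [hN]; split_ifs with h
    · simp [h]
    · exact hM1 k
  have hN2 : ∀ k L, ∑ i ∈ Finset.Ico (N k) L, w i ≤ A * (1 / 4) ^ k := fun k L => by
    simp only [hN]; split_ifs with h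
    · simpa [h] using (hs.sum_le_tsum (Finset.range L) fun i _ => hw i).trans hwA
    · exact hM2 k L
  set B : ℕ → Ω → ℝ := fun k ω => ∑ i ∈ Finset.Ico (N k) (N (k + 1)), w i * ξ i ω with hB
  have hBH : ∀ k, B k ∈ S.H := fun k => S.sum_mem _ fun i _ => S.const_mul_mem _ (hξ i)
  have hB0 : ∀ k ω, 0 ≤ B k ω := fun k ω =>
    Finset.sum_nonneg fun i _ => mul_nonneg (hw i) (hξ0 i ω)
  have hBE : ∀ k, S.E (B k) ≤ ((K * (A * (1 / 4) ^ k) : ℝ) : EReal) := fun k => by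
    refine (S.E_sum_le (b := fun i => w i * K) _ (fun i _ => S.const_mul_mem _ (hξ i))
      fun i _ => S.E_const_mul_le (hξ i) (hw i) (hE i)).trans ?_
    rw [← Finset.sum_mul, mul_comm]
    exact_mod_cast mul_le_mul_of_nonneg_left (hN2 k _) hK
  have hsub : {ω | ENNReal.ofReal x < ∑' i, ENNReal.ofReal (w i * ξ i ω)}
      ⊆ ⋃ k, {ω | x * (1 / 2) ^ (k + 1) < B k ω} := by
    intro ω hω
    by_contra hcon
    simp only [mem_iUnion, mem_ofPred_eq, not_exists, not_lt] at hcon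
    rw [mem_ofPred_eq] at hω
    refine absurd hω (not_lt.2 ?_)
    have hcov : ∀ i, ENNReal.ofReal (w i * ξ i ω) ≤ ∑' k,
        if i ∈ Finset.Ico (N k) (N (k + 1)) then ENNReal.ofReal (w i * ξ i ω) else 0 := fun i => by
      have hex : ∃ k, i < N (k + 1) := ⟨i, lt_of_lt_of_le (Nat.lt_succ_self i) (hNk _)⟩
      classical
      have hk := Nat.find_spec hex
      refine le_trans ?_ (ENNReal.le_tsum (Nat.find hex))
      rw [if_pos]
      rw [Finset.mem_Ico]
      refine ⟨?_, hk⟩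
      rcases Nat.eq_zero_or_pos (Nat.find hex) with h0 | h0
      · rw [h0]; exact Nat.zero_le _
      · have := Nat.find_min hex (m := Nat.find hex - 1) (by omega)
        rw [Nat.sub_add_cancel h0] at this
        omega
    calc ∑' i, ENNReal.ofReal (w i * ξ i ω)
        ≤ ∑' i, ∑' k, if i ∈ Finset.Ico (N k) (N (k + 1)) then ENNReal.ofReal (w i * ξ i ω)
            else 0 := ENNReal.tsum_le_tsum hcov
      _ = ∑' k, ∑' i, if i ∈ Finset.Ico (N k) (N (k + 1)) then ENNReal.ofReal (w i * ξ i ω)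
            else 0 := ENNReal.tsum_comm
      _ = ∑' k, ENNReal.ofReal (B k ω) := by
          congr 1; ext k
          rw [hB, ENNReal.ofReal_sum_of_nonneg fun i _ => mul_nonneg (hw i) (hξ0 i ω),
            tsum_eq_sum (s := Finset.Ico (N k) (N (k + 1)))]
          · exact Finset.sum_congr rfl fun i hi => if_pos hi
          · intro i hi; exact if_neg hi
      _ ≤ ∑' k : ℕ, ENNReal.ofReal (x * (1 / 2) ^ (k + 1)) :=
          ENNReal.tsum_le_tsum fun k => ENNReal.ofReal_le_ofReal (hcon k)
      _ = ENNReal.ofReal (∑' k : ℕ, x * (1 / 2) ^ (k + 1)) := by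
          rw [ENNReal.ofReal_tsum_of_nonneg (fun k => by positivity)]
          simp only [pow_succ', ← mul_assoc]
          exact summable_geometric_two.mul_left _
      _ = ENNReal.ofReal x := by
          congr 1
          simp only [pow_succ', ← mul_assoc]
          rw [tsum_mul_left, tsum_geometric_two]; ring
  refine (S.cap_mono hsub).trans ((hV _ fun k => ?_).trans ?_)
  · exact measurableSet_lt measurable_const (S.measurable_of_mem _ (hBH k))
  calc ∑' k, (S.capacity {ω | x * (1 / 2) ^ (k + 1) < B k ω}).toENNReal
      ≤ ∑' k : ℕ, ENNReal.ofReal (2 * K * A / x * (1 / 2) ^ k) := by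
        refine ENNReal.tsum_le_tsum fun k => ?_
        refine (S.cap_lt_le (hBH k) (hB0 k) (by positivity) (hBE k)).trans (le_of_eq ?_)
        congr 1
        have : (1 / 4 : ℝ) ^ k = (1 / 2) ^ k * (1 / 2) ^ k := by rw [← mul_pow]; norm_num
        rw [this, pow_succ]
        field_simp
    _ = ENNReal.ofReal (∑' k : ℕ, 2 * K * A / x * (1 / 2) ^ k) := by
        rw [ENNReal.ofReal_tsum_of_nonneg (fun k => by positivity)]
        exact summable_geometric_two.mul_left _
    _ = _ := by rw [tsum_mul_left, tsum_geometric_two]; congr 1; ring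

theorem cap_tsum_int_lt_le (hV : S.CapacityCountablySubadditive) {w : ℤ → ℝ} (hs : Summable w)
    (hw : ∀ i, 0 ≤ w i) {A K x : ℝ} (hA : 0 < A) (hwA : ∑' i, w i ≤ A) (hK : 0 ≤ K) (hx : 0 < x)
    {ξ : ℤ → Ω → ℝ} (hξ : ∀ i, ξ i ∈ S.H) (hξ0 : ∀ i ω, 0 ≤ ξ i ω)
    (hE : ∀ i, S.E (ξ i) ≤ (K : EReal)) :
    S.cap {ω | ENNReal.ofReal x < ∑' i, ENNReal.ofReal (w i * ξ i ω)}
      ≤ ENNReal.ofReal (4 * K * A / x) := by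
  have e := Equiv.intEquivNat.symm
  have := S.cap_tsum_nat_lt_le hV (w := w ∘ e) ((e.summable_iff).2 hs) (fun i => hw _) hA
    (by rw [show ∑' i, (w ∘ e) i = ∑' i, w i from e.tsum_eq w]; exact hwA) hK hx (ξ := fun i => ξ (e i)) (fun i => hξ _)
    (fun i => hξ0 _) (fun i => hE _)
  refine le_trans (le_of_eq ?_) this
  congr 1; ext ω
  simp only [mem_ofPred_eq, Function.comp]
  rw [e.tsum_eq fun i => ENNReal.ofReal (w i * ξ i ω)]

end SublinearExpectation

/-! ### Convexity of powers -/

/-- The graph of `x ↦ x ^ q` lies above its tangents. -/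
theorem rpow_tangent_le {q x y : ℝ} (hq : 1 ≤ q) (hx : 0 ≤ x) (hy : 0 ≤ y) :
    y ^ q + q * y ^ (q - 1) * (x - y) ≤ x ^ q := by
  rcases hy.eq_or_lt with rfl | hy
  · rw [Real.zero_rpow (by linarith)]
    rcases hq.eq_or_lt with rfl | hq
    · simp
    · rw [Real.zero_rpow (by linarith)]
      simpa using Real.rpow_nonneg hx q
  · have h := one_add_mul_self_le_rpow_one_add (s := x / y - 1)
      (by have : 0 ≤ x / y := by positivity
          linarith) hq
    rw [add_sub_cancel, Real.div_rpow hx hy.le, le_div_iff₀ (by positivity)] at h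
    refine le_trans (le_of_eq ?_) h
    rw [Real.rpow_sub_one hy.ne']
    field_simp

namespace SublinearExpectation

variable {Ω : Type*} [MeasurableSpace Ω] (S : SublinearExpectation Ω)

/-- Jensen's inequality for the absolute value of the mean. -/
theorem abs_rpow_le_of_E_eq {X : Ω → ℝ} (hX : X ∈ S.H) {q e B : ℝ} (hq : 1 ≤ q)
    (he : S.E X = (e : EReal)) (hXq : (fun ω => |X ω| ^ q) ∈ S.H)
    (hB : S.E (fun ω => |X ω| ^ q) ≤ (B : EReal)) : |e| ^ q ≤ B := by
  have key : ∀ Z : Ω → ℝ, Z ∈ S.H → (∀ ω, |Z ω| = |X ω|) → (((|e| : ℝ) : EReal) ≤ S.E Z) →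
      |e| ^ q ≤ B := by
    intro Z hZ hZX hZe
    have hq0 : 0 ≤ q * |e| ^ (q - 1) := by positivity
    have h1 : S.E (fun ω => q * |e| ^ (q - 1) * Z ω) ≤ ((B + (q - 1) * |e| ^ q : ℝ) : EReal) := by
      refine S.E_le_of_le (Z := fun ω => |X ω| ^ q + (q - 1) * |e| ^ q) (S.const_mul_mem _ hZ)
        (S.add_mem hXq (S.const_mem _)) (fun ω => ?_)
        (S.E_add_le hXq (S.const_mem _) hB (S.const _).le)
      have h2 := rpow_tangent_le hq (abs_nonneg (Z ω)) (abs_nonneg e)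
      have h3 : |e| ^ q = |e| ^ (q - 1) * |e| := by
        rcases (abs_nonneg e).eq_or_lt with h | h
        · rw [← h, Real.zero_rpow (by linarith), mul_zero]
        · rw [← Real.rpow_add_one h.ne', sub_add_cancel]
      have h4 : q * |e| ^ (q - 1) * Z ω ≤ q * |e| ^ (q - 1) * |Z ω| :=
        mul_le_mul_of_nonneg_left (le_abs_self _) hq0
      rw [← hZX]
      nlinarith
    rw [S.pos_homogeneous _ hZ _ hq0] at h1
    have h5 := (mul_le_mul_of_nonneg_left hZe (by exact_mod_cast hq0)).trans h1
    have h6 : q * |e| ^ (q - 1) * |e| ≤ B + (q - 1) * |e| ^ q := by exact_mod_cast h5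
    have h3 : |e| ^ q = |e| ^ (q - 1) * |e| := by
      rcases (abs_nonneg e).eq_or_lt with h | h
      · rw [← h, Real.zero_rpow (by linarith), mul_zero]
      · rw [← Real.rpow_add_one h.ne', sub_add_cancel]
    nlinarith
  rcases le_total 0 e with h | h
  · exact key X hX (fun _ => rfl) (by rw [he, abs_of_nonneg h])
  · refine key _ (S.neg_mem hX) (fun _ => abs_neg _) ?_
    rw [abs_of_nonpos h]
    have h1 := S.subadd X hX _ (S.neg_mem hX) (by simp [he]) (by simp [he])
    simp only [add_neg_cancel, S.const 0, he] at h1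
    rcases eq_or_ne (S.E fun ω => -X ω) ⊤ with h2 | h2
    · simp [h2]
    rcases eq_or_ne (S.E fun ω => -X ω) ⊥ with h3 | h3
    · simp [h3] at h1
    lift S.E (fun ω => -X ω) to ℝ using ⟨h2, h3⟩ with b
    have : (0 : ℝ) ≤ e + b := by exact_mod_cast h1
    exact_mod_cast (by linarith : -e ≤ b)

end SublinearExpectation

/-! ### A Taylor-type inequality with increasing factors -/

/-- The increasing function equal to `z` for `z ≥ 0` and to `exp z - 1` for `z ≤ 0`. -/
noncomputable def expLinear (z : ℝ) : ℝ := max z 0 + (Real.exp (min z 0) - 1)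

theorem expLinear_of_nonneg {z : ℝ} (hz : 0 ≤ z) : expLinear z = z := by
  simp [expLinear, hz]

theorem expLinear_of_nonpos {z : ℝ} (hz : z ≤ 0) : expLinear z = Real.exp z - 1 := by
  simp [expLinear, hz]

theorem le_expLinear (z : ℝ) : z ≤ expLinear z := by
  rcases le_total 0 z with h | h
  · rw [expLinear_of_nonneg h]
  · rw [expLinear_of_nonpos h]; linarith [Real.add_one_le_exp z]

theorem expLinear_le (z : ℝ) : expLinear z ≤ z + z ^ 2 := by
  rcases le_total 0 z with h | h
  · rw [expLinear_of_nonneg h]; nlinarith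
  · rw [expLinear_of_nonpos h]
    rcases le_total (-1) z with h1 | h1
    · have := (abs_le.1 (Real.abs_exp_sub_one_sub_id_le (x := z) (abs_le.2 ⟨h1, by linarith⟩))).2
      linarith
    · have : Real.exp z ≤ 1 := Real.exp_le_one_iff.2 h
      nlinarith

theorem monotone_expLinear : Monotone expLinear := fun x y h => by
  unfold expLinear
  gcongr

theorem abs_expLinear_sub_le (x y : ℝ) : |expLinear x - expLinear y| ≤ 2 * |x - y| := by
  wlog h : y ≤ x generalizing x y
  · rw [abs_sub_comm, abs_sub_comm x]; exact this y x (le_of_not_ge h)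
  rw [abs_of_nonneg (sub_nonneg.2 (monotone_expLinear h)), abs_of_nonneg (sub_nonneg.2 h)]
  have h1 : max x 0 - max y 0 ≤ x - y := by
    have := abs_max_sub_max_le_max x 0 y 0
    rw [sub_self, abs_zero, max_eq_left (abs_nonneg (x - y)),
      abs_of_nonneg (sub_nonneg.2 h)] at this
    exact (le_abs_self _).trans this
  have h2 : Real.exp (min x 0) - Real.exp (min y 0) ≤ x - y := by
    have h3 : min x 0 - min y 0 ≤ x - y := by
      have := abs_min_sub_min_le_max x 0 y 0
      rw [sub_self, abs_zero, max_eq_left (abs_nonneg (x - y)),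
      abs_of_nonneg (sub_nonneg.2 h)] at this
      exact (le_abs_self _).trans this
    have h4 : Real.exp (min x 0) ≤ 1 := Real.exp_le_one_iff.2 (min_le_right _ _)
    have h5 := Real.add_one_le_exp (min y 0 - min x 0)
    have h6 : Real.exp (min y 0) = Real.exp (min x 0) * Real.exp (min y 0 - min x 0) := by
      rw [← Real.exp_add]; ring_nf
    have h7 : min y 0 ≤ min x 0 := by gcongr
    rw [h6]
    nlinarith [Real.exp_pos (min x 0)]
  unfold expLinear
  linarith

theorem rpow_le_taylor {r a b : ℝ} (hr : 2 ≤ r) (ha : 0 ≤ a) (hb : 0 ≤ b) :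
    b ^ r ≤ a ^ r + r * a ^ (r - 1) * (b - a) + r * (r - 1) * max a b ^ (r - 2) * (b - a) ^ 2 := by
  have h1 := rpow_tangent_le (q := r) (by linarith) ha hb
  have h2 : (b ^ (r - 1) - a ^ (r - 1)) * (b - a) ≤ (r - 1) * max a b ^ (r - 2) * (b - a) ^ 2 := by
    rcases le_total a b with h | h
    · have := rpow_tangent_le (q := r - 1) (by linarith) ha hb
      rw [max_eq_right h, show r - 2 = r - 1 - 1 by ring]
      nlinarith
    · have := rpow_tangent_le (q := r - 1) (by linarith) hb ha
      rw [max_eq_left h, show r - 2 = r - 1 - 1 by ring]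
      nlinarith
  have h3 := mul_le_mul_of_nonneg_left h2 (by linarith : 0 ≤ r)
  linarith

theorem rpow_sub_two_mul_sq {r u : ℝ} (hu : 0 < u) : u ^ (r - 2) * u ^ 2 = u ^ r := by
  rw [← Real.rpow_natCast u 2, ← Real.rpow_add hu]; norm_num

theorem rpow_le_one_add_rpow {q r a : ℝ} (hq : 0 ≤ q) (hqr : q ≤ r) (ha : 0 ≤ a) :
    a ^ q ≤ 1 + a ^ r := by
  rcases le_total a 1 with h | h
  · have := Real.rpow_le_one ha h hq
    have := Real.rpow_nonneg ha r
    linarith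
  · have := Real.rpow_le_rpow_of_exponent_le h hqr
    linarith

/-- In this expansion of `(a + z)⁺ ^ r` every coefficient depending on `a` is nondecreasing in `a`,
and it multiplies a nondecreasing function of `z`. -/
theorem exists_posPart_rpow_le {r : ℝ} (hr : 2 ≤ r) : ∃ C : ℝ, 0 ≤ C ∧ ∀ a z : ℝ, 0 ≤ a →
    max (a + z) 0 ^ r ≤ a ^ r + r * (a ^ (r - 1) * expLinear z) + C * (a ^ r * max z 0 ^ 2)
      + C * (|z| ^ r + z ^ 2) := by
  set c := r * (r - 1) with hc
  have hc0 : 0 ≤ c := mul_nonneg (by linarith) (by linarith)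
  have h2r : (0 : ℝ) ≤ 2 ^ (r - 2) := by positivity
  have hrr : (0 : ℝ) ≤ r ^ (r - 2) := Real.rpow_nonneg (by linarith) _
  refine ⟨c * (2 ^ (r - 2) + r ^ (r - 2)), by positivity, fun a z ha => ?_⟩
  have hz0 : 0 ≤ |z| ^ r := by positivity
  have ha0 : 0 ≤ a ^ r := by positivity
  have ha1 : 0 ≤ a ^ (r - 1) := by positivity
  rcases le_or_gt 0 z with hz | hz
  · have h1 := rpow_le_taylor hr ha (by linarith : 0 ≤ a + z)
    rw [max_eq_left (by linarith : 0 ≤ a + z), expLinear_of_nonneg hz, max_eq_left hz]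
    rw [add_sub_cancel_left, max_eq_right (by linarith)] at h1
    have h2 : (a + z) ^ (r - 2) ≤ 2 ^ (r - 2) * (a ^ (r - 2) + z ^ (r - 2)) := by
      have ha' : 0 ≤ a ^ (r - 2) := by positivity
      have hz' : 0 ≤ z ^ (r - 2) := by positivity
      rcases le_total a z with h | h
      · calc (a + z) ^ (r - 2) ≤ (2 * z) ^ (r - 2) :=
              Real.rpow_le_rpow (by linarith) (by linarith) (by linarith)
          _ = 2 ^ (r - 2) * z ^ (r - 2) := Real.mul_rpow (by norm_num) hz
          _ ≤ _ := by gcongr; linarith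
      · calc (a + z) ^ (r - 2) ≤ (2 * a) ^ (r - 2) :=
              Real.rpow_le_rpow (by linarith) (by linarith) (by linarith)
          _ = 2 ^ (r - 2) * a ^ (r - 2) := Real.mul_rpow (by norm_num) ha
          _ ≤ _ := by gcongr; linarith
    have h3 := rpow_le_one_add_rpow (q := r - 2) (r := r) (by linarith) (by linarith) ha
    have h4 : z ^ (r - 2) * z ^ 2 ≤ |z| ^ r := by
      rcases hz.eq_or_lt with rfl | hz
      · simpa using hz0
      · rw [rpow_sub_two_mul_sq hz, abs_of_pos hz]
    have h5 : (a + z) ^ (r - 2) * z ^ 2 ≤ 2 ^ (r - 2) * (a ^ r * z ^ 2 + (|z| ^ r + z ^ 2)) := by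
      calc (a + z) ^ (r - 2) * z ^ 2 ≤ 2 ^ (r - 2) * (a ^ (r - 2) + z ^ (r - 2)) * z ^ 2 := by
            gcongr
        _ = 2 ^ (r - 2) * (a ^ (r - 2) * z ^ 2 + z ^ (r - 2) * z ^ 2) := by ring
        _ ≤ 2 ^ (r - 2) * ((1 + a ^ r) * z ^ 2 + |z| ^ r) := by gcongr
        _ = _ := by ring
    have h6 : 0 ≤ a ^ r * z ^ 2 + (|z| ^ r + z ^ 2) := by positivity
    have h7 := mul_le_mul_of_nonneg_left h5 hc0
    have h8 : 0 ≤ c * r ^ (r - 2) * (a ^ r * z ^ 2 + (|z| ^ r + z ^ 2)) := by positivity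
    nlinarith
  · rw [expLinear_of_nonpos hz.le, max_eq_right hz.le]
    simp only [ne_eq, OfNat.ofNat_ne_zero, not_false_eq_true, zero_pow, mul_zero, add_zero]
    have hE : 0 ≤ c * (2 ^ (r - 2) + r ^ (r - 2)) * (|z| ^ r + z ^ 2) := by positivity
    rcases le_or_gt r a with har | har
    · have hap : 0 < a := by linarith
      have h1 : max (a + z) 0 ≤ a * Real.exp (z / a) := by
        refine max_le ?_ (by positivity)
        have := Real.add_one_le_exp (z / a)
        calc a + z = a * (z / a + 1) := by field_simp; ring
          _ ≤ _ := by gcongr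
      have h2 : max (a + z) 0 ^ r ≤ a ^ r * Real.exp (r / a * z) := by
        calc _ ≤ (a * Real.exp (z / a)) ^ r :=
              Real.rpow_le_rpow (le_max_right _ _) h1 (by linarith)
          _ = a ^ r * Real.exp (r / a * z) := by
              rw [Real.mul_rpow ha (Real.exp_pos _).le, ← Real.exp_mul]
              congr 2; ring
      have hla : r / a ≤ 1 := by rw [div_le_one hap]; exact har
      have hla0 : 0 ≤ r / a := div_nonneg (by linarith) ha
      have h3 : Real.exp (r / a * z) ≤ 1 + r / a * (Real.exp z - 1) := by
        have := convexOn_exp.2 (mem_univ z) (mem_univ 0) hla0 (sub_nonneg.2 hla)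
          (add_sub_cancel _ _)
        simp only [smul_eq_mul, mul_zero, add_zero, Real.exp_zero, mul_one] at this
        linarith
      have h4 : a ^ r * (r / a) = r * a ^ (r - 1) := by
        rw [Real.rpow_sub_one hap.ne']; field_simp
      have h5 := mul_le_mul_of_nonneg_left h3 ha0
      have h6 : a ^ r * (1 + r / a * (Real.exp z - 1))
          = a ^ r + r * (a ^ (r - 1) * (Real.exp z - 1)) := by
        rw [mul_add, ← mul_assoc, h4]; ring
      linarith
    · have hk : z ≤ Real.exp z - 1 := by linarith [Real.add_one_le_exp z]
      have h0 : r * (a ^ (r - 1) * z) ≤ r * (a ^ (r - 1) * (Real.exp z - 1)) := by gcongr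
      have h1 : a ^ (r - 2) ≤ r ^ (r - 2) := Real.rpow_le_rpow ha har.le (by linarith)
      have ha2 : 0 ≤ a ^ (r - 2) := by positivity
      have hmain : max (a + z) 0 ^ r ≤ a ^ r + r * (a ^ (r - 1) * z) + c * (a ^ (r - 2) * z ^ 2) := by
        rcases le_total 0 (a + z) with h | h
        · have := rpow_le_taylor hr ha h
          rw [max_eq_left h]
          rw [max_eq_left (by linarith : a + z ≤ a), add_sub_cancel_left] at this
          linarith
        · rw [max_eq_right h, Real.zero_rpow (by linarith)]
          have h3 : a ^ (r - 1) ≤ a ^ (r - 2) * a := by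
            rcases ha.eq_or_lt with rfl | hap
            · rw [Real.zero_rpow (by linarith)]; simp
            · rw [← Real.rpow_add_one hap.ne']
              exact le_of_eq (by congr 1; ring)
          have h4 : a ^ (r - 2) * a * (-z) ≤ a ^ (r - 2) * z ^ 2 := by
            rw [mul_assoc]; gcongr; nlinarith
          have h5 : a ^ (r - 1) * (-z) ≤ a ^ (r - 2) * z ^ 2 :=
            (mul_le_mul_of_nonneg_right h3 (by linarith)).trans h4
          have h6 : 0 ≤ a ^ (r - 2) * z ^ 2 := by positivity
          have h7 : r * (a ^ (r - 2) * z ^ 2) ≤ c * (a ^ (r - 2) * z ^ 2) := by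
            gcongr; rw [hc]; nlinarith
          nlinarith
      have h8 : c * (a ^ (r - 2) * z ^ 2) ≤ c * (r ^ (r - 2) * z ^ 2) := by gcongr
      have h9 : 0 ≤ c * 2 ^ (r - 2) * (|z| ^ r + z ^ 2) := by positivity
      have h10 : 0 ≤ c * r ^ (r - 2) * |z| ^ r := by positivity
      nlinarith

theorem LocLip.comp_lipschitzOn {F : Type*} [NormedAddCommGroup F] {φ : F → ℝ} (hφ : LocLip φ)
    {s : Set ℝ} (hs : ∀ x, φ x ∈ s) {G : ℝ → ℝ} {L : ℝ}
    (hG : ∀ x ∈ s, ∀ y ∈ s, |G x - G y| ≤ L * |x - y|) : LocLip (fun x => G (φ x)) := by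
  obtain ⟨C, hC, m, h⟩ := hφ
  refine ⟨(|L| + 1) * C, by positivity, m, fun x y => (hG _ (hs x) _ (hs y)).trans ?_⟩
  calc L * |φ x - φ y| ≤ (|L| + 1) * |φ x - φ y| :=
        mul_le_mul_of_nonneg_right (by linarith [le_abs_self L]) (abs_nonneg _)
    _ ≤ (|L| + 1) * (C * (1 + ‖x‖ ^ m + ‖y‖ ^ m) * ‖x - y‖) :=
        mul_le_mul_of_nonneg_left (h x y) (by positivity)
    _ = _ := by ring

theorem abs_rpow_sub_rpow_le {q B x y : ℝ} (hq : 1 ≤ q) (hx : x ∈ Icc 0 B) (hy : y ∈ Icc 0 B) :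
    |x ^ q - y ^ q| ≤ q * B ^ (q - 1) * |x - y| := by
  wlog h : y ≤ x generalizing x y
  · rw [abs_sub_comm, abs_sub_comm x]; exact this hy hx (le_of_not_ge h)
  rw [abs_of_nonneg (sub_nonneg.2 (Real.rpow_le_rpow hy.1 h (by linarith))),
    abs_of_nonneg (sub_nonneg.2 h)]
  have h1 := rpow_tangent_le hq hy.1 hx.1
  have h2 : x ^ (q - 1) ≤ B ^ (q - 1) := Real.rpow_le_rpow hx.1 hx.2 (by linarith)
  have h3 : q * x ^ (q - 1) * (x - y) ≤ q * B ^ (q - 1) * (x - y) := by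
    have := sub_nonneg.2 h
    gcongr
  linarith

theorem LocLip.rpow_of_bounded {F : Type*} [NormedAddCommGroup F] {φ : F → ℝ} (hφ : LocLip φ)
    {B q : ℝ} (hB : ∀ x, φ x ∈ Icc 0 B) (hq : 1 ≤ q) : LocLip (fun x => φ x ^ q) :=
  hφ.comp_lipschitzOn hB (G := fun x => x ^ q) fun _ hx _ hy => abs_rpow_sub_rpow_le hq hx hy

theorem LocLip.abs {F : Type*} [NormedAddCommGroup F] {φ : F → ℝ} (hφ : LocLip φ) :
    LocLip (fun x => |φ x|) :=
  hφ.comp_lipschitz (G := fun x => |x|) (L := 1) fun x y => by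
    rw [one_mul]; exact abs_abs_sub_abs_le x y

/-! ### Maxima of the sums over final segments -/

/-- `max_{0 ≤ k ≤ n} (φ(y_k) + ⋯ + φ(y_{n-1}))`. -/
noncomputable def revMax (φ : ℝ → ℝ) : (n : ℕ) → (Fin n → ℝ) → ℝ
  | 0, _ => 0
  | n + 1, y => max (revMax φ n (fun k => y k.castSucc) + φ (y (Fin.last n))) 0

theorem revMax_nonneg (φ : ℝ → ℝ) (n : ℕ) (y : Fin n → ℝ) : 0 ≤ revMax φ n y := by
  cases n with
  | zero => exact le_rfl
  | succ n => exact le_max_right _ _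

theorem revMax_le {φ : ℝ → ℝ} {B : ℝ} (hB : ∀ y, |φ y| ≤ B) (n : ℕ) (y : Fin n → ℝ) :
    revMax φ n y ≤ n * B := by
  have hB0 : 0 ≤ B := (abs_nonneg _).trans (hB 0)
  induction n with
  | zero => simp [revMax]
  | succ n ih =>
    refine max_le ?_ (by positivity)
    have h1 := ih fun k => y k.castSucc
    have h2 := (abs_le.1 (hB (y (Fin.last n)))).2
    push_cast; linarith

theorem monotone_revMax {φ : ℝ → ℝ} (hφ : Monotone φ) (n : ℕ) : Monotone (revMax φ n) := by
  induction n with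
  | zero => exact fun _ _ _ => le_rfl
  | succ n ih =>
    intro x y h
    exact max_le_max (add_le_add (ih fun k => h _) (hφ (h _))) le_rfl

theorem antitone_revMax {φ : ℝ → ℝ} (hφ : Antitone φ) (n : ℕ) : Antitone (revMax φ n) := by
  induction n with
  | zero => exact fun _ _ _ => le_rfl
  | succ n ih =>
    intro x y h
    exact max_le_max (add_le_add (ih fun k => h _) (hφ (h _))) le_rfl

theorem abs_revMax_sub_le {φ : ℝ → ℝ} {L : ℝ} (hL : 0 ≤ L) (hφ : ∀ x y, |φ x - φ y| ≤ L * |x - y|)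
    (n : ℕ) (x y : Fin n → ℝ) : |revMax φ n x - revMax φ n y| ≤ n * L * ‖x - y‖ := by
  induction n with
  | zero => simp [revMax]
  | succ n ih =>
    set x' : Fin n → ℝ := fun k => x k.castSucc
    set y' : Fin n → ℝ := fun k => y k.castSucc
    have h1 : ‖x' - y'‖ ≤ ‖x - y‖ := (pi_norm_le_iff_of_nonneg (norm_nonneg _)).2 fun k =>
      norm_le_pi_norm (x - y) k.castSucc
    have h2 : |x (Fin.last n) - y (Fin.last n)| ≤ ‖x - y‖ := norm_le_pi_norm (x - y) (Fin.last n)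
    calc |revMax φ (n + 1) x - revMax φ (n + 1) y|
        ≤ |(revMax φ n x' + φ (x (Fin.last n))) - (revMax φ n y' + φ (y (Fin.last n)))| := by
          simpa [revMax] using abs_max_sub_max_le_max (revMax φ n x' + φ (x (Fin.last n))) 0
            (revMax φ n y' + φ (y (Fin.last n))) 0
      _ = |(revMax φ n x' - revMax φ n y') + (φ (x (Fin.last n)) - φ (y (Fin.last n)))| := by
          congr 1; ring
      _ ≤ |revMax φ n x' - revMax φ n y'| + |φ (x (Fin.last n)) - φ (y (Fin.last n))| :=
          abs_add_le _ _
      _ ≤ n * L * ‖x - y‖ + L * ‖x - y‖ :=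
          add_le_add ((ih _ _).trans (by gcongr)) ((hφ _ _).trans (by gcongr))
      _ = _ := by push_cast; ring

theorem sum_Ico_le_revMax (φ : ℝ → ℝ) (y : ℕ → ℝ) {k n : ℕ} (hk : k ≤ n) :
    ∑ j ∈ Finset.Ico k n, φ (y j) ≤ revMax φ n (fun i => y i) := by
  induction n with
  | zero => simp [revMax]
  | succ n ih =>
    rcases hk.eq_or_lt with rfl | hk
    · simpa using revMax_nonneg _ _ _
    · rw [Finset.sum_Ico_succ_top (by omega)]
      refine le_trans ?_ (le_max_left _ _)
      simpa using ih (by omega)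

/-! ### Rosenthal's inequality -/

namespace SublinearExpectation

variable {Ω : Type*} [MeasurableSpace Ω] (S : SublinearExpectation Ω)

theorem E_mul_le_of_negDepSeq {Y : ℤ → Ω → ℝ} (hY : ∀ i, Y i ∈ S.H) (hnd : S.NegDepSeq Y) (i : ℤ)
    (n : ℕ) {ψ₁ : (Fin n → ℝ) → ℝ} {ψ₂ : ℝ → ℝ} (h₁ : LocLip ψ₁) (h₂ : LocLip ψ₂)
    (hmon : (Monotone ψ₁ ∧ Monotone ψ₂) ∨ (Antitone ψ₁ ∧ Antitone ψ₂)) {B₁ B₂ b₁ b₂ : ℝ}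
    (h0 : ∀ y, 0 ≤ ψ₁ y) (hB₁ : ∀ y, ψ₁ y ≤ B₁) (hB₂ : ∀ y, |ψ₂ y| ≤ B₂)
    (hE0 : 0 ≤ S.E fun ω => ψ₂ (Y (i + n) ω))
    (hE₁ : S.E (fun ω => ψ₁ fun k => Y (i + (k : ℕ)) ω) ≤ (b₁ : EReal))
    (hE₂ : S.E (fun ω => ψ₂ (Y (i + n) ω)) ≤ (b₂ : EReal)) :
    S.E (fun ω => ψ₁ (fun k => Y (i + (k : ℕ)) ω) * ψ₂ (Y (i + n) ω)) ≤ ((b₁ * b₂ : ℝ) : EReal) := by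
  have hm1 : (fun ω => ψ₁ fun k => Y (i + (k : ℕ)) ω) ∈ S.H :=
    S.comp_mem n (fun k => Y (i + (k : ℕ))) (fun k => hY _) ψ₁ h₁
  have hm2 : (fun ω => ψ₂ (Y (i + n) ω)) ∈ S.H := S.comp_mem_one (hY _) h₂
  have hb2 : 0 ≤ b₂ := by exact_mod_cast hE0.trans hE₂
  have hm0 : 0 ≤ S.E (fun ω => ψ₁ fun k => Y (i + (k : ℕ)) ω) := S.E_nonneg hm1 fun _ => h0 _
  rcases Nat.eq_zero_or_pos n with rfl | hn
  · have h : ∀ ω, (ψ₁ fun k => Y (i + (k : ℕ)) ω) = ψ₁ 0 := fun ω => by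
      congr 1; exact Subsingleton.elim _ _
    simp only [h] at hE₁ ⊢
    rw [S.const] at hE₁
    rw [S.pos_homogeneous _ hm2 _ (h0 0), EReal.coe_mul]
    refine (mul_le_mul_of_nonneg_left hE₂ (by exact_mod_cast h0 0)).trans ?_
    have : ψ₁ 0 ≤ b₁ := by exact_mod_cast hE₁
    exact_mod_cast mul_le_mul_of_nonneg_right this hb2
  · have hB₁0 : 0 ≤ B₁ := (h0 0).trans (hB₁ 0)
    have key := hnd i n hn ψ₁ (fun u => ψ₂ (u 0)) h₁ (h₂.comp_apply 0)
      (hmon.imp (fun h => ⟨h.1, fun x y hxy => h.2 (hxy 0)⟩)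
        fun h => ⟨h.1, fun x y hxy => h.2 (hxy 0)⟩) (fun ω => h0 _) hE0
      ((S.E_le_const (c := B₁ * B₂) (S.mul_mem hm1 hm2) fun ω => ?_).trans_lt (EReal.coe_lt_top _))
      ((S.E_le_const (c := B₁) (S.comp_mem n (fun k => Y (i + (k : ℕ))) (fun k => hY _) _ h₁.abs)
        fun ω => ?_).trans_lt (EReal.coe_lt_top _))
      ((S.E_le_const (c := B₂) (S.comp_mem_one (hY _) h₂.abs)
        fun ω => hB₂ _).trans_lt (EReal.coe_lt_top _))
    · refine key.trans ?_
      rw [EReal.coe_mul]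
      exact mul_le_mul hE₁ hE₂ hE0 (hm0.trans hE₁)
    · calc _ ≤ ψ₁ (fun k => Y (i + (k : ℕ)) ω) * |ψ₂ (Y (i + n) ω)| :=
            mul_le_mul_of_nonneg_left (le_abs_self _) (h0 _)
        _ ≤ B₁ * B₂ := mul_le_mul (hB₁ _) (hB₂ _) (abs_nonneg _) hB₁0
    · rw [abs_of_nonneg (h0 _)]; exact hB₁ _

/-- Rosenthal's inequality for a monotone function of a negatively dependent sequence, normalized
so that the variances add up to at most one. -/
theorem exists_E_revMax_rpow_le {Y : ℤ → Ω → ℝ} (hY : ∀ i, Y i ∈ S.H) (hnd : S.NegDepSeq Y) {r : ℝ}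
    (hr : 2 ≤ r) : ∃ D : ℝ, 0 < D ∧ ∀ (φ : ℝ → ℝ) (L B β : ℝ) (n : ℕ), (Monotone φ ∨ Antitone φ) →
      0 ≤ L → (∀ x y, |φ x - φ y| ≤ L * |x - y|) → (∀ y, |φ y| ≤ B) → 1 ≤ n → 0 ≤ β →
      (∀ j, S.E (fun ω => φ (Y j ω)) = 0) →
      (∀ j, S.E (fun ω => φ (Y j ω) ^ 2) ≤ ((1 / n : ℝ) : EReal)) →
      (∀ j, S.E (fun ω => |φ (Y j ω)| ^ r) ≤ (β : EReal)) →
      ∀ i, S.E (fun ω => revMax φ n (fun k => Y (i + (k : ℕ)) ω) ^ r)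
        ≤ ((D * (1 + n * β) : ℝ) : EReal) := by
  obtain ⟨C, hC, hpt⟩ := exists_posPart_rpow_le hr
  set d := r + C with hd
  have hd0 : 0 < d := by linarith
  refine ⟨d * Real.exp d, by positivity, ?_⟩
  intro φ L B β n hmon hL hLip hB hn hβ hE1 hE2 hEr i
  have hB0 : 0 ≤ B := (abs_nonneg _).trans (hB 0)
  have hn0 : (0 : ℝ) < n := by exact_mod_cast hn
  have hφ : LocLip φ := LocLip.of_lipschitz (L := L) hLip
  have hφm : ∀ j, (fun ω => φ (Y j ω)) ∈ S.H := fun j => S.comp_mem_one (hY j) hφ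
  have hφ2 : ∀ j, (fun ω => φ (Y j ω) ^ 2) ∈ S.H := fun j => by
    simpa [sq] using S.mul_mem (hφm j) (hφm j)
  have hφr : ∀ j, (fun ω => |φ (Y j ω)| ^ r) ∈ S.H := fun j =>
    S.comp_mem_one (hY j) (hφ.abs.rpow_of_bounded (fun y => ⟨abs_nonneg _, hB y⟩) (by linarith))
  have hR : ∀ k, LocLip (revMax φ k) := fun k =>
    LocLip.of_lipschitz (abs_revMax_sub_le hL hLip k)
  have hRb : ∀ (k : ℕ) y, revMax φ k y ∈ Icc 0 (k * B) := fun k y =>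
    ⟨revMax_nonneg _ _ _, revMax_le hB k y⟩
  have hRq : ∀ k {q : ℝ}, 1 ≤ q → LocLip (fun y => revMax φ k y ^ q) := fun k q hq =>
    (hR k).rpow_of_bounded (hRb k) hq
  have hRH : ∀ k {q : ℝ}, 1 ≤ q → (fun ω => revMax φ k (fun m => Y (i + (m : ℕ)) ω) ^ q) ∈ S.H :=
    fun k q hq => S.comp_mem k (fun m => Y (i + (m : ℕ))) (fun m => hY _) _ (hRq k hq)
  -- the two increasing functions of the last variable
  have hκ : LocLip (fun y => expLinear (φ y)) := hφ.comp_lipschitz abs_expLinear_sub_le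
  have hκB : ∀ y, |expLinear (φ y)| ≤ B + B ^ 2 := fun y => by
    have h1 := abs_le.1 (hB y)
    have h2 := le_expLinear (φ y)
    have h3 := expLinear_le (φ y)
    rw [abs_le]
    constructor <;> nlinarith
  have hσ : LocLip (fun y => max (φ y) 0 ^ 2) := by
    refine hφ.comp_lipschitzOn (s := Icc (-B) B) (fun y => abs_le.1 (hB y))
      (G := fun z => max z 0 ^ 2) (L := 2 * B) fun x hx y hy => ?_
    have h1 : |max x 0 + max y 0| ≤ 2 * B := by
      rw [abs_of_nonneg (by positivity)]
      have := max_le hx.2 hB0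
      have := max_le hy.2 hB0
      linarith
    have h2 : |max x 0 - max y 0| ≤ |x - y| := by
      simpa using abs_max_sub_max_le_max x 0 y 0
    rw [sq_sub_sq, abs_mul]
    gcongr
  have hσB : ∀ y, |max (φ y) 0 ^ 2| ≤ B ^ 2 := fun y => by
    rw [abs_of_nonneg (by positivity)]
    have := max_le (abs_le.1 (hB y)).2 hB0
    gcongr
  have hκE0 : ∀ j, 0 ≤ S.E (fun ω => expLinear (φ (Y j ω))) := fun j => by
    rw [← hE1 j]
    exact S.mono _ (S.comp_mem_one (hY j) hκ) _ (hφm j) fun ω => le_expLinear _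
  have hκE : ∀ j, S.E (fun ω => expLinear (φ (Y j ω))) ≤ ((1 / n : ℝ) : EReal) := fun j => by
    have := S.E_add_le (hφm j) (hφ2 j) (a := 0) (by simp [hE1 j]) (hE2 j)
    rw [zero_add] at this
    exact S.E_le_of_le (S.comp_mem_one (hY j) hκ) (S.add_mem (hφm j) (hφ2 j))
      (fun ω => expLinear_le _) this
  have hσE0 : ∀ j, 0 ≤ S.E (fun ω => max (φ (Y j ω)) 0 ^ 2) := fun j =>
    S.E_nonneg (S.comp_mem_one (hY j) hσ) fun ω => by positivity
  have hσE : ∀ j, S.E (fun ω => max (φ (Y j ω)) 0 ^ 2) ≤ ((1 / n : ℝ) : EReal) := fun j =>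
    S.E_le_of_le (S.comp_mem_one (hY j) hσ) (hφ2 j) (fun ω => by
      rcases le_total 0 (φ (Y j ω)) with h | h
      · rw [max_eq_left h]
      · rw [max_eq_right h]; nlinarith [sq_nonneg (φ (Y j ω))]) (hE2 j)
  have hmonκ : ∀ k {q : ℝ}, 0 ≤ q →
      (Monotone (fun y => revMax φ k y ^ q) ∧ Monotone (fun y => expLinear (φ y))) ∨
      (Antitone (fun y => revMax φ k y ^ q) ∧ Antitone (fun y => expLinear (φ y))) :=
    fun k q hq => hmon.imp
      (fun h => ⟨fun x y hxy => Real.rpow_le_rpow (revMax_nonneg _ _ _) (monotone_revMax h k hxy) hq,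
        monotone_expLinear.comp h⟩)
      (fun h => ⟨fun x y hxy => Real.rpow_le_rpow (revMax_nonneg _ _ _) (antitone_revMax h k hxy) hq,
        monotone_expLinear.comp_antitone h⟩)
  have hmonσ : ∀ k {q : ℝ}, 0 ≤ q →
      (Monotone (fun y => revMax φ k y ^ q) ∧ Monotone (fun y => max (φ y) 0 ^ 2)) ∨
      (Antitone (fun y => revMax φ k y ^ q) ∧ Antitone (fun y => max (φ y) 0 ^ 2)) :=
    fun k q hq => hmon.imp
      (fun h => ⟨fun x y hxy => Real.rpow_le_rpow (revMax_nonneg _ _ _) (monotone_revMax h k hxy) hq,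
        fun x y hxy => pow_le_pow_left₀ (le_max_right _ _) (max_le_max (h hxy) le_rfl) 2⟩)
      (fun h => ⟨fun x y hxy => Real.rpow_le_rpow (revMax_nonneg _ _ _) (antitone_revMax h k hxy) hq,
        fun x y hxy => pow_le_pow_left₀ (le_max_right _ _) (max_le_max (h hxy) le_rfl) 2⟩)
  set c := d / n + d * β with hc
  have hc0 : 0 ≤ c := by positivity
  have main : ∀ k : ℕ, S.E (fun ω => revMax φ k (fun m => Y (i + (m : ℕ)) ω) ^ r)
      ≤ (((1 + d / n) ^ k * (k * c) : ℝ) : EReal) := by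
    intro k
    induction k with
    | zero =>
      have : ((0 : ℝ) ^ r) = 0 := Real.zero_rpow (by linarith)
      simp [revMax, this, S.const 0]
    | succ k ih =>
      set xk : ℝ := (1 + d / n) ^ k * (k * c) with hxk
      have hxk0 : 0 ≤ xk := by positivity
      have hr1 : S.E (fun ω => revMax φ k (fun m => Y (i + (m : ℕ)) ω) ^ (r - 1))
          ≤ ((1 + xk : ℝ) : EReal) :=
        S.E_le_of_le (hRH k (by linarith)) (S.add_mem (S.const_mem 1) (hRH k (by linarith)))
          (fun ω => rpow_le_one_add_rpow (by linarith) (by linarith) (revMax_nonneg _ _ _))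
          (S.E_add_le (S.const_mem 1) (hRH k (by linarith)) (S.const 1).le ih)
      have hT2 := S.E_mul_le_of_negDepSeq hY hnd i k (hRq k (q := r - 1) (by linarith)) hκ
        (hmonκ k (by linarith)) (fun y => Real.rpow_nonneg (revMax_nonneg _ _ _) _)
        (fun y => Real.rpow_le_rpow (hRb k y).1 (hRb k y).2 (by linarith)) hκB (hκE0 _) hr1 (hκE _)
      have hT3 := S.E_mul_le_of_negDepSeq hY hnd i k (hRq k (q := r) (by linarith)) hσ
        (hmonσ k (by linarith)) (fun y => Real.rpow_nonneg (revMax_nonneg _ _ _) _)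
        (fun y => Real.rpow_le_rpow (hRb k y).1 (hRb k y).2 (by linarith)) hσB (hσE0 _) ih (hσE _)
      have hm2 := S.mul_mem (hRH k (q := r - 1) (by linarith)) (S.comp_mem_one (hY (i + k)) hκ)
      have hm3 := S.mul_mem (hRH k (q := r) (by linarith)) (S.comp_mem_one (hY (i + k)) hσ)
      have hm4 := S.add_mem (hφr (i + k)) (hφ2 (i + k))
      have hT4 := S.E_add_le (hφr (i + k)) (hφ2 (i + k)) (hEr _) (hE2 _)
      have hsum := S.E_add_le (S.add_mem (S.add_mem (hRH k (q := r) (by linarith))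
          (S.const_mul_mem r hm2)) (S.const_mul_mem C hm3)) (S.const_mul_mem C hm4)
        (S.E_add_le (S.add_mem (hRH k (q := r) (by linarith)) (S.const_mul_mem r hm2))
          (S.const_mul_mem C hm3)
          (S.E_add_le (hRH k (q := r) (by linarith)) (S.const_mul_mem r hm2) ih
            (S.E_const_mul_le hm2 (by linarith) hT2)) (S.E_const_mul_le hm3 hC hT3))
        (S.E_const_mul_le hm4 hC hT4)
      refine (S.E_le_of_le (hRH (k + 1) (by linarith)) (S.add_mem (S.add_mem (S.add_mem
        (hRH k (q := r) (by linarith)) (S.const_mul_mem r hm2)) (S.const_mul_mem C hm3))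
        (S.const_mul_mem C hm4)) (fun ω => ?_) hsum).trans ?_
      · exact hpt _ _ (revMax_nonneg φ k _)
      · rw [EReal.coe_le_coe_iff]
        calc _ = (1 + d / n) * xk + (d / n + C * β) := by rw [hd]; ring
          _ ≤ (1 + d / n) * xk + 1 * c := by
              rw [hc, hd]
              have : 0 ≤ r * β := mul_nonneg (by linarith) hβ
              linarith
          _ ≤ (1 + d / n) * xk + (1 + d / n) ^ (k + 1) * c := by
              gcongr
              exact one_le_pow₀ (by have : 0 ≤ d / n := by positivity
                                    linarith)
          _ = _ := by rw [hxk]; push_cast; ring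
  refine (main n).trans ?_
  rw [EReal.coe_le_coe_iff]
  have h1 : (1 + d / n) ^ n ≤ Real.exp d := by
    calc (1 + d / n) ^ n ≤ Real.exp (d / n) ^ n := by
          have := Real.add_one_le_exp (d / n)
          gcongr
          linarith
      _ = Real.exp d := by
          rw [← Real.exp_nat_mul]; congr 1; field_simp
  have h2 : n * c = d * (1 + n * β) := by rw [hc]; field_simp
  rw [h2]
  calc _ ≤ Real.exp d * (d * (1 + n * β)) := by gcongr
    _ = _ := by ring

end SublinearExpectation

/-! ### Truncation -/

/-- Truncation at the levels `-x` and `x`. -/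
noncomputable def truncate (x y : ℝ) : ℝ := max (-x) (min y x)

theorem abs_truncate_sub_le (x y z : ℝ) : |truncate x y - truncate x z| ≤ 1 * |y - z| := by
  rw [one_mul]
  calc _ ≤ |min y x - min z x| := by
        simpa [truncate] using abs_max_sub_max_le_max (-x) (min y x) (-x) (min z x)
    _ ≤ _ := by simpa using abs_min_sub_min_le_max y x z x

theorem monotone_truncate (x : ℝ) : Monotone (truncate x) := fun y z h => by
  unfold truncate; gcongr

theorem abs_truncate {x : ℝ} (hx : 0 ≤ x) (y : ℝ) : |truncate x y| = min |y| x := by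
  unfold truncate
  rcases le_total 0 y with h | h
  · rw [abs_of_nonneg h, max_eq_right (by rw [le_min_iff]; constructor <;> linarith),
      abs_of_nonneg (le_min h hx)]
  · rw [abs_of_nonpos h, min_eq_left (by linarith), abs_of_nonpos (max_le (by linarith) h)]
    rw [← min_neg_neg, neg_neg, min_comm]

theorem abs_sub_truncate {x : ℝ} (hx : 0 ≤ x) (y : ℝ) : |y - truncate x y| = max (|y| - x) 0 := by
  unfold truncate
  rcases le_total 0 y with h | h
  · rw [abs_of_nonneg h, max_eq_right (by rw [le_min_iff]; constructor <;> linarith)]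
    rcases le_total y x with h1 | h1
    · rw [min_eq_left h1, max_eq_right (by linarith)]; simp
    · rw [min_eq_right h1, max_eq_left (by linarith), abs_of_nonneg (by linarith)]
  · rw [abs_of_nonpos h, min_eq_left (by linarith)]
    rcases le_total (-x) y with h1 | h1
    · rw [max_eq_right h1, max_eq_right (by linarith)]; simp
    · rw [max_eq_left h1, max_eq_left (by linarith), abs_of_nonpos (by linarith)]; ring

theorem le_add_rpow_mul {r b c : ℝ} (hr : 1 ≤ r) (hb : 0 ≤ b) (hc : 0 < c) :
    b ≤ c + c ^ (1 - r) * b ^ r := by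
  rcases le_total b c with h | h
  · have : 0 ≤ c ^ (1 - r) * b ^ r := by positivity
    linarith
  · have hb0 : 0 < b := by linarith
    have h1 : b ^ (1 - r) ≤ c ^ (1 - r) := Real.rpow_le_rpow_of_nonpos hc h (by linarith)
    have h2 : b ^ (1 - r) * b ^ r = b := by rw [← Real.rpow_add hb0]; simp
    have h3 : b ^ (1 - r) * b ^ r ≤ c ^ (1 - r) * b ^ r := by gcongr
    linarith

theorem add_rpow_le_two_rpow_mul {r a b : ℝ} (hr : 0 ≤ r) (ha : 0 ≤ a) (hb : 0 ≤ b) :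
    (a + b) ^ r ≤ 2 ^ r * (a ^ r + b ^ r) := by
  have ha' : 0 ≤ a ^ r := by positivity
  have hb' : 0 ≤ b ^ r := by positivity
  rcases le_total a b with h | h
  · calc (a + b) ^ r ≤ (2 * b) ^ r := Real.rpow_le_rpow (by linarith) (by linarith) hr
      _ = 2 ^ r * b ^ r := Real.mul_rpow (by norm_num) hb
      _ ≤ _ := by gcongr; linarith
  · calc (a + b) ^ r ≤ (2 * a) ^ r := Real.rpow_le_rpow (by linarith) (by linarith) hr
      _ = 2 ^ r * a ^ r := Real.mul_rpow (by norm_num) ha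
      _ ≤ _ := by gcongr; linarith

/-- Partial sums in terms of excesses over a level and of maxima of the centered truncated sums. -/
theorem abs_sum_range_le (y : ℕ → ℝ) {x s e e' M : ℝ} (hx : 0 ≤ x) (hs : 0 < s) (he : e ≤ M)
    (he' : e' ≤ M) (hM : 0 ≤ M) {k n : ℕ} (hk : k ≤ n) :
    |∑ j ∈ Finset.range k, y j| ≤ ∑ j ∈ Finset.range n, max (|y j| - x) 0
      + s * revMax (fun z => (truncate x z - e) / s) n (fun i => y i)
      + s * revMax (fun z => (-truncate x z - e') / s) n (fun i => y i) + 2 * (n * M) := by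
  set RU := revMax (fun z => (truncate x z - e) / s) n (fun i => y i)
  set RD := revMax (fun z => (-truncate x z - e') / s) n (fun i => y i)
  have hcard : ∀ {m : ℕ} {e : ℝ}, e ≤ M → ∑ _j ∈ Finset.Ico m n, e ≤ n * M := fun {m e} he => by
    rw [Finset.sum_const, Nat.card_Ico, nsmul_eq_mul]
    have h1 : ((n - m : ℕ) : ℝ) ≤ n := by exact_mod_cast Nat.sub_le n m
    calc ((n - m : ℕ) : ℝ) * e ≤ (n - m : ℕ) * M := by gcongr
      _ ≤ n * M := by gcongr
  have hU : ∀ m, m ≤ n → ∑ j ∈ Finset.Ico m n, truncate x (y j) ≤ s * RU + n * M := fun m hm => by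
    have h1 := sum_Ico_le_revMax (fun z => (truncate x z - e) / s) y hm
    rw [← Finset.sum_div, div_le_iff₀ hs, Finset.sum_sub_distrib] at h1
    have := hcard (m := m) he
    linarith
  have hD : ∀ m, m ≤ n → -∑ j ∈ Finset.Ico m n, truncate x (y j) ≤ s * RD + n * M := fun m hm => by
    have h1 := sum_Ico_le_revMax (fun z => (-truncate x z - e') / s) y hm
    rw [← Finset.sum_div, div_le_iff₀ hs, Finset.sum_sub_distrib, Finset.sum_neg_distrib] at h1
    have := hcard (m := m) he'
    linarith
  have h1 : ∑ j ∈ Finset.range k, truncate x (y j) =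
      ∑ j ∈ Finset.Ico 0 n, truncate x (y j) - ∑ j ∈ Finset.Ico k n, truncate x (y j) := by
    rw [Finset.range_eq_Ico, ← Finset.sum_Ico_consecutive _ (Nat.zero_le k) hk]; ring
  have h2 : |∑ j ∈ Finset.range k, truncate x (y j)| ≤ s * RU + s * RD + 2 * (n * M) := by
    rw [h1, abs_le]
    have := hU 0 (Nat.zero_le _)
    have := hD 0 (Nat.zero_le _)
    have := hU k hk
    have := hD k hk
    constructor <;> linarith
  have h3 : |∑ j ∈ Finset.range k, (y j - truncate x (y j))|
      ≤ ∑ j ∈ Finset.range n, max (|y j| - x) 0 := by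
    refine (Finset.abs_sum_le_sum_abs _ _).trans ?_
    simp only [abs_sub_truncate hx]
    exact Finset.sum_le_sum_of_subset_of_nonneg (Finset.range_mono hk)
      fun _ _ _ => le_max_right _ _
  have h4 : ∑ j ∈ Finset.range k, y j = ∑ j ∈ Finset.range k, (y j - truncate x (y j))
      + ∑ j ∈ Finset.range k, truncate x (y j) := by
    rw [← Finset.sum_add_distrib]; simp
  rw [h4]
  refine (abs_add_le _ _).trans ?_
  linarith

theorem maxPartialSum_movingAverage_le {Ω : Type*} {a : ℤ → ℝ} {Y : ℤ → Ω → ℝ} {ω : Ω} {n : ℕ}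
    (hn : 1 ≤ n) {b : ℤ → ℝ} (hb : Summable fun i => |a i| * b i)
    (h : ∀ (i : ℤ) (k : ℕ), k ≤ n → |∑ j ∈ Finset.range k, Y (i + 1 + j) ω| ≤ b i) :
    maxPartialSum (movingAverage a Y) n ω ≤ ∑' i, |a i| * b i := by
  have : Nonempty (Fin n) := ⟨⟨0, hn⟩⟩
  refine ciSup_le fun k => ?_
  have hs : ∀ j ∈ Finset.range ((k : ℕ) + 1), Summable fun i : ℤ => a i * Y (i + 1 + j) ω := by
    intro j hj
    have hj' : j + 1 ≤ n := by
      have := Finset.mem_range.1 hj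
      have := k.2
      omega
    refine Summable.of_norm_bounded (hb.mul_left 2) fun i => ?_
    rw [norm_mul, Real.norm_eq_abs, Real.norm_eq_abs, mul_left_comm]
    refine mul_le_mul_of_nonneg_left ?_ (abs_nonneg _)
    have h1 := h i j (by omega)
    have h2 := h i (j + 1) hj'
    rw [Finset.sum_range_succ] at h2
    rw [abs_le] at h1 h2 ⊢
    constructor <;> linarith [h1.1, h1.2, h2.1, h2.2]
  have h1 : ∑ j ∈ Finset.Icc 1 ((k : ℕ) + 1), movingAverage a Y j ω
      = ∑' i, a i * ∑ j ∈ Finset.range ((k : ℕ) + 1), Y (i + 1 + j) ω := by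
    have h2 : ∑ j ∈ Finset.Icc 1 ((k : ℕ) + 1), movingAverage a Y j ω
        = ∑ j ∈ Finset.range ((k : ℕ) + 1), movingAverage a Y (j + 1) ω := by
      rw [Finset.range_eq_Ico, Finset.sum_Ico_add' (fun j => movingAverage a Y j ω)]
      congr 1
    rw [h2]
    simp only [Finset.mul_sum]
    rw [Summable.tsum_finsetSum hs]
    refine Finset.sum_congr rfl fun j _ => ?_
    unfold movingAverage
    congr 1; ext i
    congr 2; push_cast; ring
  rw [h1, ← Real.norm_eq_abs]
  refine tsum_of_norm_bounded hb.hasSum fun i => ?_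
  rw [norm_mul, Real.norm_eq_abs, Real.norm_eq_abs]
  refine mul_le_mul_of_nonneg_left (h i _ ?_) (abs_nonneg _)
  exact k.2

theorem summable_and_tsum_le_of_ofReal {ι : Type*} {u : ι → ℝ} (hu : ∀ i, 0 ≤ u i) {δ : ℝ}
    (hδ : 0 ≤ δ) (h : ∑' i, ENNReal.ofReal (u i) ≤ ENNReal.ofReal δ) :
    Summable u ∧ ∑' i, u i ≤ δ := by
  have h1 : Summable u := by
    have := ENNReal.summable_toReal (h.trans_lt ENNReal.ofReal_lt_top).ne
    simpa only [ENNReal.toReal_ofReal (hu _)] using this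
  refine ⟨h1, ?_⟩
  rw [← ENNReal.ofReal_tsum_of_nonneg hu h1] at h
  exact (ENNReal.ofReal_le_ofReal_iff hδ).1 h

namespace SublinearExpectation

variable {Ω : Type*} [MeasurableSpace Ω] (S : SublinearExpectation Ω)

theorem E_add_const {X : Ω → ℝ} (hX : X ∈ S.H) {e : ℝ} (he : S.E X = (e : EReal)) (c : ℝ) :
    S.E (fun ω => X ω + c) = ((e + c : ℝ) : EReal) := by
  refine le_antisymm (S.E_add_le hX (S.const_mem c) he.le (S.const c).le) ?_
  by_contra hlt
  obtain ⟨b, hb1, hb2⟩ := EReal.lt_iff_exists_real_btwn.1 (not_le.1 hlt)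
  have h1 := S.E_add_le (S.add_mem hX (S.const_mem c)) (S.const_mem (-c)) hb1.le (S.const (-c)).le
  simp only [add_neg_cancel_right, he] at h1
  have h2 : e ≤ b + -c := by exact_mod_cast h1
  have h3 : b < e + c := by exact_mod_cast hb2
  linarith

/-- The moment bound for the maxima of centered sums of a bounded monotone function. -/
theorem exists_E_mul_revMax_rpow_le {Y : ℤ → Ω → ℝ} (hY : ∀ i, Y i ∈ S.H) (hnd : S.NegDepSeq Y)
    {r : ℝ} (hr : 2 ≤ r) : ∃ D : ℝ, 0 < D ∧ ∀ (c : ℝ → ℝ) (b e s σ B : ℝ) (n : ℕ),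
      (Monotone c ∨ Antitone c) → (∀ x y, |c x - c y| ≤ 1 * |x - y|) → (∀ y, |c y| ≤ b) →
      1 ≤ n → 0 < s → 0 ≤ B → (∀ j, S.E (fun ω => c (Y j ω)) = (e : EReal)) →
      (∀ j, S.E (fun ω => |c (Y j ω)| ^ (2 : ℝ)) ≤ (σ : EReal)) → 4 * (n * σ) ≤ s ^ 2 →
      (∀ j, S.E (fun ω => |c (Y j ω)| ^ r) ≤ (B : EReal)) →
      ∀ (i : ℤ) (x : ℝ), 0 < x →
        (fun ω => (s * revMax (fun z => (c z - e) / s) n (fun k => Y (i + (k : ℕ)) ω) / x) ^ r) ∈ S.H ∧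
        S.E (fun ω => (s * revMax (fun z => (c z - e) / s) n (fun k => Y (i + (k : ℕ)) ω) / x) ^ r)
          ≤ ((D * ((s ^ r + n * B) / x ^ r) : ℝ) : EReal) := by
  obtain ⟨D, hD, hmax⟩ := S.exists_E_revMax_rpow_le hY hnd hr
  refine ⟨D * (2 * 2 ^ r), by positivity, ?_⟩
  intro c b e s σ B n hmon hLip hb hn hs hB hE hE2 hσ hEr i x hx
  have hn0 : (0 : ℝ) < n := by exact_mod_cast hn
  have hc : LocLip c := LocLip.of_lipschitz (L := 1) hLip
  have hcm : ∀ j, (fun ω => c (Y j ω)) ∈ S.H := fun j => S.comp_mem_one (hY j) hc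
  have hcr : ∀ {q : ℝ}, 1 ≤ q → ∀ j, (fun ω => |c (Y j ω)| ^ q) ∈ S.H := fun hq j =>
    S.comp_mem_one (hY j) (hc.abs.rpow_of_bounded (fun y => ⟨abs_nonneg _, hb y⟩) hq)
  have he2 : |e| ^ (2 : ℝ) ≤ σ :=
    S.abs_rpow_le_of_E_eq (hcm 0) (by norm_num) (hE 0) (hcr (by norm_num) 0) (hE2 0)
  have her : |e| ^ r ≤ B :=
    S.abs_rpow_le_of_E_eq (hcm 0) (by linarith) (hE 0) (hcr (by linarith) 0) (hEr 0)
  set φ : ℝ → ℝ := fun z => (c z - e) / s with hφ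
  have hφLip : ∀ x y, |φ x - φ y| ≤ s⁻¹ * |x - y| := fun x y => by
    have h1 : φ x - φ y = s⁻¹ * (c x - c y) := by simp only [hφ]; field_simp; ring
    rw [h1, abs_mul, abs_of_pos (inv_pos.2 hs)]
    have := hLip x y
    rw [one_mul] at this
    gcongr
  have hφb : ∀ y, |φ y| ≤ (b + |e|) / s := fun y => by
    simp only [hφ]
    rw [abs_div, abs_of_pos hs]
    gcongr
    exact (abs_sub _ _).trans (by gcongr; exact hb y)
  have hφl : LocLip φ := LocLip.of_lipschitz (L := s⁻¹) hφLip
  have hφm : ∀ j, (fun ω => φ (Y j ω)) ∈ S.H := fun j => S.comp_mem_one (hY j) hφl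
  have hφmon : Monotone φ ∨ Antitone φ := hmon.imp
    (fun h x y hxy => by have := h hxy; simp only [hφ]; gcongr)
    (fun h x y hxy => by have := h hxy; simp only [hφ]; gcongr)
  have hφE : ∀ j, S.E (fun ω => φ (Y j ω)) = 0 := fun j => by
    have h1 := S.E_add_const (hcm j) (hE j) (-e)
    have h2 : (fun ω => φ (Y j ω)) = fun ω => s⁻¹ * (c (Y j ω) + -e) := by
      ext ω; simp only [hφ]; field_simp; ring
    rw [h2, S.pos_homogeneous _ (S.add_mem (hcm j) (S.const_mem _)) _ (inv_pos.2 hs).le, h1]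
    simp
  have hφE2 : ∀ j, S.E (fun ω => φ (Y j ω) ^ 2) ≤ ((1 / n : ℝ) : EReal) := fun j => by
    have h1 := S.E_const_mul_le (S.add_mem (hcr (q := 2) (by norm_num) j) (S.const_mem σ))
      (c := 2 / s ^ 2) (by positivity)
      (S.E_add_le (hcr (q := 2) (by norm_num) j) (S.const_mem σ) (hE2 j) (S.const σ).le)
    have h3 : (2 / s ^ 2 * (σ + σ) : ℝ) ≤ 1 / n := by
      rw [div_mul_eq_mul_div, div_le_div_iff₀ (by positivity) hn0]; linarith
    refine (S.E_le_of_le (by simpa [sq] using S.mul_mem (hφm j) (hφm j)) (S.const_mul_mem _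
      (S.add_mem (hcr (q := 2) (by norm_num) j) (S.const_mem σ))) (fun ω => ?_) h1).trans
      (by exact_mod_cast h3)
    rw [Real.rpow_two, sq_abs] at he2
    rw [Real.rpow_two, sq_abs]
    simp only [hφ]
    rw [div_pow, div_mul_eq_mul_div]
    gcongr
    nlinarith [sq_nonneg (c (Y j ω) + e)]
  have hφEr : ∀ j, S.E (fun ω => |φ (Y j ω)| ^ r)
      ≤ ((2 ^ r / s ^ r * (B + B) : ℝ) : EReal) := fun j => by
    refine S.E_le_of_le (S.comp_mem_one (hY j) (hφl.abs.rpow_of_bounded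
      (fun y => ⟨abs_nonneg _, hφb y⟩) (by linarith))) (S.const_mul_mem _
      (S.add_mem (hcr (q := r) (by linarith) j) (S.const_mem B))) (fun ω => ?_)
      (S.E_const_mul_le (S.add_mem (hcr (q := r) (by linarith) j) (S.const_mem B))
      (c := 2 ^ r / s ^ r) (by positivity)
      (S.E_add_le (hcr (q := r) (by linarith) j) (S.const_mem B) (hEr j) (S.const B).le))
    simp only [hφ]
    rw [abs_div, abs_of_pos hs, Real.div_rpow (abs_nonneg _) hs.le, div_mul_eq_mul_div]
    gcongr
    calc |c (Y j ω) - e| ^ r ≤ (|c (Y j ω)| + |e|) ^ r :=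
          Real.rpow_le_rpow (abs_nonneg _) (abs_sub _ _) (by linarith)
      _ ≤ 2 ^ r * (|c (Y j ω)| ^ r + |e| ^ r) :=
          add_rpow_le_two_rpow_mul (by linarith) (abs_nonneg _) (abs_nonneg _)
      _ ≤ _ := by gcongr
  have key := hmax φ s⁻¹ ((b + |e|) / s) _ n hφmon (by positivity) hφLip hφb hn
    (by positivity : 0 ≤ 2 ^ r / s ^ r * (B + B)) hφE hφE2 hφEr i
  have hRH : (fun ω => revMax φ n (fun k => Y (i + (k : ℕ)) ω) ^ r) ∈ S.H :=
    S.comp_mem n (fun m => Y (i + (m : ℕ))) (fun m => hY _) _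
      ((LocLip.of_lipschitz (abs_revMax_sub_le (inv_pos.2 hs).le hφLip n)).rpow_of_bounded
        (fun y => ⟨revMax_nonneg _ _ _, revMax_le hφb n y⟩) (by linarith))
  have heq : (fun ω => (s * revMax φ n (fun k => Y (i + (k : ℕ)) ω) / x) ^ r)
      = fun ω => s ^ r / x ^ r * revMax φ n (fun k => Y (i + (k : ℕ)) ω) ^ r := by
    ext ω
    have := revMax_nonneg φ n (fun k => Y (i + (k : ℕ)) ω)
    rw [Real.div_rpow (by positivity) hx.le, Real.mul_rpow hs.le this]
    ring
  rw [heq]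
  refine ⟨S.const_mul_mem _ hRH, (S.E_const_mul_le hRH (by positivity) key).trans ?_⟩
  rw [EReal.coe_le_coe_iff]
  have hsr : 0 < s ^ r := by positivity
  have hxr : 0 < x ^ r := by positivity
  have h2 : (1 : ℝ) ≤ 2 * 2 ^ r := by
    have : (1 : ℝ) ≤ 2 ^ r := Real.one_le_rpow (by norm_num) (by linarith)
    linarith
  calc s ^ r / x ^ r * (D * (1 + n * (2 ^ r / s ^ r * (B + B))))
      = D * ((1 * s ^ r + 2 * 2 ^ r * (n * B)) / x ^ r) := by field_simp; ring
    _ ≤ D * ((2 * 2 ^ r * s ^ r + 2 * 2 ^ r * (n * B)) / x ^ r) := by gcongr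
    _ = _ := by ring

/-- Tail bound for the maxima of the partial sums of a moving average, in terms of truncated
moments at the level of the tail. -/
theorem exists_cap_maxPartialSum_le (hV : S.CapacityCountablySubadditive) {Y : ℤ → Ω → ℝ}
    (hY : ∀ i, Y i ∈ S.H) (hnd : S.NegDepSeq Y) {a : ℤ → ℝ} (ha : Summable fun i => |a i|) {r ε : ℝ}
    (hr : 2 ≤ r) (hε : 0 < ε) : ∃ C : ℝ, 0 < C ∧ ∀ (n : ℕ) (x M B s σ e e' : ℝ), 1 ≤ n → 0 < x →
      0 ≤ M → 0 ≤ B → 0 < s → 4 * (n * σ) ≤ s ^ 2 → e ≤ M → e' ≤ M →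
      (∀ j, S.E (fun ω => max (|Y j ω| - x) 0) ≤ (M : EReal)) →
      (∀ j, S.E (fun ω => truncate x (Y j ω)) = (e : EReal)) →
      (∀ j, S.E (fun ω => -truncate x (Y j ω)) = (e' : EReal)) →
      (∀ j, S.E (fun ω => |truncate x (Y j ω)| ^ (2 : ℝ)) ≤ (σ : EReal)) →
      (∀ j, S.E (fun ω => |truncate x (Y j ω)| ^ r) ≤ (B : EReal)) →
      S.cap {ω | ε * x < maxPartialSum (movingAverage a Y) n ω}
        ≤ ENNReal.ofReal (C * (n * M / x + (s ^ r + n * B) / x ^ r)) := by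
  obtain ⟨D, hD, hmax⟩ := S.exists_E_mul_revMax_rpow_le hY hnd hr
  set A := ∑' i, |a i| + 1 with hA
  have hA0 : 0 < A := by
    have : 0 ≤ ∑' i, |a i| := tsum_nonneg fun i => abs_nonneg _
    linarith
  set c := ε / (8 * A) with hc
  have hc0 : 0 < c := by positivity
  set q := 1 + c ^ (1 - r) with hq
  have hq0 : 0 < q := by positivity
  set δ := ε / (4 * q) with hδ
  have hδ0 : 0 < δ := by positivity
  refine ⟨4 * A / ε + 4 * A / δ * (1 + 2 * D), by positivity, ?_⟩
  intro n x M B s σ e e' hn hx hM hB hs hσ he he' hEM hEe hEe' hE2 hEr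
  have hn0 : (0 : ℝ) < n := by exact_mod_cast hn
  set Q := (s ^ r + n * B) / x ^ r with hQ
  have hQ0 : 0 ≤ Q := by positivity
  have hM0 : 0 ≤ n * M / x := by positivity
  rcases lt_or_ge (ε * x) (4 * A * (n * M)) with hbig | hsmall
  · refine (S.cap_le_one _).trans ?_
    rw [← ENNReal.ofReal_one]
    apply ENNReal.ofReal_le_ofReal
    have h1 : 1 ≤ 4 * A / ε * (n * M / x) := by
      rw [div_mul_div_comm, one_le_div (by positivity)]; linarith
    have h2 : 0 ≤ 4 * A / ε * Q := by positivity
    have h3 : 0 ≤ 4 * A / δ * (1 + 2 * D) * (n * M / x + Q) := by positivity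
    nlinarith
  have htb : ∀ y, |truncate x y| ≤ x := fun y => by
    rw [abs_truncate hx.le]; exact min_le_right _ _
  have hU := hmax (truncate x) x e s σ B n (Or.inl (monotone_truncate x)) (abs_truncate_sub_le x)
    htb hn hs hB hEe hE2 hσ hEr
  have hD' := hmax (fun y => -truncate x y) x e' s σ B n
    (Or.inr fun y z h => neg_le_neg (monotone_truncate x h))
    (fun y z => by
      have := abs_truncate_sub_le x z y
      rw [abs_sub_comm z y] at this
      convert this using 2; ring)
    (fun y => by rw [abs_neg]; exact htb y) hn hs hB hEe' (by simpa only [abs_neg] using hE2) hσ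
    (by simpa only [abs_neg] using hEr)
  set TU : ℤ → Ω → ℝ := fun i ω =>
    s * revMax (fun z => (truncate x z - e) / s) n (fun k => Y (i + 1 + (k : ℕ)) ω) / x with hTU
  set TD : ℤ → Ω → ℝ := fun i ω =>
    s * revMax (fun z => (-truncate x z - e') / s) n (fun k => Y (i + 1 + (k : ℕ)) ω) / x with hTD
  set F : ℤ → Ω → ℝ := fun i ω => ∑ j ∈ Finset.range n, max (|Y (i + 1 + j) ω| - x) 0 with hF
  have hexc : ∀ j, (fun ω => max (|Y j ω| - x) 0) ∈ S.H := fun j =>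
    S.comp_mem_one (φ := fun y => max (|y| - x) 0) (hY j) (LocLip.of_lipschitz (L := 1) fun y z => by
      rw [one_mul]
      calc _ ≤ |(|y| - x) - (|z| - x)| := by
            simpa using abs_max_sub_max_le_max (|y| - x) 0 (|z| - x) 0
        _ = |(|y| - |z|)| := by congr 1; ring
        _ ≤ _ := abs_abs_sub_abs_le y z)
  have hFH : ∀ i, F i ∈ S.H := fun i => S.sum_mem _ fun j _ => hexc _
  have hFE : ∀ i, S.E (F i) ≤ ((n * M : ℝ) : EReal) := fun i => by
    have := S.E_sum_le (Finset.range n) (X := fun j ω => max (|Y (i + 1 + j) ω| - x) 0)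
      (b := fun _ => M) (fun j _ => hexc _) fun j _ => hEM _
    simpa using this
  set ξ : ℤ → Ω → ℝ := fun i ω => x⁻¹ * F i ω + TU i ω ^ r + TD i ω ^ r with hξ
  have hF0 : ∀ i ω, 0 ≤ F i ω := fun i ω => Finset.sum_nonneg fun j _ => le_max_right _ _
  have hTU0 : ∀ i ω, 0 ≤ TU i ω := fun i ω =>
    div_nonneg (mul_nonneg hs.le (revMax_nonneg _ _ _)) hx.le
  have hTD0 : ∀ i ω, 0 ≤ TD i ω := fun i ω =>
    div_nonneg (mul_nonneg hs.le (revMax_nonneg _ _ _)) hx.le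
  have hTUr : ∀ i ω, 0 ≤ TU i ω ^ r := fun i ω => Real.rpow_nonneg (hTU0 i ω) _
  have hTDr : ∀ i ω, 0 ≤ TD i ω ^ r := fun i ω => Real.rpow_nonneg (hTD0 i ω) _
  have hξ0 : ∀ i ω, 0 ≤ ξ i ω := fun i ω =>
    add_nonneg (add_nonneg (mul_nonneg (inv_nonneg.2 hx.le) (hF0 i ω)) (hTUr i ω)) (hTDr i ω)
  have hξH : ∀ i, ξ i ∈ S.H := fun i => S.add_mem (S.add_mem (S.const_mul_mem _ (hFH i))
    (hU (i + 1) x hx).1) (hD' (i + 1) x hx).1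
  have hξE : ∀ i, S.E (ξ i) ≤ ((x⁻¹ * (n * M) + D * Q + D * Q : ℝ) : EReal) := fun i =>
    S.E_add_le (S.add_mem (S.const_mul_mem _ (hFH i)) (hU (i + 1) x hx).1) (hD' (i + 1) x hx).1
      (S.E_add_le (S.const_mul_mem _ (hFH i)) (hU (i + 1) x hx).1
        (S.E_const_mul_le (hFH i) (inv_nonneg.2 hx.le) (hFE i)) (hU (i + 1) x hx).2)
      (hD' (i + 1) x hx).2
  have hM0' : 0 ≤ x⁻¹ * (n * M) := by positivity
  have hcap := S.cap_tsum_int_lt_le hV ha (fun i => abs_nonneg _) hA0 (by linarith : _ ≤ A)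
    (by positivity : 0 ≤ x⁻¹ * (n * M) + D * Q + D * Q) hδ0 hξH hξ0 hξE
  refine (S.cap_mono fun ω hω => ?_).trans (hcap.trans (ENNReal.ofReal_le_ofReal ?_))
  · rw [mem_ofPred_eq] at hω ⊢
    by_contra hcon
    obtain ⟨hsum, htsum⟩ := summable_and_tsum_le_of_ofReal
      (fun i => mul_nonneg (abs_nonneg (a i)) (hξ0 i ω)) hδ0.le (not_lt.1 hcon)
    have hbd : ∀ (i : ℤ) (k : ℕ), k ≤ n →
        |∑ j ∈ Finset.range k, Y (i + 1 + j) ω| ≤ x * q * ξ i ω + (2 * c * x + 2 * (n * M)) := by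
      intro i k hk
      have h1 := abs_sum_range_le (fun j => Y (i + 1 + j) ω) hx.le hs he he' hM hk
      have h2 := le_add_rpow_mul (r := r) (by linarith) (hTU0 i ω) hc0
      have h3 := le_add_rpow_mul (r := r) (by linarith) (hTD0 i ω) hc0
      have h4 : s * revMax (fun z => (truncate x z - e) / s) n (fun k => Y (i + 1 + (k : ℕ)) ω)
          = x * TU i ω := by simp only [hTU]; field_simp
      have h5 : s * revMax (fun z => (-truncate x z - e') / s) n (fun k => Y (i + 1 + (k : ℕ)) ω)
          = x * TD i ω := by simp only [hTD]; field_simp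
      rw [h4, h5] at h1
      refine h1.trans ?_
      have h6 : x * q * ξ i ω = F i ω + x * (TU i ω ^ r + TD i ω ^ r) + x * c ^ (1 - r) * (x⁻¹ * F i ω)
          + x * (c ^ (1 - r) * TU i ω ^ r + c ^ (1 - r) * TD i ω ^ r) := by
        simp only [hξ, hq]; field_simp; ring
      have h7 : 0 ≤ x * (TU i ω ^ r + TD i ω ^ r) :=
        mul_nonneg hx.le (add_nonneg (hTUr i ω) (hTDr i ω))
      have h8 : 0 ≤ x * c ^ (1 - r) * (x⁻¹ * F i ω) := by
        have := hF0 i ω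
        positivity
      have h9 := mul_le_mul_of_nonneg_left h2 hx.le
      have h10 := mul_le_mul_of_nonneg_left h3 hx.le
      have h11 : ∑ j ∈ Finset.range n, max (|Y (i + 1 + j) ω| - x) 0 = F i ω := rfl
      rw [h6, h11]
      linarith
    have heq : (fun i => |a i| * (x * q * ξ i ω + (2 * c * x + 2 * (n * M))))
        = fun i => x * q * (|a i| * ξ i ω) + (2 * c * x + 2 * (n * M)) * |a i| := by
      ext i; ring
    have hs1 := hsum.mul_left (x * q)
    have hs2 := ha.mul_left (2 * c * x + 2 * (n * M))
    have h1 := maxPartialSum_movingAverage_le (a := a) (Y := Y) (ω := ω) hn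
      (b := fun i => x * q * ξ i ω + (2 * c * x + 2 * (n * M))) (by rw [heq]; exact hs1.add hs2) hbd
    rw [heq, hs1.tsum_add hs2, tsum_mul_left, tsum_mul_left] at h1
    have h2 : x * q * ∑' i, |a i| * ξ i ω ≤ x * q * δ := by gcongr
    have h3 : (2 * c * x + 2 * (n * M)) * ∑' i, |a i| ≤ (2 * c * x + 2 * (n * M)) * A := by
      gcongr; linarith
    have h4 : x * q * δ = ε * x / 4 := by rw [hδ]; field_simp
    have h5 : 2 * c * x * A = ε * x / 4 := by rw [hc]; field_simp; ring
    nlinarith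
  · have h1 : 4 * (x⁻¹ * (n * M) + D * Q + D * Q) * A / δ
        = 4 * A / δ * (n * M / x + 2 * D * Q) := by field_simp; ring
    rw [h1]
    have h2 : 0 ≤ 4 * A / ε * (n * M / x + Q) := by positivity
    have h3 : n * M / x + 2 * D * Q ≤ (1 + 2 * D) * (n * M / x + Q) := by
      have : 0 ≤ D * (n * M / x) := by positivity
      nlinarith
    have h4 := mul_le_mul_of_nonneg_left h3 (by positivity : 0 ≤ 4 * A / δ)
    nlinarith

end SublinearExpectation

/-! ### Slowly varying functions -/

theorem exists_volume_lt_one_of_slowlyVarying {L : ℝ → ℝ} (hL : Measurable L)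
    (h : ∀ c : ℝ, 0 < c → Tendsto (fun x => L (c * x) / L x) atTop (𝓝 1)) {x : ℕ → ℝ}
    (hx : Tendsto x atTop atTop) : ∃ N : ℕ,
      volume {c ∈ Icc (1 : ℝ) 8 | ∃ m ≥ N, L (c * x m) / L (x m) ∉ Ioo (1 / 2 : ℝ) 2} < 1 := by
  set s : ℕ → Set ℝ := fun N =>
    {c ∈ Icc (1 : ℝ) 8 | ∃ m ≥ N, L (c * x m) / L (x m) ∉ Ioo (1 / 2 : ℝ) 2} with hs
  have hm : ∀ N, MeasurableSet (s N) := fun N => by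
    have : s N = Icc 1 8 ∩ ⋃ m ≥ N, {c | L (c * x m) / L (x m) ∉ Ioo (1 / 2 : ℝ) 2} := by
      ext c; simp [hs]
    rw [this]
    refine measurableSet_Icc.inter (MeasurableSet.iUnion fun m => MeasurableSet.iUnion fun _ => ?_)
    exact ((hL.comp (measurable_id.mul_const _)).div_const _) measurableSet_Ioo.compl
  have hanti : Antitone s := fun M N hMN c hc => ⟨hc.1, by
    obtain ⟨m, hm, h⟩ := hc.2
    exact ⟨m, hMN.trans hm, h⟩⟩
  have hemp : ⋂ N, s N = ∅ := by
    refine eq_empty_of_forall_notMem fun c hc => ?_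
    rw [mem_iInter] at hc
    have hc1 : (0 : ℝ) < c := lt_of_lt_of_le one_pos (hc 0).1.1
    have h1 := ((h c hc1).comp hx).eventually (Ioo_mem_nhds (by norm_num : (1 / 2 : ℝ) < 1)
      (by norm_num : (1 : ℝ) < 2))
    obtain ⟨N, hN⟩ := eventually_atTop.1 h1
    obtain ⟨m, hm, hbad⟩ := (hc N).2
    exact hbad (hN m hm)
  have ht := tendsto_measure_iInter_atTop (μ := volume) (fun N => (hm N).nullMeasurableSet) hanti
    ⟨0, ((measure_mono (fun c hc => hc.1)).trans_lt
      (measure_Icc_lt_top (a := (1 : ℝ)) (b := 8))).ne⟩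
  rw [hemp, measure_empty] at ht
  exact (ht.eventually (gt_mem_nhds one_pos)).exists

/-- A slowly varying function is comparable to a constant on `[k, k + 1]`, uniformly in large `k`. -/
theorem SlowlyVarying.eventually_le {l : ℝ → ℝ} (hl : SlowlyVarying l) :
    ∀ᶠ k : ℕ in atTop, ∀ x ∈ Icc (k : ℝ) (k + 1), l k ≤ 4 * l x ∧ l x ≤ 4 * l k := by
  classical
  set L : ℝ → ℝ := fun x => l (max x 0) with hLdef
  have hLm : Measurable L :=
    hl.measurable.comp (Measurable.subtype_mk (measurable_id.max measurable_const)
      (h := fun x => le_max_right _ _))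
  have hLl : ∀ {x}, 0 ≤ x → L x = l x := fun {x} hx => by simp only [hLdef, max_eq_left hx]
  have hLp : ∀ x, 0 < L x := fun x => hl.pos _ (le_max_right _ _)
  have hLt : ∀ c : ℝ, 0 < c → Tendsto (fun x => L (c * x) / L x) atTop (𝓝 1) := fun c hc => by
    refine (hl.tendsto c hc).congr' ?_
    filter_upwards [eventually_ge_atTop (0 : ℝ)] with x hx
    rw [hLl hx, hLl (by positivity)]
  by_contra hcon
  rw [not_eventually] at hcon
  set y : ℕ → ℝ := fun k =>
    if h : ∃ x ∈ Icc (k : ℝ) (k + 1), ¬ (l k ≤ 4 * l x ∧ l x ≤ 4 * l k) then h.choose else k with hy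
  have hyk : ∀ k : ℕ, y k ∈ Icc (k : ℝ) (k + 1) := fun k => by
    simp only [hy]
    split_ifs with h
    · exact h.choose_spec.1
    · exact ⟨le_rfl, by linarith⟩
  obtain ⟨N₁, hN₁⟩ := exists_volume_lt_one_of_slowlyVarying hLm hLt tendsto_natCast_atTop_atTop
  obtain ⟨N₂, hN₂⟩ := exists_volume_lt_one_of_slowlyVarying hLm hLt
    (tendsto_atTop_mono (fun k => (hyk k).1) tendsto_natCast_atTop_atTop)
  obtain ⟨k, hbad, hk⟩ := (hcon.and_eventually (eventually_ge_atTop (max 1 (max N₁ N₂)))).exists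
  have hk1 : (1 : ℝ) ≤ k := by exact_mod_cast (le_max_left _ _).trans hk
  have hkN₁ : N₁ ≤ k := ((le_max_left _ _).trans (le_max_right _ _)).trans hk
  have hkN₂ : N₂ ≤ k := ((le_max_right _ _).trans (le_max_right _ _)).trans hk
  have hbad' : ¬ (l k ≤ 4 * l (y k) ∧ l (y k) ≤ 4 * l k) := by
    have h : ∃ x ∈ Icc (k : ℝ) (k + 1), ¬ (l k ≤ 4 * l x ∧ l x ≤ 4 * l k) := by
      simpa only [not_forall, exists_prop] using hbad
    have : y k = h.choose := by simp only [hy]; rw [dif_pos h]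
    rw [this]
    exact h.choose_spec.2
  have hy0 : 0 < y k := by linarith [(hyk k).1]
  set ρ := y k / k with hρ
  have hρ1 : 1 ≤ ρ := by rw [hρ, le_div_iff₀ (by linarith)]; linarith [(hyk k).1]
  have hρ2 : ρ ≤ 2 := by rw [hρ, div_le_iff₀ (by linarith)]; linarith [(hyk k).2]
  set A := {c ∈ Icc (1 : ℝ) 8 | ∃ m ≥ N₁, L (c * (m : ℝ)) / L m ∉ Ioo (1 / 2 : ℝ) 2}
  set B := {c ∈ Icc (1 : ℝ) 8 | ∃ m ≥ N₂, L (c * y m) / L (y m) ∉ Ioo (1 / 2 : ℝ) 2}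
  have hex : ∃ c ∈ Icc (2 : ℝ) 8, c ∉ A ∧ c * ρ⁻¹ ∉ B := by
    by_contra hno
    have hsub : Icc (2 : ℝ) 8 ⊆ A ∪ (fun c => c * ρ⁻¹) ⁻¹' B := fun c hc => by
      by_contra hc'
      rw [mem_union, not_or] at hc'
      exact hno ⟨c, hc, hc'.1, hc'.2⟩
    have h1 := (measure_mono (μ := volume) hsub).trans (measure_union_le _ _)
    rw [Real.volume_preimage_mul_right (inv_ne_zero (by linarith)), inv_inv, Real.volume_Icc,
      abs_of_nonneg (by linarith)] at h1
    have h2 : volume A + ENNReal.ofReal ρ * volume B ≤ 1 + ENNReal.ofReal 2 * 1 := by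
      gcongr
    have h3 := h1.trans h2
    have h4 : (1 : ENNReal) + ENNReal.ofReal 2 * 1 = ENNReal.ofReal 3 := by
      rw [mul_one, ← ENNReal.ofReal_one, ← ENNReal.ofReal_add (by norm_num) (by norm_num)]
      norm_num
    rw [h4, ENNReal.ofReal_le_ofReal_iff (by norm_num)] at h3
    norm_num at h3
  obtain ⟨c, hc, hcA, hcB⟩ := hex
  have h1 : L (c * k) / L k ∈ Ioo (1 / 2 : ℝ) 2 := by
    by_contra h
    exact hcA ⟨⟨by linarith [hc.1], hc.2⟩, k, hkN₁, h⟩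
  have h2 : L (c * ρ⁻¹ * y k) / L (y k) ∈ Ioo (1 / 2 : ℝ) 2 := by
    by_contra h
    refine hcB ⟨⟨?_, ?_⟩, k, hkN₂, h⟩
    · rw [← div_eq_mul_inv, le_div_iff₀ (by linarith)]; linarith [hc.1]
    · rw [← div_eq_mul_inv, div_le_iff₀ (by linarith)]; linarith [hc.2]
  have h3 : c * ρ⁻¹ * y k = c * k := by rw [hρ]; field_simp
  rw [h3] at h2
  have hLk := hLp k
  have hLy := hLp (y k)
  rw [mem_Ioo, lt_div_iff₀ hLk, div_lt_iff₀ hLk] at h1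
  rw [mem_Ioo, lt_div_iff₀ hLy, div_lt_iff₀ hLy] at h2
  rw [← hLl (by linarith : (0 : ℝ) ≤ k), ← hLl hy0.le] at hbad'
  refine hbad' ⟨?_, ?_⟩ <;> linarith [h1.1, h1.2, h2.1, h2.2]

/-! ### Changes of variables -/

theorem setLIntegral_Ioi_affine (F : ℝ → ENNReal) {c : ℝ} (hc : 0 < c) (b d : ℝ) :
    ∫⁻ t in Ioi d, F t = ENNReal.ofReal c * ∫⁻ x in Ioi b, F (d + c * (x - b)) := by
  have himg : (fun x => d + c * (x - b)) '' Ioi b = Ioi d := by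
    ext t
    simp only [mem_image, mem_Ioi]
    constructor
    · rintro ⟨x, hx, rfl⟩
      have := mul_pos hc (sub_pos.2 hx)
      linarith
    · intro ht
      have := div_pos (sub_pos.2 ht) hc
      refine ⟨b + (t - d) / c, by linarith, by field_simp; ring⟩
  have h := lintegral_image_eq_lintegral_abs_deriv_mul (s := Ioi b) measurableSet_Ioi
    (f := fun x => d + c * (x - b)) (f' := fun _ => c)
    (fun x _ => by
      have := (((hasDerivAt_id x).sub_const b).const_mul c).const_add d
      simpa using this.hasDerivWithinAt)
    (fun x _ y _ h => by
      have : c * (x - b) = c * (y - b) := by simpa using h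
      have := mul_left_cancel₀ hc.ne' this
      linarith) F
  rw [himg, lintegral_const_mul' _ _ (by simp)] at h
  rw [h, abs_of_pos hc]

theorem setLIntegral_Ioi_rpow (F : ℝ → ENNReal) {q : ℝ} (hq : 0 < q) :
    ∫⁻ t in Ioi (0 : ℝ), F t
      = ∫⁻ y in Ioi (0 : ℝ), ENNReal.ofReal (q * y ^ (q - 1)) * F (y ^ q) := by
  have himg : (fun y : ℝ => y ^ q) '' Ioi 0 = Ioi 0 := by
    ext t
    simp only [mem_image, mem_Ioi]
    constructor
    · rintro ⟨x, hx, rfl⟩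
      positivity
    · intro ht
      refine ⟨t ^ (q⁻¹), by positivity, ?_⟩
      rw [← Real.rpow_mul ht.le, inv_mul_cancel₀ hq.ne', Real.rpow_one]
  have h := lintegral_image_eq_lintegral_abs_deriv_mul (s := Ioi (0 : ℝ)) measurableSet_Ioi
    (f := fun y => y ^ q) (f' := fun y => q * y ^ (q - 1))
    (fun x hx => (Real.hasDerivAt_rpow_const (Or.inl (ne_of_gt hx))).hasDerivWithinAt)
    (fun x hx y hy h => (Real.rpow_left_inj (le_of_lt hx) (le_of_lt hy) hq.ne').1 h) F
  rw [himg] at h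
  rw [h]
  refine setLIntegral_congr_fun measurableSet_Ioi fun y hy => ?_
  have hy : 0 < y := hy
  rw [abs_of_nonneg (by positivity)]

namespace SublinearExpectation

variable {Ω : Type*} [MeasurableSpace Ω] (S : SublinearExpectation Ω)

/-- The tail of `|X|` under the capacity. -/
noncomputable def tail (X : Ω → ℝ) (y : ℝ) : ENNReal := S.cap {ω | y < |X ω|}

theorem antitone_tail (X : Ω → ℝ) : Antitone (S.tail X) := S.antitone_cap fun ω => |X ω|

theorem tail_le_one (X : Ω → ℝ) (y : ℝ) : S.tail X y ≤ 1 := S.cap_le_one _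

theorem toENNReal_E_excess_le (hS : S.CountablySubadditive) {X X₀ : Ω → ℝ} (hX : X ∈ S.H)
    (hX₀ : X₀ ∈ S.H) (hid : S.IdentDistributed X X₀) (x : ℝ) :
    (S.E fun ω => max (|X ω| - x) 0).toENNReal ≤ ∫⁻ y in Ioi x, S.tail X₀ y := by
  refine (S.toENNReal_E_le_lintegral_cap hS hX hX₀ hid (ψ := fun y => max (|y| - x) 0)
    (LocLip.of_lipschitz (L := 1) fun y z => ?_) fun y => le_max_right _ _).trans ?_
  · rw [one_mul]
    calc _ ≤ |(|y| - x) - (|z| - x)| := by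
          simpa using abs_max_sub_max_le_max (|y| - x) 0 (|z| - x) 0
      _ = |(|y| - |z|)| := by congr 1; ring
      _ ≤ _ := abs_abs_sub_abs_le y z
  · rw [setLIntegral_Ioi_affine (S.tail X₀) one_pos 0 x, ENNReal.ofReal_one, one_mul]
    refine setLIntegral_mono' measurableSet_Ioi fun t ht => S.cap_mono fun ω hω => ?_
    rw [mem_ofPred_eq] at hω ⊢
    rcases lt_max_iff.1 hω with h | h
    · linarith
    · exact absurd ht (not_lt.2 h.le)

theorem toENNReal_E_truncate_rpow_le (hS : S.CountablySubadditive) {X X₀ : Ω → ℝ} (hX : X ∈ S.H)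
    (hX₀ : X₀ ∈ S.H) (hid : S.IdentDistributed X X₀) {x q : ℝ} (hx : 0 < x) (hq : 1 ≤ q) :
    (S.E fun ω => |truncate x (X ω)| ^ q).toENNReal
      ≤ ENNReal.ofReal q * ∫⁻ y in Ioo 0 x, ENNReal.ofReal (y ^ (q - 1)) * S.tail X₀ y := by
  have hl : LocLip fun y => |truncate x y| ^ q :=
    (LocLip.of_lipschitz (L := 1) (abs_truncate_sub_le x)).abs.rpow_of_bounded (B := x)
      (fun y => ⟨abs_nonneg _, by rw [abs_truncate hx.le]; exact min_le_right _ _⟩) hq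
  refine (S.toENNReal_E_le_lintegral_cap hS hX hX₀ hid hl fun y => by positivity).trans ?_
  rw [setLIntegral_Ioi_rpow _ (by linarith : 0 < q), ← lintegral_const_mul' _ _ (by simp),
    ← lintegral_indicator measurableSet_Ioi, ← lintegral_indicator measurableSet_Ioo]
  refine lintegral_mono fun y => ?_
  by_cases hy : y ∈ Ioi (0 : ℝ)
  · rw [indicator_of_mem hy]
    have hy0 : 0 < y := hy
    by_cases hyx : y < x
    · have hmem : y ∈ Ioo 0 x := ⟨hy0, hyx⟩
      rw [indicator_of_mem hmem, ENNReal.ofReal_mul (by linarith), mul_assoc]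
      gcongr
      refine S.cap_mono fun ω hω => ?_
      rw [mem_ofPred_eq, abs_truncate hx.le] at hω
      have := (Real.rpow_lt_rpow_iff hy0.le (le_min (abs_nonneg _) hx.le) (by linarith)).1 hω
      exact lt_of_lt_of_le this (min_le_left _ _)
    · have : {ω | y ^ q < |truncate x (X₀ ω)| ^ q} = ∅ := by
        refine eq_empty_of_forall_notMem fun ω hω => ?_
        rw [mem_ofPred_eq, abs_truncate hx.le] at hω
        have := (Real.rpow_lt_rpow_iff hy0.le (le_min (abs_nonneg _) hx.le) (by linarith)).1 hω
        exact hyx (lt_of_lt_of_le this (min_le_right _ _))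
      rw [this, cap_empty]
      simp
  · rw [indicator_of_notMem hy]
    exact zero_le

theorem E_congr_of_bounded {X X₀ : Ω → ℝ} (hX : X ∈ S.H) (hX₀ : X₀ ∈ S.H)
    (hid : S.IdentDistributed X X₀) {ψ : ℝ → ℝ} (hψ : LocLip ψ) {b : ℝ} (hb : ∀ y, |ψ y| ≤ b) :
    ∃ e : ℝ, S.E (fun ω => ψ (X ω)) = (e : EReal) ∧ S.E (fun ω => ψ (X₀ ω)) = (e : EReal) := by
  obtain ⟨e, he⟩ := S.exists_E_eq_coe (S.comp_mem_one hX hψ) (fun ω => (abs_le.1 (hb _)).1)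
    (fun ω => (abs_le.1 (hb _)).2)
  obtain ⟨e', he'⟩ := S.exists_E_eq_coe (S.comp_mem_one hX₀ hψ) (fun ω => (abs_le.1 (hb _)).1)
    (fun ω => (abs_le.1 (hb _)).2)
  have := hid ψ hψ (by simp [he]) (by simp [he]) (by simp [he']) (by simp [he'])
  exact ⟨e, he, by rw [← this, he]⟩

theorem lintegral_tail_lt_top {X : Ω → ℝ} {p : ℝ} (hp : 1 ≤ p)
    (hG : ∫⁻ y in Ioi (0 : ℝ), ENNReal.ofReal (y ^ (p - 1)) * S.tail X y < ⊤) :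
    ∫⁻ y in Ioi (0 : ℝ), S.tail X y < ⊤ := by
  rw [← Ioc_union_Ioi_eq_Ioi (zero_le_one' ℝ)]
  refine (lintegral_union_le _ _ _).trans_lt (ENNReal.add_lt_top.2 ⟨?_, ?_⟩)
  · calc ∫⁻ y in Ioc (0 : ℝ) 1, S.tail X y ≤ ∫⁻ y in Ioc (0 : ℝ) 1, 1 :=
          lintegral_mono fun y => S.tail_le_one X y
      _ < ⊤ := by simp
  · calc ∫⁻ y in Ioi (1 : ℝ), S.tail X y
        ≤ ∫⁻ y in Ioi (1 : ℝ), ENNReal.ofReal (y ^ (p - 1)) * S.tail X y := by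
          refine setLIntegral_mono' measurableSet_Ioi fun y hy => ?_
          refine le_mul_of_one_le_left (zero_le) ?_
          rw [ENNReal.one_le_ofReal]
          exact Real.one_le_rpow (le_of_lt hy) (by linarith)
      _ ≤ ∫⁻ y in Ioi (0 : ℝ), ENNReal.ofReal (y ^ (p - 1)) * S.tail X y :=
          lintegral_mono_set (Ioi_subset_Ioi zero_le_one)
      _ < ⊤ := hG

theorem lintegral_Ioo_rpow_mul_tail_lt_top (X : Ω → ℝ) {q : ℝ} (hq : 1 ≤ q) (x : ℝ) :
    ∫⁻ y in Ioo 0 x, ENNReal.ofReal (y ^ (q - 1)) * S.tail X y < ⊤ := by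
  calc _ ≤ ∫⁻ y in Ioo 0 x, ENNReal.ofReal (x ^ (q - 1)) := by
        refine setLIntegral_mono' measurableSet_Ioo fun y hy => ?_
        calc _ ≤ ENNReal.ofReal (x ^ (q - 1)) * 1 := by
              refine mul_le_mul' (ENNReal.ofReal_le_ofReal ?_) (S.tail_le_one X y)
              exact Real.rpow_le_rpow hy.1.le hy.2.le (by linarith)
          _ = _ := mul_one _
    _ < ⊤ := by
        rw [setLIntegral_const]
        exact ENNReal.mul_lt_top ENNReal.ofReal_lt_top (by simp)

/-- Tail bound for the maxima of the partial sums of a moving average, in terms of the tail of the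
common distribution. -/
theorem exists_cap_maxPartialSum_le_tail (hS : S.CountablySubadditive)
    (hV : S.CapacityCountablySubadditive) {Y : ℤ → Ω → ℝ} (hY : ∀ i, Y i ∈ S.H)
    (hnd : S.NegDepSeq Y) {Y₀ : Ω → ℝ} (hY₀ : Y₀ ∈ S.H) (hid : ∀ i, S.IdentDistributed (Y i) Y₀)
    (hmean : S.E Y₀ = 0) (hmean' : S.E (fun ω => -Y₀ ω) = 0) {a : ℤ → ℝ}
    (ha : Summable fun i => |a i|) {p r ε : ℝ} (hp : 1 ≤ p) (hr : 2 ≤ r) (hε : 0 < ε)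
    (hG : ∫⁻ y in Ioi (0 : ℝ), ENNReal.ofReal (y ^ (p - 1)) * S.tail Y₀ y < ⊤) :
    ∃ C : ℝ, 0 < C ∧ ∀ (n : ℕ) (x : ℝ), 1 ≤ n → 0 < x →
      S.cap {ω | ε * x < maxPartialSum (movingAverage a Y) n ω} ≤ ENNReal.ofReal C *
        (ENNReal.ofReal n * (ENNReal.ofReal x⁻¹ * (∫⁻ y in Ioi x, S.tail Y₀ y)
          + ENNReal.ofReal (x ^ (-r))
            * ∫⁻ y in Ioo 0 x, ENNReal.ofReal (y ^ (r - 1)) * S.tail Y₀ y)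
        + ENNReal.ofReal ((n : ℝ) ^ (r / 2))
            * ENNReal.ofReal (x ^ (max 0 (2 - p) * r / 2 - r))) := by
  obtain ⟨C, hC, hcap⟩ := S.exists_cap_maxPartialSum_le hV hY hnd ha hr hε
  set G := (∫⁻ y in Ioi (0 : ℝ), ENNReal.ofReal (y ^ (p - 1)) * S.tail Y₀ y).toReal with hGdef
  have hG0 : 0 ≤ G := ENNReal.toReal_nonneg
  set K := 1 + p * G with hK
  have hK1 : 1 ≤ K := by have : 0 ≤ p * G := mul_nonneg (by linarith) hG0
                         linarith
  set D := C * (1 + (2 ^ r * K ^ (r / 2) + r)) with hD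
  refine ⟨D, by positivity, ?_⟩
  intro n x hn hx
  have hn0 : (0 : ℝ) < n := by exact_mod_cast hn
  have htl : LocLip (truncate x) := LocLip.of_lipschitz (L := 1) (abs_truncate_sub_le x)
  have htb : ∀ y, |truncate x y| ≤ x := fun y => by
    rw [abs_truncate hx.le]; exact min_le_right _ _
  have htl' : LocLip (fun y => -truncate x y) := htl.comp_lipschitz (G := fun z => -z) (L := 1)
    fun y z => by rw [one_mul, ← abs_neg]; exact le_of_eq (by congr 1; ring)
  have hm : ∫⁻ y in Ioi x, S.tail Y₀ y ≠ ⊤ :=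
    ((lintegral_mono_set (Ioi_subset_Ioi hx.le)).trans_lt (S.lintegral_tail_lt_top hp hG)).ne
  have hβ := (S.lintegral_Ioo_rpow_mul_tail_lt_top Y₀ (q := r) (by linarith) x).ne
  set M := (∫⁻ y in Ioi x, S.tail Y₀ y).toReal with hMdef
  set b := (∫⁻ y in Ioo 0 x, ENNReal.ofReal (y ^ (r - 1)) * S.tail Y₀ y).toReal with hbdef
  have hM0 : 0 ≤ M := ENNReal.toReal_nonneg
  have hb0 : 0 ≤ b := ENNReal.toReal_nonneg
  have hexc : ∀ {X : Ω → ℝ}, X ∈ S.H → S.IdentDistributed X Y₀ →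
      S.E (fun ω => max (|X ω| - x) 0) ≤ (M : EReal) := fun {X} hX hidX => by
    refine S.E_le_of_toENNReal_le hM0 ?_
    rw [hMdef, ENNReal.ofReal_toReal hm]
    exact S.toENNReal_E_excess_le hS hX hY₀ hidX x
  have hrid : S.IdentDistributed Y₀ Y₀ := fun ψ _ _ _ _ _ => rfl
  obtain ⟨e, -, he⟩ := S.E_congr_of_bounded (hY 0) hY₀ (hid 0) htl htb
  obtain ⟨e', -, he'⟩ := S.E_congr_of_bounded (hY 0) hY₀ (hid 0) htl' (b := x)
    (fun y => by rw [abs_neg]; exact htb y)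
  have hexcm : (fun ω => max (|Y₀ ω| - x) 0) ∈ S.H :=
    S.comp_mem_one (φ := fun y => max (|y| - x) 0) hY₀ (LocLip.of_lipschitz (L := 1) fun y z => by
      rw [one_mul]
      calc _ ≤ |(|y| - x) - (|z| - x)| := by
            simpa using abs_max_sub_max_le_max (|y| - x) 0 (|z| - x) 0
        _ = |(|y| - |z|)| := by congr 1; ring
        _ ≤ _ := abs_abs_sub_abs_le y z)
  have heM : e ≤ M := by
    have h1 := S.E_add_le hY₀ hexcm (a := 0) (by simp [hmean]) (hexc hY₀ hrid)
    have h2 := S.E_le_of_le (S.comp_mem_one hY₀ htl) (S.add_mem hY₀ hexcm) (fun ω => by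
      have h3 := abs_sub_truncate hx.le (Y₀ ω)
      have h4 := neg_abs_le (Y₀ ω - truncate x (Y₀ ω))
      rw [h3] at h4
      linarith) h1
    rw [he, zero_add] at h2
    exact_mod_cast h2
  have heM' : e' ≤ M := by
    have h1 := S.E_add_le (S.neg_mem hY₀) hexcm (a := 0) (by simp [hmean']) (hexc hY₀ hrid)
    have h2 := S.E_le_of_le (S.comp_mem_one hY₀ htl') (S.add_mem (S.neg_mem hY₀) hexcm) (fun ω => by
      have h3 := abs_sub_truncate hx.le (Y₀ ω)
      have h4 := le_abs_self (Y₀ ω - truncate x (Y₀ ω))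
      rw [h3] at h4
      linarith) h1
    rw [he', zero_add] at h2
    exact_mod_cast h2
  have hEe : ∀ j, S.E (fun ω => truncate x (Y j ω)) = (e : EReal) := fun j => by
    obtain ⟨e₁, h1, h2⟩ := S.E_congr_of_bounded (hY j) hY₀ (hid j) htl htb
    rw [h1, ← h2, he]
  have hEe' : ∀ j, S.E (fun ω => -truncate x (Y j ω)) = (e' : EReal) := fun j => by
    obtain ⟨e₁, h1, h2⟩ := S.E_congr_of_bounded (hY j) hY₀ (hid j) htl' (b := x)
      (fun y => by rw [abs_neg]; exact htb y)
    rw [h1, ← h2, he']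
  have hpow : ∀ {q : ℝ}, 1 ≤ q → ∀ j, (fun ω => |truncate x (Y j ω)| ^ q) ∈ S.H := fun hq j =>
    S.comp_mem_one (hY j) (htl.abs.rpow_of_bounded (fun y => ⟨abs_nonneg _, htb y⟩) hq)
  have hEp : ∀ j, S.E (fun ω => |truncate x (Y j ω)| ^ p) ≤ ((p * G : ℝ) : EReal) := fun j => by
    refine S.E_le_of_toENNReal_le (mul_nonneg (by linarith) hG0) ?_
    refine (S.toENNReal_E_truncate_rpow_le hS (hY j) hY₀ (hid j) hx hp).trans ?_
    rw [ENNReal.ofReal_mul (by linarith), hGdef, ENNReal.ofReal_toReal hG.ne]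
    gcongr
    exact fun y hy => hy.1
  have hEr : ∀ j, S.E (fun ω => |truncate x (Y j ω)| ^ r) ≤ ((r * b : ℝ) : EReal) := fun j => by
    refine S.E_le_of_toENNReal_le (mul_nonneg (by linarith) hb0) ?_
    refine (S.toENNReal_E_truncate_rpow_le hS (hY j) hY₀ (hid j) hx (by linarith)).trans ?_
    rw [ENNReal.ofReal_mul (by linarith), hbdef, ENNReal.ofReal_toReal hβ]
  set u := max 0 (2 - p) with hu
  have hxu : 0 < x ^ u := by positivity
  have hE2 : ∀ j, S.E (fun ω => |truncate x (Y j ω)| ^ (2 : ℝ)) ≤ ((K * x ^ u : ℝ) : EReal) := by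
    intro j
    rcases le_total 2 p with h2p | h2p
    · have hu0 : u = 0 := by rw [hu, max_eq_left (by linarith)]
      rw [hu0, Real.rpow_zero, mul_one]
      exact S.E_le_of_le (hpow (by norm_num) j) (S.add_mem (S.const_mem 1) (hpow hp j))
        (fun ω => rpow_le_one_add_rpow (by norm_num) h2p (abs_nonneg _))
        (S.E_add_le (S.const_mem 1) (hpow hp j) (S.const 1).le (hEp j))
    · have hu0 : u = 2 - p := by rw [hu, max_eq_right (by linarith)]
      refine (S.E_le_of_le (hpow (by norm_num) j) (S.const_mul_mem (x ^ u) (hpow hp j))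
        (fun ω => ?_) (S.E_const_mul_le (hpow hp j) hxu.le (hEp j))).trans ?_
      · rcases (abs_nonneg (truncate x (Y j ω))).eq_or_lt with h0 | h0
        · rw [← h0, Real.zero_rpow (by norm_num), Real.zero_rpow (by linarith), mul_zero]
        · have h1 : |truncate x (Y j ω)| ^ (2 : ℝ)
              = |truncate x (Y j ω)| ^ u * |truncate x (Y j ω)| ^ p := by
            rw [← Real.rpow_add h0, hu0]; congr 1; ring
          rw [h1]
          have := Real.rpow_le_rpow h0.le (htb (Y j ω)) (by rw [hu0]; linarith : 0 ≤ u)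
          gcongr
      · rw [EReal.coe_le_coe_iff, hK]
        nlinarith
  set s := 2 * Real.sqrt (n * (K * x ^ u)) with hs
  have hσ0 : 0 < n * (K * x ^ u) := by positivity
  have hs0 : 0 < s := mul_pos two_pos (Real.sqrt_pos.2 hσ0)
  have hs2 : 4 * (n * (K * x ^ u)) ≤ s ^ 2 := by
    rw [hs, mul_pow, Real.sq_sqrt hσ0.le]; norm_num
  have hsr : s ^ r = 2 ^ r * K ^ (r / 2) * ((n : ℝ) ^ (r / 2) * x ^ (u * r / 2)) := by
    rw [hs, Real.mul_rpow (by norm_num) (Real.sqrt_nonneg _), Real.sqrt_eq_rpow,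
      ← Real.rpow_mul hσ0.le, Real.mul_rpow hn0.le (by positivity),
      Real.mul_rpow (by linarith) hxu.le, ← Real.rpow_mul hx.le]
    rw [show 1 / 2 * r = r / 2 by ring, show u * (r / 2) = u * r / 2 by ring]
    ring
  refine (hcap n x M (r * b) s (K * x ^ u) e e' hn hx hM0 (mul_nonneg (by linarith) hb0) hs0 hs2
    heM heM' (fun j => hexc (hY j) (hid j)) hEe hEe' hE2 hEr).trans ?_
  have hR : (ENNReal.ofReal n * (ENNReal.ofReal x⁻¹ * (∫⁻ y in Ioi x, S.tail Y₀ y)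
          + ENNReal.ofReal (x ^ (-r))
            * ∫⁻ y in Ioo 0 x, ENNReal.ofReal (y ^ (r - 1)) * S.tail Y₀ y)
        + ENNReal.ofReal ((n : ℝ) ^ (r / 2)) * ENNReal.ofReal (x ^ (u * r / 2 - r)))
      = ENNReal.ofReal (n * (x⁻¹ * M + x ^ (-r) * b) + (n : ℝ) ^ (r / 2) * x ^ (u * r / 2 - r)) := by
    rw [ENNReal.ofReal_add (by positivity) (by positivity), ENNReal.ofReal_mul (by positivity),
      ENNReal.ofReal_add (by positivity) (by positivity), ENNReal.ofReal_mul (by positivity),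
      ENNReal.ofReal_mul (by positivity), ENNReal.ofReal_mul (by positivity), hMdef, hbdef,
      ENNReal.ofReal_toReal hm, ENNReal.ofReal_toReal hβ]
  rw [hR, ← ENNReal.ofReal_mul (by positivity)]
  refine ENNReal.ofReal_le_ofReal ?_
  rw [hsr, hD]
  set A := 2 ^ r * K ^ (r / 2) with hA
  have hA0 : 0 ≤ A := by positivity
  set T := (n : ℝ) ^ (r / 2) * x ^ (u * r / 2 - r) with hT
  have hT0 : 0 ≤ T := by positivity
  have h1 : (A * ((n : ℝ) ^ (r / 2) * x ^ (u * r / 2)) + n * (r * b)) / x ^ r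
      = A * T + r * (n * (x ^ (-r) * b)) := by
    rw [hT, Real.rpow_sub hx, Real.rpow_neg hx.le]; field_simp
  have h2 : (n : ℝ) * M / x = n * (x⁻¹ * M) := by field_simp
  rw [h1, h2, mul_assoc C]
  refine mul_le_mul_of_nonneg_left ?_ hC.le
  set a₁ := (n : ℝ) * (x⁻¹ * M)
  set a₂ := (n : ℝ) * (x ^ (-r) * b) with ha₂
  have h3 : (n : ℝ) * (x⁻¹ * M + x ^ (-r) * b) = a₁ + a₂ := by ring
  have ha1 : 0 ≤ a₁ := by positivity
  have ha2 : 0 ≤ a₂ := by positivity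
  rw [h3]
  nlinarith [mul_nonneg hA0 ha1, mul_nonneg hA0 ha2, mul_nonneg (by linarith : 0 ≤ r) ha1,
    mul_nonneg (by linarith : 0 ≤ r) hT0]

end SublinearExpectation

/-! ### Comparison of integrals of antitone functions -/

/-- A set that is closed downwards has measure at most `c` if its initial segments have. -/
theorem measure_le_of_forall_Ioc_le {μ : Measure ℝ} {A : Set ℝ} (hA0 : ∀ y ∈ A, 0 < y)
    (hA : ∀ y ∈ A, ∀ z, 0 < z → z ≤ y → z ∈ A) {c : ENNReal} (h : ∀ y ∈ A, μ (Ioc 0 y) ≤ c) :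
    μ A ≤ c := by
  by_cases hmax : ∃ b ∈ A, ∀ y ∈ A, y ≤ b
  · obtain ⟨b, hb, hle⟩ := hmax
    have hsub : A ⊆ Ioc 0 b := fun y hy => ⟨hA0 y hy, hle y hy⟩
    exact (measure_mono hsub).trans (h b hb)
  · have hcov : A ⊆ ⋃ q : {q : ℚ // (q : ℝ) ∈ A}, Ioc (0 : ℝ) (q : ℚ) := fun y hy => by
      by_contra hno
      refine hmax ⟨y, hy, fun z hz => ?_⟩
      by_contra hzy
      obtain ⟨q, hq1, hq2⟩ := exists_rat_btwn (not_le.1 hzy)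
      refine hno (mem_iUnion.2 ⟨⟨q, hA z hz q ((hA0 y hy).trans hq1) hq2.le⟩, hA0 y hy, hq1.le⟩)
    have hdir : Directed (· ⊆ ·) fun q : {q : ℚ // (q : ℝ) ∈ A} => Ioc (0 : ℝ) (q : ℚ) :=
      Monotone.directed_le fun a b hab => Ioc_subset_Ioc_right (by exact_mod_cast hab)
    refine (measure_mono hcov).trans ?_
    rw [hdir.measure_iUnion]
    exact iSup_le fun q => h _ q.2

theorem lintegral_mul_le_of_forall_lt {v H Φ : ℝ → ENNReal} (hv : Antitone v) (hH : Antitone H)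
    (hv1 : ∀ y, v y ≤ 1) (hH1 : ∀ y, H y ≤ 1) (hΦ : Measurable Φ)
    (h : ∀ y t : ℝ, 0 < y → 0 < t → ENNReal.ofReal t < ∫⁻ z in Ioc 0 y, Φ z → v y ≤ H t) :
    ∫⁻ y in Ioi (0 : ℝ), Φ y * v y ≤ ∫⁻ t in Ioi (0 : ℝ), H t := by
  have hvt : ∀ y, v y ≠ ⊤ := fun y => ((hv1 y).trans_lt ENNReal.one_lt_top).ne
  have hHt : ∀ y, H y ≠ ⊤ := fun y => ((hH1 y).trans_lt ENNReal.one_lt_top).ne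
  have hvm : Measurable fun y => (v y).toReal := hv.measurable.ennreal_toReal
  have hHm : Measurable fun y => (H y).toReal := hH.measurable.ennreal_toReal
  set μ := (volume.restrict (Ioi (0 : ℝ))).withDensity Φ with hμ
  have h1 : ∫⁻ y in Ioi (0 : ℝ), Φ y * v y = ∫⁻ u in Ioi (0 : ℝ), μ {y | u < (v y).toReal} := by
    rw [← lintegral_eq_lintegral_meas_lt μ (ae_of_all _ fun y => ENNReal.toReal_nonneg)
      hvm.aemeasurable]
    simp only [ENNReal.ofReal_toReal (hvt _)]
    rw [hμ, lintegral_withDensity_eq_lintegral_mul _ hΦ hv.measurable]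
    rfl
  have h2 : ∫⁻ t in Ioi (0 : ℝ), H t
      = ∫⁻ u in Ioi (0 : ℝ), volume.restrict (Ioi (0 : ℝ)) {t | u < (H t).toReal} := by
    rw [← lintegral_eq_lintegral_meas_lt _ (ae_of_all _ fun y => ENNReal.toReal_nonneg)
      hHm.aemeasurable]
    simp only [ENNReal.ofReal_toReal (hHt _)]
  rw [h1, h2]
  refine lintegral_mono fun u => ?_
  have hms : MeasurableSet {y | u < (v y).toReal} := measurableSet_lt measurable_const hvm
  have hmH : MeasurableSet {y | u < (H y).toReal} := measurableSet_lt measurable_const hHm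
  have hμs : ∀ s, MeasurableSet s → μ s = ∫⁻ z in s ∩ Ioi 0, Φ z := fun s hs => by
    rw [hμ, withDensity_apply _ hs, Measure.restrict_restrict hs]
  rw [Measure.restrict_apply hmH]
  refine le_of_forall_lt fun c hc => ?_
  obtain ⟨d, hcd, hd⟩ := exists_between hc
  have hdt : d ≠ ⊤ := (hd.trans_le le_top).ne
  refine hcd.trans_le ?_
  have hsub : Ioo 0 d.toReal ⊆ {y | u < (H y).toReal} ∩ Ioi 0 := fun t ht => by
    refine ⟨?_, ht.1⟩
    have htd : ENNReal.ofReal t < d := by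
      rw [← ENNReal.ofReal_toReal hdt]
      exact (ENNReal.ofReal_lt_ofReal_iff (ht.1.trans ht.2)).2 ht.2
    by_contra hno
    rw [mem_ofPred_eq] at hno
    have hle : μ ({y | u < (v y).toReal} ∩ Ioi 0) ≤ ENNReal.ofReal t := by
      have hdown : ∀ y ∈ {y | u < (v y).toReal} ∩ Ioi 0, ∀ z, 0 < z → z ≤ y →
          z ∈ {y | u < (v y).toReal} ∩ Ioi 0 := fun y hy z hz hzy =>
        ⟨lt_of_lt_of_le hy.1 (ENNReal.toReal_mono (hvt _) (hv hzy)), hz⟩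
      refine measure_le_of_forall_Ioc_le (fun y hy => hy.2) hdown fun y hy => ?_
      by_contra hlt
      rw [hμs _ measurableSet_Ioc, inter_eq_left.2 fun z hz => hz.1] at hlt
      have h3 := h y t hy.2 ht.1 (not_le.1 hlt)
      exact hno (lt_of_lt_of_le hy.1 (ENNReal.toReal_mono (hHt _) h3))
    rw [hμs _ (hms.inter measurableSet_Ioi), inter_assoc, inter_self, ← hμs _ hms] at hle
    exact absurd (hd.trans_le hle) (not_lt.2 htd.le)
  calc d = volume (Ioo 0 d.toReal) := by rw [Real.volume_Ioo, sub_zero, ENNReal.ofReal_toReal hdt]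
    _ ≤ _ := measure_mono hsub

theorem lintegral_mul_lintegral_Ioi {F v : ℝ → ENNReal} (hF : Measurable F) (hv : Measurable v) :
    ∫⁻ x in Ioi (0 : ℝ), F x * ∫⁻ y in Ioi x, v y
      = ∫⁻ y in Ioi (0 : ℝ), (∫⁻ x in Ioo 0 y, F x) * v y := by
  have hm : Measurable fun z : ℝ × ℝ => {z : ℝ × ℝ | 0 < z.1 ∧ z.1 < z.2}.indicator
      (fun z => F z.1 * v z.2) z :=
    ((hF.comp measurable_fst).mul (hv.comp measurable_snd)).indicator
      ((measurableSet_lt measurable_const measurable_fst).inter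
        (measurableSet_lt measurable_fst measurable_snd))
  have h1 : ∫⁻ x in Ioi (0 : ℝ), F x * ∫⁻ y in Ioi x, v y
      = ∫⁻ x, ∫⁻ y, {z : ℝ × ℝ | 0 < z.1 ∧ z.1 < z.2}.indicator (fun z => F z.1 * v z.2) (x, y) := by
    rw [← lintegral_indicator measurableSet_Ioi]
    refine lintegral_congr fun x => ?_
    by_cases hx : 0 < x
    · rw [indicator_of_mem (show x ∈ Ioi 0 from hx), ← lintegral_const_mul _ hv,
        ← lintegral_indicator measurableSet_Ioi]
      refine lintegral_congr fun y => ?_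
      by_cases hxy : x < y
      · rw [indicator_of_mem (show y ∈ Ioi x from hxy), indicator_of_mem (by exact ⟨hx, hxy⟩)]
      · rw [indicator_of_notMem (show y ∉ Ioi x from hxy),
          indicator_of_notMem (fun h => hxy h.2)]
    · rw [indicator_of_notMem (show x ∉ Ioi 0 from hx)]
      symm
      rw [lintegral_congr (g := fun _ => 0) fun y => indicator_of_notMem (fun h => hx h.1) _,
        lintegral_zero]
  have h2 : ∫⁻ y in Ioi (0 : ℝ), (∫⁻ x in Ioo 0 y, F x) * v y
      = ∫⁻ y, ∫⁻ x, {z : ℝ × ℝ | 0 < z.1 ∧ z.1 < z.2}.indicator (fun z => F z.1 * v z.2) (x, y) := by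
    rw [← lintegral_indicator measurableSet_Ioi]
    refine lintegral_congr fun y => ?_
    by_cases hy : 0 < y
    · rw [indicator_of_mem (show y ∈ Ioi 0 from hy), ← lintegral_mul_const _ hF,
        ← lintegral_indicator measurableSet_Ioo]
      refine lintegral_congr fun x => ?_
      by_cases hxy : 0 < x ∧ x < y
      · rw [indicator_of_mem (show x ∈ Ioo 0 y from hxy), indicator_of_mem (by exact hxy)]
      · rw [indicator_of_notMem (show x ∉ Ioo 0 y from hxy),
          indicator_of_notMem (show (x, y) ∉ {z : ℝ × ℝ | 0 < z.1 ∧ z.1 < z.2} from hxy)]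
    · rw [indicator_of_notMem (show y ∉ Ioi 0 from hy)]
      symm
      rw [lintegral_congr (g := fun _ => 0) fun x =>
        indicator_of_notMem (fun h => hy (h.1.trans h.2)) _, lintegral_zero]
  rw [h1, h2, lintegral_lintegral_swap hm.aemeasurable]

/-! ### Step functions with jumps at the points of a sequence -/

/-- The sum of `n ^ q * g n * l n / f n` over the indices `n ≥ 1` with `f n < x`. -/
noncomputable def stepSum (q : ℝ) (f g : ℕ → ℝ) (l : ℝ → ℝ) (x : ℝ) : ENNReal :=
  ∑' n : ℕ, (Ioi (f (n + 1))).indicator (fun _ => ENNReal.ofReal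
    (((n + 1 : ℕ) : ℝ) ^ q * g (n + 1) * l ((n + 1 : ℕ) : ℝ) / f (n + 1))) x

theorem measurable_stepSum (q : ℝ) (f g : ℕ → ℝ) (l : ℝ → ℝ) : Measurable (stepSum q f g l) :=
  Measurable.tsum fun _ => measurable_const.indicator measurableSet_Ioi

theorem monotone_stepSum (q : ℝ) (f g : ℕ → ℝ) (l : ℝ → ℝ) : Monotone (stepSum q f g l) := by
  intro x y hxy
  refine ENNReal.tsum_le_tsum fun n => ?_
  by_cases hx : x ∈ Ioi (f (n + 1))
  · rw [indicator_of_mem hx, indicator_of_mem (show y ∈ Ioi (f (n + 1)) from lt_of_lt_of_le hx hxy)]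
  · rw [indicator_of_notMem hx]; exact zero_le

section

variable {f g : ℕ → ℝ} {l : ℝ → ℝ}

theorem le_of_le_succ_of_one_le (hmono : ∀ n : ℕ, 1 ≤ n → f n ≤ f (n + 1)) {m n : ℕ} (hm : 1 ≤ m)
    (hmn : m ≤ n) : f m ≤ f n :=
  Nat.le_induction le_rfl (fun k hk ih => ih.trans (hmono k (hm.trans hk))) n hmn

theorem weightSum_nonneg (hf : ∀ n : ℕ, 1 ≤ n → 0 < f n) (hg : ∀ n : ℕ, 1 ≤ n → 0 < g n)
    (hl : ∀ x, 0 ≤ x → 0 < l x) (q : ℝ) (m : ℕ) : 0 ≤ weightSum q f g l m := by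
  refine Finset.sum_nonneg fun n hn => ?_
  have hn1 := (Finset.mem_Icc.1 hn).1
  have h1 := (hf n hn1).le
  have h2 := (hg n hn1).le
  have h3 := (hl n (Nat.cast_nonneg n)).le
  positivity

theorem stepSum_le (hf : ∀ n : ℕ, 1 ≤ n → 0 < f n) (hg : ∀ n : ℕ, 1 ≤ n → 0 < g n)
    (hl : ∀ x, 0 ≤ x → 0 < l x) (hmono : ∀ n : ℕ, 1 ≤ n → f n ≤ f (n + 1)) (q : ℝ) {k : ℕ} {x : ℝ}
    (hx : x ≤ f (k + 1)) : stepSum q f g l x ≤ ENNReal.ofReal (weightSum q f g l k) := by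
  have hsum : weightSum q f g l k = ∑ n ∈ Finset.range k,
      ((n + 1 : ℕ) : ℝ) ^ q * g (n + 1) * l ((n + 1 : ℕ) : ℝ) / f (n + 1) := by
    rw [weightSum, Finset.range_eq_Ico,
      Finset.sum_Ico_add' (fun n : ℕ => (n : ℝ) ^ q * g n * l n / f n) 0 k 1]
    congr 1
  rw [hsum, ENNReal.ofReal_sum_of_nonneg, stepSum, tsum_eq_sum (s := Finset.range k)]
  · refine Finset.sum_le_sum fun n _ => ?_
    exact indicator_le_self' (fun _ _ => zero_le) x
  · intro n hn
    refine indicator_of_notMem ?_ _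
    rw [Finset.mem_range, not_lt] at hn
    exact not_lt.2 (hx.trans (le_of_le_succ_of_one_le hmono (by omega) (by omega)))
  · intro n _
    have h1 := (hf (n + 1) (by omega)).le
    have h2 := (hg (n + 1) (by omega)).le
    have h3 := (hl ((n + 1 : ℕ) : ℝ) (Nat.cast_nonneg _)).le
    positivity

theorem lintegral_Ioc_inv {a b : ℝ} (ha : 0 < a) (hab : a ≤ b) :
    ∫⁻ x in Ioc a b, ENNReal.ofReal x⁻¹ = ENNReal.ofReal (Real.log (b / a)) := by
  have hi : IntervalIntegrable (fun x : ℝ => x⁻¹) volume a b :=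
    intervalIntegral.intervalIntegrable_inv (fun x hx => by
      rw [uIcc_of_le hab] at hx; exact (ha.trans_le hx.1).ne') continuousOn_id
  rw [← integral_inv_of_pos ha (ha.trans_le hab), intervalIntegral.integral_of_le hab,
    ofReal_integral_eq_lintegral_ofReal ((intervalIntegrable_iff_integrableOn_Ioc_of_le hab).1 hi)]
  filter_upwards [ae_restrict_mem measurableSet_Ioc] with x hx
  exact inv_nonneg.2 (ha.trans hx.1).le

theorem lintegral_Ioc_rpow_neg {r a b : ℝ} (hr : 1 < r) (ha : 0 < a) (hab : a ≤ b) :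
    ∫⁻ x in Ioc a b, ENNReal.ofReal (x ^ (-r))
      = ENNReal.ofReal ((a ^ (1 - r) - b ^ (1 - r)) / (r - 1)) := by
  have h0 : (0 : ℝ) ∉ uIcc a b := by
    rw [uIcc_of_le hab]; exact fun h => absurd h.1 (not_le.2 ha)
  have hi : IntervalIntegrable (fun x : ℝ => x ^ (-r)) volume a b :=
    intervalIntegral.intervalIntegrable_rpow (Or.inr h0)
  have hval : (a ^ (1 - r) - b ^ (1 - r)) / (r - 1) = ∫ x in a..b, x ^ (-r) := by
    rw [integral_rpow (Or.inr ⟨by linarith, h0⟩), show -r + 1 = 1 - r by ring,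
      ← neg_div_neg_eq]
    congr 1 <;> ring
  rw [hval, intervalIntegral.integral_of_le hab,
    ofReal_integral_eq_lintegral_ofReal ((intervalIntegrable_iff_integrableOn_Ioc_of_le hab).1 hi)]
  filter_upwards [ae_restrict_mem measurableSet_Ioc] with x hx
  exact Real.rpow_nonneg (ha.trans hx.1).le _

theorem lintegral_Ioc_stepSum_mul_le (hf : ∀ n : ℕ, 1 ≤ n → 0 < f n)
    (hg : ∀ n : ℕ, 1 ≤ n → 0 < g n) (hl : ∀ x, 0 ≤ x → 0 < l x)
    (hmono : ∀ n : ℕ, 1 ≤ n → f n ≤ f (n + 1)) (q : ℝ) {k : ℕ} {a b c : ℝ} (hb : b ≤ f (k + 1))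
    {u : ℝ → ENNReal} (hu : ∫⁻ x in Ioc a b, u x ≤ ENNReal.ofReal c) :
    ∫⁻ x in Ioc a b, stepSum q f g l x * u x ≤ ENNReal.ofReal (weightSum q f g l k * c) := by
  rw [ENNReal.ofReal_mul (weightSum_nonneg hf hg hl q k)]
  calc _ ≤ ∫⁻ x in Ioc a b, ENNReal.ofReal (weightSum q f g l k) * u x :=
        setLIntegral_mono' measurableSet_Ioc fun x hx => by
          gcongr
          exact stepSum_le hf hg hl hmono q (hx.2.trans hb)
    _ = ENNReal.ofReal (weightSum q f g l k) * ∫⁻ x in Ioc a b, u x :=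
        lintegral_const_mul' _ _ (by simp)
    _ ≤ _ := by gcongr

theorem lintegral_Ioc_zero_stepSum_mul (hf : ∀ n : ℕ, 1 ≤ n → 0 < f n)
    (hg : ∀ n : ℕ, 1 ≤ n → 0 < g n) (hl : ∀ x, 0 ≤ x → 0 < l x)
    (hmono : ∀ n : ℕ, 1 ≤ n → f n ≤ f (n + 1)) (q a : ℝ) (u : ℝ → ENNReal) :
    ∫⁻ x in Ioc a (f 1), stepSum q f g l x * u x = 0 := by
  rw [setLIntegral_congr_fun (g := fun _ => 0) measurableSet_Ioc]
  · simp
  · intro x hx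
    have := stepSum_le hf hg hl hmono q (k := 0) hx.2
    simp only [weightSum] at this
    simp at this
    simp [this]

theorem Ioi_subset_iUnion_Ioc (htop : Tendsto f atTop atTop) (k : ℕ) :
    Ioi (f k) ⊆ ⋃ j : ℕ, Ioc (f (k + j)) (f (k + j + 1)) := fun x hx => by
  classical
  have hex : ∃ j, x ≤ f (k + j + 1) := by
    obtain ⟨n, hn, hk⟩ := ((htop.eventually_ge_atTop x).and (eventually_ge_atTop (k + 1))).exists
    exact ⟨n - k - 1, by rw [show k + (n - k - 1) + 1 = n by omega]; exact hn⟩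
  refine mem_iUnion.2 ⟨Nat.find hex, ?_, Nat.find_spec hex⟩
  rcases Nat.eq_zero_or_pos (Nat.find hex) with h0 | h0
  · rw [h0]; exact hx
  · have := Nat.find_min hex (m := Nat.find hex - 1) (by omega)
    rw [show k + (Nat.find hex - 1) + 1 = k + Nat.find hex by omega] at this
    exact not_le.1 this

theorem lintegral_Ioi_le_tsum (htop : Tendsto f atTop atTop) (k : ℕ) (u : ℝ → ENNReal) {c : ℕ → ℝ}
    (hc0 : ∀ j, 0 ≤ c j) (hc : Summable c)
    (h : ∀ j, ∫⁻ x in Ioc (f (k + j)) (f (k + j + 1)), u x ≤ ENNReal.ofReal (c j)) :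
    ∫⁻ x in Ioi (f k), u x ≤ ENNReal.ofReal (∑' j, c j) := by
  rw [ENNReal.ofReal_tsum_of_nonneg hc0 hc]
  exact (lintegral_mono_set (Ioi_subset_iUnion_Ioc htop k)).trans
    ((lintegral_iUnion_le _ _).trans (ENNReal.tsum_le_tsum h))

end

/-! ### Consequences of the rate conditions -/

/-- `∫_0^y W(x) dx / x` for the step function `W` of the weights. -/
noncomputable def innerWeight (f g : ℕ → ℝ) (l : ℝ → ℝ) (y : ℝ) : ENNReal :=
  ∫⁻ x in Ioo 0 y, stepSum 1 f g l x * ENNReal.ofReal x⁻¹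

/-- `y^{r-1} ∫_y^∞ W(x) x^{-r} dx` for the step function `W` of the weights. -/
noncomputable def outerWeight (r : ℝ) (f g : ℕ → ℝ) (l : ℝ → ℝ) (y : ℝ) : ENNReal :=
  ENNReal.ofReal (y ^ (r - 1)) * ∫⁻ x in Ioi y, stepSum 1 f g l x * ENNReal.ofReal (x ^ (-r))

theorem innerWeight_mono (f g : ℕ → ℝ) (l : ℝ → ℝ) : Monotone (innerWeight f g l) :=
  fun _ _ h => lintegral_mono_set (Ioo_subset_Ioo_right h)

theorem outerWeight_eq (r : ℝ) (f g : ℕ → ℝ) (l : ℝ → ℝ) {y : ℝ} (hy : 0 < y) :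
    outerWeight r f g l y
      = ∫⁻ s in Ioi (1 : ℝ), stepSum 1 f g l (y * s) * ENNReal.ofReal (s ^ (-r)) := by
  rw [outerWeight, setLIntegral_Ioi_affine _ hy 1 y, ← mul_assoc, ← lintegral_const_mul' _ _
    (ENNReal.mul_ne_top ENNReal.ofReal_ne_top ENNReal.ofReal_ne_top)]
  refine setLIntegral_congr_fun measurableSet_Ioi fun s hs => ?_
  have hs0 : (0 : ℝ) < s := lt_trans one_pos hs
  have h1 : y + y * (s - 1) = y * s := by ring
  simp only [h1]
  rw [mul_left_comm, ← ENNReal.ofReal_mul (by positivity), ← ENNReal.ofReal_mul (by positivity)]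
  congr 2
  rw [Real.mul_rpow hy.le hs0.le, Real.rpow_neg hy.le, Real.rpow_sub_one hy.ne']
  have : y ^ r ≠ 0 := (Real.rpow_pos_of_pos hy r).ne'
  field_simp

theorem outerWeight_mono (r : ℝ) (f g : ℕ → ℝ) (l : ℝ → ℝ) {y z : ℝ} (hy : 0 < y) (hyz : y ≤ z) :
    outerWeight r f g l y ≤ outerWeight r f g l z := by
  rw [outerWeight_eq r f g l hy, outerWeight_eq r f g l (hy.trans_le hyz)]
  refine setLIntegral_mono' measurableSet_Ioi fun s hs => ?_
  have hs0 : (0 : ℝ) < s := lt_trans one_pos hs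
  gcongr
  exact monotone_stepSum _ _ _ _ (by gcongr)

theorem Asymptotics.IsBigO.exists_nat_bound {u v : ℕ → ℝ} (h : u =O[atTop] v) :
    ∃ C : ℝ, 0 < C ∧ ∀ᶠ k in atTop, u k ≤ C * |v k| := by
  obtain ⟨C, hC, hb⟩ := h.exists_pos
  refine ⟨C, hC, hb.bound.mono fun k hk => (le_abs_self _).trans ?_⟩
  simpa using hk

namespace RateConditions

variable {p r : ℝ} {f g : ℕ → ℝ} {l : ℝ → ℝ}

theorem rpow_sub_nonneg (hfg : RateConditions p r f g l) (hf : ∀ n : ℕ, 1 ≤ n → 0 < f n)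
    (hr : 1 ≤ r) {m : ℕ} (hm : 1 ≤ m) : 0 ≤ f m ^ (1 - r) - f (m + 1) ^ (1 - r) :=
  sub_nonneg.2 (Real.rpow_le_rpow_of_nonpos (hf m hm) (hfg.c1_mono m hm) (by linarith))

theorem lintegral_Ioc_inv_le (hfg : RateConditions p r f g l) (hf : ∀ n : ℕ, 1 ≤ n → 0 < f n)
    (hg : ∀ n : ℕ, 1 ≤ n → 0 < g n) (hl : ∀ x, 0 ≤ x → 0 < l x) (k : ℕ) :
    ∫⁻ x in Ioc 0 (f (k + 1)), stepSum 1 f g l x * ENNReal.ofReal x⁻¹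
      ≤ ENNReal.ofReal (∑ m ∈ Finset.Icc 1 k, Real.log (f (m + 1) / f m) * weightSum 1 f g l m) := by
  induction k with
  | zero =>
    rw [lintegral_Ioc_zero_stepSum_mul hf hg hl hfg.c1_mono]
    exact zero_le
  | succ k ih =>
    have hk := hf (k + 1) (by omega)
    have hmono := hfg.c1_mono (k + 1) (by omega)
    have hlog : ∀ m ∈ Finset.Icc 1 k, 0 ≤ Real.log (f (m + 1) / f m) * weightSum 1 f g l m :=
      fun m hm => by
        have hm1 := (Finset.mem_Icc.1 hm).1
        refine mul_nonneg (Real.log_nonneg ?_) (weightSum_nonneg hf hg hl 1 m)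
        rw [one_le_div (hf m hm1)]; exact hfg.c1_mono m hm1
    rw [← Ioc_union_Ioc_eq_Ioc hk.le hmono, Finset.sum_Icc_succ_top (by omega),
      ENNReal.ofReal_add (Finset.sum_nonneg hlog) (mul_nonneg (Real.log_nonneg (by
        rw [one_le_div hk]; exact hmono)) (weightSum_nonneg hf hg hl 1 _))]
    refine (lintegral_union_le _ _ _).trans (add_le_add ih ?_)
    rw [mul_comm (Real.log _)]
    exact lintegral_Ioc_stepSum_mul_le hf hg hl hfg.c1_mono 1 le_rfl
      (lintegral_Ioc_inv hk hmono).le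

theorem lintegral_Ioi_rpow_le (hfg : RateConditions p r f g l) (hf : ∀ n : ℕ, 1 ≤ n → 0 < f n)
    (hg : ∀ n : ℕ, 1 ≤ n → 0 < g n) (hl : ∀ x, 0 ≤ x → 0 < l x) (hr : 1 < r) {k : ℕ} (hk : 1 ≤ k) :
    ∫⁻ x in Ioi (f k), stepSum 1 f g l x * ENNReal.ofReal (x ^ (-r))
      ≤ ENNReal.ofReal ((∑' j : ℕ,
        (f (k + j) ^ (1 - r) - f (k + j + 1) ^ (1 - r)) * weightSum 1 f g l (k + j)) / (r - 1)) := by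
  rw [← tsum_div_const]
  refine lintegral_Ioi_le_tsum hfg.c1_atTop k _ (fun j => ?_) ?_ fun j => ?_
  · exact div_nonneg (mul_nonneg (hfg.rpow_sub_nonneg hf hr.le (by omega))
      (weightSum_nonneg hf hg hl 1 _)) (by linarith)
  · exact (hfg.c3_summable.comp_injective (add_right_injective k)).div_const _
  · rw [mul_comm, mul_div_assoc]
    exact lintegral_Ioc_stepSum_mul_le hf hg hl hfg.c1_mono 1 le_rfl
      (lintegral_Ioc_rpow_neg hr (hf _ (by omega)) (hfg.c1_mono _ (by omega))).le

theorem lintegral_stepSum_half_lt_top (hfg : RateConditions p r f g l)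
    (hf : ∀ n : ℕ, 1 ≤ n → 0 < f n) (hg : ∀ n : ℕ, 1 ≤ n → 0 < g n) (hl : ∀ x, 0 ≤ x → 0 < l x)
    (hr : 1 < r) :
    ∫⁻ x in Ioi (0 : ℝ), stepSum (r / 2) f g l x
      * ENNReal.ofReal (x ^ (max 0 (2 - p) * r / 2 - r)) < ⊤ := by
  set t := max 0 (2 - p) * r / 2 with ht
  have ht0 : 0 ≤ t := by
    have : 0 ≤ max 0 (2 - p) := le_max_left _ _
    have : 0 ≤ max 0 (2 - p) * r := mul_nonneg this (by linarith)
    positivity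
  rw [← Ioc_union_Ioi_eq_Ioi (hf 1 le_rfl).le]
  refine (lintegral_union_le _ _ _).trans_lt (ENNReal.add_lt_top.2 ⟨?_, ?_⟩)
  · rw [lintegral_Ioc_zero_stepSum_mul hf hg hl hfg.c1_mono]; exact ENNReal.zero_lt_top
  have hsum := ((hfg.c5.comp_injective (add_right_injective 1)).div_const (r - 1))
  refine lt_of_le_of_lt (lintegral_Ioi_le_tsum hfg.c1_atTop 1 _ (fun j => ?_) hsum fun j => ?_)
    ENNReal.ofReal_lt_top
  · have h1 := (hf (1 + j + 1) (by omega)).le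
    exact div_nonneg (mul_nonneg (mul_nonneg (hfg.rpow_sub_nonneg hf hr.le (m := 1 + j) (by omega))
      (Real.rpow_nonneg h1 _)) (weightSum_nonneg hf hg hl _ _)) (by linarith)
  · have hfp := hf (1 + j) (by omega)
    have hfm := hfg.c1_mono (1 + j) (by omega)
    have h2 := lintegral_Ioc_stepSum_mul_le hf hg hl hfg.c1_mono (r / 2) (k := 1 + j) (a := f (1 + j))
      (u := fun x => ENNReal.ofReal (x ^ (t - r))) (c := f (1 + j + 1) ^ t *
        ((f (1 + j) ^ (1 - r) - f (1 + j + 1) ^ (1 - r)) / (r - 1))) le_rfl (by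
        have h0 : 0 ≤ f (1 + j + 1) ^ t := Real.rpow_nonneg (hfp.le.trans hfm) _
        rw [ENNReal.ofReal_mul h0, ← lintegral_Ioc_rpow_neg hr hfp hfm,
          ← lintegral_const_mul' _ _ (by simp)]
        refine setLIntegral_mono' measurableSet_Ioc fun x hx => ?_
        have hx0 : 0 < x := hfp.trans hx.1
        rw [← ENNReal.ofReal_mul h0]
        refine ENNReal.ofReal_le_ofReal ?_
        rw [sub_eq_add_neg, Real.rpow_add hx0]
        gcongr
        exact hx.2)
    refine h2.trans (le_of_eq ?_)
    congr 1
    simp only [Function.comp]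
    ring

/-- The weights are dominated by the moment function of the theorem. -/
theorem exists_weight_le (hfg : RateConditions p r f g l) (hf : ∀ n : ℕ, 1 ≤ n → 0 < f n)
    (hg : ∀ n : ℕ, 1 ≤ n → 0 < g n) (hl : SlowlyVarying l) {finv : ℝ → ℝ}
    (hfinv : IsInverseSeq f finv) (hp : 1 ≤ p) (hr : 2 ≤ r) (hpr : p ≤ r) :
    ∃ C₀ C : ℝ, 0 ≤ C₀ ∧ 0 < C ∧ ∀ y : ℝ, 0 < y →
      ENNReal.ofReal y * (innerWeight f g l y + outerWeight r f g l y)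
        ≤ ENNReal.ofReal (C₀ + C * (y ^ p * max 1 (l (finv y)))) := by
  have hlp := hl.pos
  obtain ⟨c₂, hc₂, h₂⟩ := hfg.c2.exists_nat_bound
  obtain ⟨c₃, hc₃, h₃⟩ := hfg.c3.exists_nat_bound
  obtain ⟨c₄, hc₄, h₄⟩ := hfg.c4.exists_nat_bound
  obtain ⟨K, hK⟩ := eventually_atTop.1 ((h₂.and (h₃.and (h₄.and hl.eventually_le))).and
    (eventually_ge_atTop 1))
  have hK1 : 1 ≤ K := (hK K le_rfl).2
  have hr1 : 0 < r - 1 := by linarith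
  set C := c₂ * 4 + (2 ^ (r - p) * c₃ * 4 / (r - 1) + (c₄ * 4 / (r - 1) + c₃ * 16 / (r - 1))) with hC
  have hC0 : 0 < C := by positivity
  have key : ∀ k, K ≤ k → ∀ y, f k ≤ y → y < f (k + 1) →
      ENNReal.ofReal y * (innerWeight f g l y + outerWeight r f g l y)
        ≤ ENNReal.ofReal (C * (y ^ p * max 1 (l (finv y)))) := by
    intro k hk y hky hyk
    obtain ⟨⟨h2k, h3k, h4k, hlk⟩, hk1⟩ := hK k hk
    obtain ⟨⟨-, h3k', -, -⟩, -⟩ := hK (k + 1) (by omega)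
    have hfk := hf k hk1
    have hy : 0 < y := hfk.trans_le hky
    have hfk' : 0 < f (k + 1) := hy.trans hyk
    have hlk0 := hlp k (Nat.cast_nonneg k)
    have hlk0' := hlp ((k + 1 : ℕ) : ℝ) (Nat.cast_nonneg _)
    rw [abs_of_pos (by positivity)] at h2k h3k h4k h3k'
    set lam := l (finv y) with hlam
    have hb := hfinv.bounds k hk1 y hky hyk
    have hlam1 : l k ≤ 4 * lam := (hlk (finv y) hb).1
    have hlam2 : l ((k + 1 : ℕ) : ℝ) ≤ 16 * lam := by
      have := (hlk ((k + 1 : ℕ) : ℝ) ⟨by push_cast; linarith, by push_cast; linarith⟩).2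
      linarith
    have hlam0 : 0 < lam := by linarith
    have hw0 := weightSum_nonneg hf hg hlp 1 k
    have hyp : 0 < y ^ (p - 1) := by positivity
    set P := y ^ (p - 1) * lam with hP
    have hP0 : 0 < P := by positivity
    have hin : innerWeight f g l y ≤ ENNReal.ofReal (c₂ * 4 * P) := by
      have h1 : innerWeight f g l y ≤
          ∫⁻ x in Ioc 0 (f (k + 1)), stepSum 1 f g l x * ENNReal.ofReal x⁻¹ :=
        lintegral_mono_set fun x hx => ⟨hx.1, (hx.2.trans hyk).le⟩
      refine h1.trans ((hfg.lintegral_Ioc_inv_le hf hg hlp k).trans (ENNReal.ofReal_le_ofReal ?_))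
      refine h2k.trans ?_
      have : f k ^ (p - 1) ≤ y ^ (p - 1) := Real.rpow_le_rpow hfk.le hky (by linarith)
      calc c₂ * (f k ^ (p - 1) * l k) ≤ c₂ * (y ^ (p - 1) * (4 * lam)) := by gcongr
        _ = _ := by rw [hP]; ring
    have hyr : 0 ≤ y ^ (r - 1) := by positivity
    have hmix : y ^ (r - 1) * y ^ (p - r) = y ^ (p - 1) := by
      rw [← Real.rpow_add hy]; congr 1; ring
    have hout : outerWeight r f g l y ≤ ENNReal.ofReal
        ((2 ^ (r - p) * c₃ * 4 / (r - 1) + (c₄ * 4 / (r - 1) + c₃ * 16 / (r - 1))) * P) := by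
      rw [outerWeight]
      rcases le_or_gt (f (k + 1)) (2 * f k) with hcase | hcase
      · have h1 : ∫⁻ x in Ioi y, stepSum 1 f g l x * ENNReal.ofReal (x ^ (-r))
            ≤ ENNReal.ofReal (c₃ * (f k ^ (p - r) * l k) / (r - 1)) :=
          (lintegral_mono_set (Ioi_subset_Ioi hky)).trans
            ((hfg.lintegral_Ioi_rpow_le hf hg hlp (by linarith) hk1).trans
              (ENNReal.ofReal_le_ofReal (by gcongr)))
        refine (mul_le_mul_right h1 _).trans ?_
        rw [← ENNReal.ofReal_mul hyr]
        refine ENNReal.ofReal_le_ofReal ?_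
        have h5 : f k ^ (p - r) ≤ 2 ^ (r - p) * y ^ (p - r) := by
          calc f k ^ (p - r) ≤ (y / 2) ^ (p - r) :=
                Real.rpow_le_rpow_of_nonpos (by positivity) (by linarith) (by linarith)
            _ = 2 ^ (r - p) * y ^ (p - r) := by
                rw [Real.div_rpow hy.le (by norm_num), show r - p = -(p - r) by ring,
                  Real.rpow_neg (by norm_num : (0 : ℝ) ≤ 2)]
                field_simp
        calc y ^ (r - 1) * (c₃ * (f k ^ (p - r) * l k) / (r - 1))
            ≤ y ^ (r - 1) * (c₃ * (2 ^ (r - p) * y ^ (p - r) * (4 * lam)) / (r - 1)) := by gcongr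
          _ = (2 ^ (r - p) * c₃ * 4 / (r - 1)) * (y ^ (r - 1) * y ^ (p - r) * lam) := by ring
          _ = (2 ^ (r - p) * c₃ * 4 / (r - 1)) * P := by rw [hmix]
          _ ≤ _ := by
              gcongr
              have : 0 ≤ c₄ * 4 / (r - 1) + c₃ * 16 / (r - 1) := by positivity
              linarith
      · have hw : weightSum 1 f g l k ≤ c₄ * (f k ^ (p - 1) * l k) := by
          have h5 : (f (k + 1) - f k) * weightSum 1 f g l k ≤ c₄ * (f k ^ p * l k) := by
            refine le_trans ?_ h4k
            refine Finset.single_le_sum (f := fun m => (f (m + 1) - f m) * weightSum 1 f g l m)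
              (fun m hm => ?_) (Finset.mem_Icc.2 ⟨hk1, le_rfl⟩)
            exact mul_nonneg (sub_nonneg.2 (hfg.c1_mono m (Finset.mem_Icc.1 hm).1))
              (weightSum_nonneg hf hg hlp 1 m)
          have h6 : f k * weightSum 1 f g l k ≤ (f (k + 1) - f k) * weightSum 1 f g l k := by
            gcongr; linarith
          have h7 : f k ^ p = f k * f k ^ (p - 1) := by
            rw [Real.rpow_sub_one hfk.ne']; field_simp
          have h8 : f k * weightSum 1 f g l k ≤ f k * (c₄ * (f k ^ (p - 1) * l k)) := by
            refine (h6.trans h5).trans (le_of_eq ?_)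
            rw [h7]; ring
          exact le_of_mul_le_mul_left h8 hfk
        have h1 : ∫⁻ x in Ioi y, stepSum 1 f g l x * ENNReal.ofReal (x ^ (-r))
            ≤ ENNReal.ofReal (weightSum 1 f g l k * (y ^ (1 - r) / (r - 1)))
              + ENNReal.ofReal (c₃ * (f (k + 1) ^ (p - r) * l ((k + 1 : ℕ) : ℝ)) / (r - 1)) := by
          rw [← Ioc_union_Ioi_eq_Ioi hyk.le]
          refine (lintegral_union_le _ _ _).trans (add_le_add ?_ ?_)
          · refine lintegral_Ioc_stepSum_mul_le hf hg hlp hfg.c1_mono 1 le_rfl ?_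
            rw [lintegral_Ioc_rpow_neg (by linarith) hy hyk.le]
            refine ENNReal.ofReal_le_ofReal ?_
            have : 0 ≤ f (k + 1) ^ (1 - r) := by positivity
            gcongr
            linarith
          · exact (hfg.lintegral_Ioi_rpow_le hf hg hlp (by linarith) (by omega)).trans
              (ENNReal.ofReal_le_ofReal (by gcongr))
        refine (mul_le_mul_right h1 _).trans ?_
        rw [← ENNReal.ofReal_add (by positivity) (by positivity), ← ENNReal.ofReal_mul hyr]
        refine ENNReal.ofReal_le_ofReal ?_
        have h9 : y ^ (r - 1) * y ^ (1 - r) = 1 := by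
          rw [← Real.rpow_add hy]; simp
        have h10 : f k ^ (p - 1) ≤ y ^ (p - 1) := Real.rpow_le_rpow hfk.le hky (by linarith)
        have h11 : f (k + 1) ^ (p - r) ≤ y ^ (p - r) :=
          Real.rpow_le_rpow_of_nonpos hy hyk.le (by linarith)
        calc y ^ (r - 1) * (weightSum 1 f g l k * (y ^ (1 - r) / (r - 1))
              + c₃ * (f (k + 1) ^ (p - r) * l ((k + 1 : ℕ) : ℝ)) / (r - 1))
            = (y ^ (r - 1) * y ^ (1 - r)) * (weightSum 1 f g l k / (r - 1))
              + y ^ (r - 1) * (c₃ * (f (k + 1) ^ (p - r) * l ((k + 1 : ℕ) : ℝ)) / (r - 1)) := by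
              ring
          _ ≤ 1 * (c₄ * (y ^ (p - 1) * (4 * lam)) / (r - 1))
              + y ^ (r - 1) * (c₃ * (y ^ (p - r) * (16 * lam)) / (r - 1)) := by
              rw [h9]
              gcongr
              exact hw.trans (by gcongr)
          _ = (c₄ * 4 / (r - 1)) * P
              + (c₃ * 16 / (r - 1)) * (y ^ (r - 1) * y ^ (p - r) * lam) := by rw [hP]; ring
          _ = (c₄ * 4 / (r - 1) + c₃ * 16 / (r - 1)) * P := by rw [hmix]; ring
          _ ≤ _ := by
              have : 0 ≤ 2 ^ (r - p) * c₃ * 4 / (r - 1) := by positivity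
              exact mul_le_mul_of_nonneg_right (by linarith) hP0.le
    calc ENNReal.ofReal y * (innerWeight f g l y + outerWeight r f g l y)
        ≤ ENNReal.ofReal y * (ENNReal.ofReal (c₂ * 4 * P) + ENNReal.ofReal
          ((2 ^ (r - p) * c₃ * 4 / (r - 1) + (c₄ * 4 / (r - 1) + c₃ * 16 / (r - 1))) * P)) := by
          gcongr
      _ = ENNReal.ofReal (C * (y * P)) := by
          rw [← ENNReal.ofReal_add (by positivity) (by positivity), ← ENNReal.ofReal_mul hy.le]
          congr 1; rw [hC]; ring
      _ ≤ _ := by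
          refine ENNReal.ofReal_le_ofReal ?_
          have h12 : y * P = y ^ p * lam := by
            rw [hP, Real.rpow_sub_one hy.ne']; field_simp
          rw [h12]
          gcongr
          exact le_max_right _ _
  set C₀ := C * (f K ^ p * max 1 (l (finv (f K)))) with hC₀
  have hfK := hf K hK1
  have hC₀0 : 0 ≤ C₀ := by
    have : 0 < max 1 (l (finv (f K))) := lt_of_lt_of_le one_pos (le_max_left _ _)
    positivity
  have hcover : ∀ y, f K ≤ y → ENNReal.ofReal y * (innerWeight f g l y + outerWeight r f g l y)
        ≤ ENNReal.ofReal (C * (y ^ p * max 1 (l (finv y)))) := by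
    classical
    intro y hy
    have hex : ∃ j, y < f (K + j + 1) := by
      obtain ⟨n, hn, hk⟩ :=
        ((hfg.c1_atTop.eventually_gt_atTop y).and (eventually_ge_atTop (K + 1))).exists
      exact ⟨n - K - 1, by rw [show K + (n - K - 1) + 1 = n by omega]; exact hn⟩
    refine key (K + Nat.find hex) (by omega) y ?_ (Nat.find_spec hex)
    rcases Nat.eq_zero_or_pos (Nat.find hex) with h0 | h0
    · rw [h0]; exact hy
    · have := Nat.find_min hex (m := Nat.find hex - 1) (by omega)
      rw [show K + (Nat.find hex - 1) + 1 = K + Nat.find hex by omega] at this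
      exact not_lt.1 this
  refine ⟨C₀, C, hC₀0, hC0, fun y hy => ?_⟩
  have hm0 : 0 ≤ C * (y ^ p * max 1 (l (finv y))) := by
    have : 0 < max 1 (l (finv y)) := lt_of_lt_of_le one_pos (le_max_left _ _)
    positivity
  rcases le_total (f K) y with h | h
  · exact (hcover y h).trans (ENNReal.ofReal_le_ofReal (by linarith))
  · refine le_trans ?_ ((hcover (f K) le_rfl).trans (ENNReal.ofReal_le_ofReal (by linarith)))
    gcongr
    · exact innerWeight_mono f g l h
    · exact outerWeight_mono r f g l hy h

end RateConditions

theorem tsum_mul_setLIntegral_Ioi {f : ℕ → ℝ} (hf : ∀ n : ℕ, 1 ≤ n → 0 < f n) (g : ℕ → ℝ)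
    (l : ℝ → ℝ) (q : ℝ) {U : ℝ → ENNReal} (hU : Measurable U) :
    ∑' n : ℕ, ENNReal.ofReal
        (((n + 1 : ℕ) : ℝ) ^ q * g (n + 1) * l ((n + 1 : ℕ) : ℝ) / f (n + 1))
          * ∫⁻ x in Ioi (f (n + 1)), U x
      = ∫⁻ x in Ioi (0 : ℝ), stepSum q f g l x * U x := by
  simp only [stepSum, ← ENNReal.tsum_mul_right]
  have hm : ∀ n : ℕ, Measurable fun x => (Ioi (f (n + 1))).indicator (fun _ => ENNReal.ofReal
      (((n + 1 : ℕ) : ℝ) ^ q * g (n + 1) * l ((n + 1 : ℕ) : ℝ) / f (n + 1))) x * U x := fun n =>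
    (measurable_const.indicator measurableSet_Ioi).mul hU
  rw [lintegral_tsum fun n => (hm n).aemeasurable]
  refine tsum_congr fun n => ?_
  have h1 : Ioi (f (n + 1)) ∩ Ioi 0 = Ioi (f (n + 1)) :=
    inter_eq_left.2 (Ioi_subset_Ioi (hf _ (by omega)).le)
  rw [← lintegral_const_mul' _ _ ENNReal.ofReal_ne_top, ← h1,
    ← Measure.restrict_restrict measurableSet_Ioi, ← lintegral_indicator measurableSet_Ioi, h1]
  refine lintegral_congr fun x => ?_
  by_cases hx : x ∈ Ioi (f (n + 1))
  · rw [indicator_of_mem hx, indicator_of_mem hx]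
  · rw [indicator_of_notMem hx, indicator_of_notMem hx, zero_mul]

namespace SublinearExpectation

variable {Ω : Type*} [MeasurableSpace Ω] (S : SublinearExpectation Ω)

theorem capacity_not_summable_eq_zero (hV : S.CapacityCountablySubadditive) {a : ℤ → ℝ}
    (ha : Summable fun i => |a i|) {Z : ℤ → Ω → ℝ} (hZ : ∀ i, (fun ω => |Z i ω|) ∈ S.H) {K : ℝ}
    (hK : 0 ≤ K) (hE : ∀ i, S.E (fun ω => |Z i ω|) ≤ (K : EReal)) :
    S.capacity {ω | ¬ Summable fun i => a i * Z i ω} = 0 := by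
  refine le_antisymm (EReal.toENNReal_eq_zero_iff.1 ?_) (S.capacity_nonneg _)
  set A := ∑' i, |a i| + 1 with hA
  have hA0 : 0 < A := by
    have : 0 ≤ ∑' i, |a i| := tsum_nonneg fun i => abs_nonneg _
    linarith
  have hle : ∀ x : ℝ, 0 < x →
      S.cap {ω | ¬ Summable fun i => a i * Z i ω} ≤ ENNReal.ofReal (4 * K * A / x) := by
    intro x hx
    refine (S.cap_mono fun ω hω => ?_).trans (S.cap_tsum_int_lt_le hV ha (fun i => abs_nonneg _) hA0
      (by linarith : _ ≤ A) hK hx hZ (fun i ω => abs_nonneg _) hE)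
    rw [mem_ofPred_eq] at hω ⊢
    by_contra hcon
    have h1 := (summable_and_tsum_le_of_ofReal
      (fun i => mul_nonneg (abs_nonneg (a i)) (abs_nonneg (Z i ω))) hx.le (not_lt.1 hcon)).1
    refine hω (Summable.of_abs ?_)
    simpa only [abs_mul] using h1
  have ht : Tendsto (fun x : ℝ => ENNReal.ofReal (4 * K * A / x)) atTop (𝓝 0) := by
    have := ENNReal.tendsto_ofReal (tendsto_const_nhds.div_atTop tendsto_id :
      Tendsto (fun x : ℝ => 4 * K * A / x) atTop (𝓝 0))
    simpa using this
  exact le_antisymm (ge_of_tendsto ht ((eventually_gt_atTop 0).mono hle)) zero_le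

/-- The Choquet integral of the excess over `ε b` in terms of the tail above `b`. -/
theorem toENNReal_choquet_excess_le (X : Ω → ℝ) {ε : ℝ} (hε : 0 < ε) (b : ℝ) :
    (S.choquet fun ω => max (X ω - ε * b) 0).toENNReal
      ≤ ENNReal.ofReal ε * ∫⁻ x in Ioi b, S.cap {ω | ε * x < X ω} := by
  rw [S.choquet_of_nonneg fun ω => le_max_right _ _, EReal.toENNReal_coe,
    setLIntegral_Ioi_affine _ hε b 0]
  gcongr ENNReal.ofReal ε * ?_
  refine setLIntegral_mono' measurableSet_Ioi fun x hx => S.cap_mono fun ω hω => ?_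
  rw [mem_ofPred_eq] at hω ⊢
  have hx' := mul_pos hε (sub_pos.2 (mem_Ioi.1 hx))
  rcases lt_max_iff.1 hω with h | h <;> linarith

theorem lintegral_cap_affine_lt_top {h : Ω → ℝ} {C₀ C : ℝ} (hC₀ : 0 ≤ C₀) (hC : 0 < C)
    (hh : ∫⁻ t in Ioi (0 : ℝ), S.cap {ω | t < h ω} < ⊤) :
    ∫⁻ t in Ioi (0 : ℝ), S.cap {ω | t < C₀ + C * h ω} < ⊤ := by
  rw [← Ioc_union_Ioi_eq_Ioi hC₀]
  refine (lintegral_union_le _ _ _).trans_lt (ENNReal.add_lt_top.2 ⟨?_, ?_⟩)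
  · calc ∫⁻ t in Ioc (0 : ℝ) C₀, S.cap {ω | t < C₀ + C * h ω} ≤ ∫⁻ t in Ioc (0 : ℝ) C₀, 1 :=
          lintegral_mono fun t => S.cap_le_one _
      _ < ⊤ := by simp
  · rw [setLIntegral_Ioi_affine _ hC 0 C₀]
    refine ENNReal.mul_lt_top ENNReal.ofReal_lt_top (lt_of_le_of_lt (lintegral_mono fun x =>
      S.cap_mono fun ω hω => ?_) hh)
    rw [mem_ofPred_eq] at hω ⊢
    have : C * x < C * h ω := by linarith
    exact lt_of_mul_lt_mul_left this hC.le

theorem lintegral_rpow_mul_tail_lt_top {X h : Ω → ℝ} {p : ℝ} (hp : 1 ≤ p)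
    (hX : ∀ ω, |X ω| ^ p ≤ h ω) (hh : ∫⁻ t in Ioi (0 : ℝ), S.cap {ω | t < h ω} < ⊤) :
    ∫⁻ y in Ioi (0 : ℝ), ENNReal.ofReal (y ^ (p - 1)) * S.tail X y < ⊤ := by
  refine lt_of_le_of_lt ?_ hh
  rw [setLIntegral_Ioi_rpow (fun t => S.cap {ω | t < h ω}) (by linarith : 0 < p)]
  refine setLIntegral_mono' measurableSet_Ioi fun y hy => ?_
  have hy0 : 0 < y := hy
  refine mul_le_mul' (ENNReal.ofReal_le_ofReal ?_) (S.cap_mono fun ω hω => ?_)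
  · exact le_mul_of_one_le_left (by positivity) hp
  · rw [mem_ofPred_eq] at hω ⊢
    exact lt_of_lt_of_le (Real.rpow_lt_rpow hy0.le hω (by linarith)) (hX ω)

/-- Integrability of the weights against the tail of the common distribution. -/
theorem lintegral_weight_mul_tail_lt_top {p r : ℝ} {f g : ℕ → ℝ} {l : ℝ → ℝ}
    (hfg : RateConditions p r f g l) (hf : ∀ n : ℕ, 1 ≤ n → 0 < f n)
    (hg : ∀ n : ℕ, 1 ≤ n → 0 < g n) (hl : SlowlyVarying l) {finv : ℝ → ℝ}
    (hfinv : IsInverseSeq f finv) (hp : 1 ≤ p) (hr : 2 ≤ r) (hpr : p ≤ r) {X : Ω → ℝ}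
    (hX : ∫⁻ t in Ioi (0 : ℝ), S.cap {ω | t < |X ω| ^ p * max 1 (l (finv |X ω|))} < ⊤) :
    ∫⁻ y in Ioi (0 : ℝ), (innerWeight f g l y + outerWeight r f g l y) * S.tail X y < ⊤ := by
  obtain ⟨C₀, C, hC₀, hC, hb⟩ := hfg.exists_weight_le hf hg hl hfinv hp hr hpr
  have hmeas : Measurable fun y => innerWeight f g l y + outerWeight r f g l y := by
    refine (innerWeight_mono f g l).measurable.add (Measurable.mul (by fun_prop) ?_)
    exact Antitone.measurable fun y z h => lintegral_mono_set (Ioi_subset_Ioi h)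
  refine lt_of_le_of_lt (lintegral_mul_le_of_forall_lt (S.antitone_tail X)
    (S.antitone_cap fun ω => C₀ + C * (|X ω| ^ p * max 1 (l (finv |X ω|))))
    (S.tail_le_one X) (fun t => S.cap_le_one _) hmeas fun y t hy ht hlt => ?_)
    (S.lintegral_cap_affine_lt_top hC₀ hC hX)
  refine S.cap_mono fun ω hω => ?_
  rw [mem_ofPred_eq] at hω ⊢
  have hz : 0 < |X ω| := hy.trans hω
  have h1 : ENNReal.ofReal t
      < ENNReal.ofReal (C₀ + C * (|X ω| ^ p * max 1 (l (finv |X ω|)))) := by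
    refine hlt.trans_le (le_trans ?_ (hb _ hz))
    calc ∫⁻ z in Ioc 0 y, (innerWeight f g l z + outerWeight r f g l z)
        ≤ ∫⁻ z in Ioc 0 y, (innerWeight f g l y + outerWeight r f g l y) :=
          setLIntegral_mono' measurableSet_Ioc fun z hz =>
            add_le_add (innerWeight_mono f g l hz.2) (outerWeight_mono r f g l hz.1 hz.2)
      _ = ENNReal.ofReal y * (innerWeight f g l y + outerWeight r f g l y) := by
          rw [setLIntegral_const, Real.volume_Ioc, sub_zero, mul_comm]
      _ ≤ _ := by
          refine mul_le_mul' (ENNReal.ofReal_le_ofReal hω.le) (add_le_add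
            (innerWeight_mono f g l hω.le) (outerWeight_mono r f g l hy hω.le))
  exact (ENNReal.ofReal_lt_ofReal_iff_of_nonneg ht.le).1 h1

end SublinearExpectation

theorem theorem3p1 {Ω : Type*} [MeasurableSpace Ω] (S : SublinearExpectation Ω)
    (hS : S.CountablySubadditive) (hV : S.CapacityCountablySubadditive)
    (l : ℝ → ℝ) (hl : SlowlyVarying l)
    (a : ℤ → ℝ) (ha : Summable (fun i => |a i|))
    (p r : ℝ) (hp : 1 ≤ p) (hr : max 2 p ≤ r)
    (f g : ℕ → ℝ) (hf : ∀ n : ℕ, 1 ≤ n → 0 < f n) (hg : ∀ n : ℕ, 1 ≤ n → 0 < g n)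
    (hfg : RateConditions p r f g l)
    (finv : ℝ → ℝ) (hfinv : IsInverseSeq f finv)
    (Y : ℤ → Ω → ℝ) (hY : ∀ i, Y i ∈ S.H) (hYnd : S.NegDepSeq Y)
    (Y₀ : Ω → ℝ) (hY₀ : Y₀ ∈ S.H) (hYid : ∀ i, S.IdentDistributed (Y i) Y₀)
    (hmean : S.E Y₀ = 0) (hmean' : S.E (fun ω => -Y₀ ω) = 0)
    (hmoment : S.choquet (fun ω => |Y₀ ω| ^ p * max 1 (l (finv |Y₀ ω|))) < ⊤) :
    (∀ n : ℕ, 1 ≤ n → S.capacity {ω | ¬ Summable (fun i : ℤ => a i * Y (i + n) ω)} = 0) ∧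
    ∀ ε : ℝ, 0 < ε →
      ∑' n : ℕ, ENNReal.ofReal (g (n + 1) * l ((n + 1 : ℕ) : ℝ) / f (n + 1)) *
        (S.choquet (fun ω =>
          max (maxPartialSum (movingAverage a Y) (n + 1) ω - ε * f (n + 1)) 0)).toENNReal < ⊤ := by
  have hr2 : 2 ≤ r := (le_max_left _ _).trans hr
  have hpr : p ≤ r := (le_max_right _ _).trans hr
  have hmom : ∫⁻ t in Ioi (0 : ℝ), S.cap {ω | t < |Y₀ ω| ^ p * max 1 (l (finv |Y₀ ω|))} < ⊤ := by
    rw [S.choquet_of_nonneg fun ω => by positivity,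
      ← EReal.coe_ennreal_top, EReal.coe_ennreal_lt_coe_ennreal_iff] at hmoment
    exact hmoment
  have hG : ∫⁻ y in Ioi (0 : ℝ), ENNReal.ofReal (y ^ (p - 1)) * S.tail Y₀ y < ⊤ :=
    S.lintegral_rpow_mul_tail_lt_top hp
      (fun ω => le_mul_of_one_le_right (by positivity) (le_max_left _ _)) hmom
  refine ⟨fun n _ => ?_, fun ε hε => ?_⟩
  · have habs : ∀ j, (fun ω => |Y j ω|) ∈ S.H := fun j =>
      S.comp_mem_one (φ := fun y => |y|) (hY j)
        (LocLip.of_lipschitz (L := 1) fun x y => by rw [one_mul]; exact abs_abs_sub_abs_le x y)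
    refine S.capacity_not_summable_eq_zero hV ha (Z := fun i => Y (i + n)) (fun i => habs _)
      (K := (∫⁻ y in Ioi (0 : ℝ), S.tail Y₀ y).toReal) ENNReal.toReal_nonneg fun i => ?_
    refine S.E_le_of_toENNReal_le ENNReal.toReal_nonneg ?_
    rw [ENNReal.ofReal_toReal (S.lintegral_tail_lt_top hp hG).ne]
    have := S.toENNReal_E_excess_le hS (hY (i + n)) hY₀ (hYid _) 0
    have hmax : ∀ y : ℝ, max |y| 0 = |y| := fun y => max_eq_left (abs_nonneg y)
    simpa only [sub_zero, hmax] using this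
  · obtain ⟨C, hC, hcap⟩ := S.exists_cap_maxPartialSum_le_tail hS hV hY hYnd hY₀ hYid hmean hmean' ha
      hp hr2 hε hG
    have hvm : Measurable (S.tail Y₀) := (S.antitone_tail Y₀).measurable
    set m : ℝ → ENNReal := fun x => ∫⁻ y in Ioi x, S.tail Y₀ y with hm
    set β : ℝ → ENNReal := fun x =>
      ∫⁻ y in Ioo 0 x, ENNReal.ofReal (y ^ (r - 1)) * S.tail Y₀ y with hβ
    have hmm : Measurable m :=
      Antitone.measurable fun y z h => lintegral_mono_set (Ioi_subset_Ioi h)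
    have hβm : Measurable β :=
      Monotone.measurable fun y z h => lintegral_mono_set (Ioo_subset_Ioo_right h)
    have hm1 : Measurable fun x : ℝ => ENNReal.ofReal x⁻¹ := by fun_prop
    have hm2 : Measurable fun x : ℝ => ENNReal.ofReal (x ^ (-r)) := by fun_prop
    have hm3 : Measurable fun x : ℝ => ENNReal.ofReal (x ^ (r - 1)) := by fun_prop
    set U : ℝ → ENNReal := fun x =>
      ENNReal.ofReal x⁻¹ * m x + ENNReal.ofReal (x ^ (-r)) * β x with hU
    set U' : ℝ → ENNReal := fun x => ENNReal.ofReal (x ^ (max 0 (2 - p) * r / 2 - r)) with hU'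
    have hUm : Measurable U := (hm1.mul hmm).add (hm2.mul hβm)
    have hU'm : Measurable U' := by fun_prop
    have hterm : ∀ n : ℕ, ENNReal.ofReal (g (n + 1) * l ((n + 1 : ℕ) : ℝ) / f (n + 1)) *
        (S.choquet (fun ω =>
          max (maxPartialSum (movingAverage a Y) (n + 1) ω - ε * f (n + 1)) 0)).toENNReal
        ≤ ENNReal.ofReal ε * ENNReal.ofReal C * (ENNReal.ofReal
            (((n + 1 : ℕ) : ℝ) ^ (1 : ℝ) * g (n + 1) * l ((n + 1 : ℕ) : ℝ) / f (n + 1))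
              * (∫⁻ x in Ioi (f (n + 1)), U x)
          + ENNReal.ofReal
            (((n + 1 : ℕ) : ℝ) ^ (r / 2) * g (n + 1) * l ((n + 1 : ℕ) : ℝ) / f (n + 1))
              * ∫⁻ x in Ioi (f (n + 1)), U' x) := by
      intro n
      have hfn := hf (n + 1) (by omega)
      have hgn := hg (n + 1) (by omega)
      have hln := hl.pos ((n + 1 : ℕ) : ℝ) (Nat.cast_nonneg _)
      set w := g (n + 1) * l ((n + 1 : ℕ) : ℝ) / f (n + 1) with hw
      have hw0 : 0 ≤ w := by positivity
      have hq : ∀ q : ℝ, ENNReal.ofReal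
          (((n + 1 : ℕ) : ℝ) ^ q * g (n + 1) * l ((n + 1 : ℕ) : ℝ) / f (n + 1))
          = ENNReal.ofReal w * ENNReal.ofReal (((n + 1 : ℕ) : ℝ) ^ q) := fun q => by
        rw [← ENNReal.ofReal_mul hw0, hw]; congr 1; ring
      have h1 : ∫⁻ x in Ioi (f (n + 1)),
            S.cap {ω | ε * x < maxPartialSum (movingAverage a Y) (n + 1) ω}
          ≤ ENNReal.ofReal C * (ENNReal.ofReal ((n + 1 : ℕ) : ℝ) * (∫⁻ x in Ioi (f (n + 1)), U x)
            + ENNReal.ofReal (((n + 1 : ℕ) : ℝ) ^ (r / 2)) * ∫⁻ x in Ioi (f (n + 1)), U' x) := by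
        rw [← lintegral_const_mul _ hUm, ← lintegral_const_mul _ hU'm,
          ← lintegral_add_left (hUm.const_mul _), ← lintegral_const_mul' _ _ ENNReal.ofReal_ne_top]
        exact setLIntegral_mono' measurableSet_Ioi fun x hx =>
          hcap (n + 1) x (by omega) (hfn.trans hx)
      calc _ ≤ ENNReal.ofReal w * (ENNReal.ofReal ε * (ENNReal.ofReal C *
            (ENNReal.ofReal ((n + 1 : ℕ) : ℝ) * (∫⁻ x in Ioi (f (n + 1)), U x)
            + ENNReal.ofReal (((n + 1 : ℕ) : ℝ) ^ (r / 2)) * ∫⁻ x in Ioi (f (n + 1)), U' x))) := by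
            gcongr
            exact (S.toENNReal_choquet_excess_le _ hε _).trans (by gcongr)
        _ = _ := by rw [hq, hq, Real.rpow_one]; ring
    refine lt_of_le_of_lt (ENNReal.tsum_le_tsum hterm) ?_
    rw [ENNReal.tsum_mul_left, ENNReal.tsum_add, tsum_mul_setLIntegral_Ioi hf g l 1 hUm,
      tsum_mul_setLIntegral_Ioi hf g l (r / 2) hU'm]
    refine ENNReal.mul_lt_top (ENNReal.mul_lt_top ENNReal.ofReal_lt_top ENNReal.ofReal_lt_top)
      (ENNReal.add_lt_top.2 ⟨?_, hfg.lintegral_stepSum_half_lt_top hf hg hl.pos (by linarith)⟩)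
    have hW := measurable_stepSum 1 f g l
    have hsplit : ∫⁻ x in Ioi (0 : ℝ), stepSum 1 f g l x * U x
        = ∫⁻ y in Ioi (0 : ℝ), (innerWeight f g l y + outerWeight r f g l y) * S.tail Y₀ y := by
      have e1 : ∫⁻ x in Ioi (0 : ℝ), stepSum 1 f g l x * (ENNReal.ofReal x⁻¹ * m x)
          = ∫⁻ y in Ioi (0 : ℝ), innerWeight f g l y * S.tail Y₀ y := by
        simp only [← mul_assoc]
        exact lintegral_mul_lintegral_Ioi (hW.mul hm1) hvm
      have e2 : ∫⁻ x in Ioi (0 : ℝ), stepSum 1 f g l x * (ENNReal.ofReal (x ^ (-r)) * β x)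
          = ∫⁻ y in Ioi (0 : ℝ), outerWeight r f g l y * S.tail Y₀ y := by
        have h := lintegral_mul_lintegral_Ioi (hm3.mul hvm) (hW.mul hm2)
        simp only [Pi.mul_apply] at h
        calc _ = ∫⁻ x in Ioi (0 : ℝ), β x * (stepSum 1 f g l x * ENNReal.ofReal (x ^ (-r))) :=
              lintegral_congr fun x => by ring
          _ = _ := h.symm
          _ = _ := lintegral_congr fun y => by rw [outerWeight]; ring
      simp only [hU, mul_add, add_mul]
      have k1 : Measurable fun x => stepSum 1 f g l x * (ENNReal.ofReal x⁻¹ * m x) :=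
        hW.mul (hm1.mul hmm)
      have k2 : Measurable fun y => innerWeight f g l y * S.tail Y₀ y :=
        (innerWeight_mono f g l).measurable.mul hvm
      rw [lintegral_add_left k1, lintegral_add_left k2, e1, e2]
    rw [hsplit]
    exact S.lintegral_weight_mul_tail_lt_top hfg hf hg hl hfinv hp hr2 hpr hmom
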